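/- **Setting.** Let $\mathcal D$ be an unknown distribution of triples $(x,m,\ell)$ with $x$ in a context space $\mathcal X$ and $m,\ell\in[0,1]^K$. In each round $t=1,\dots,T$ ($T\ge 1$) a triple $(x_t,m_t,\ell_t)\sim\mathcal D$ is drawn independently; the learner sees $x_t$ and $m_t$, draws an action $a_t\in[K]$ and then observes only $\ell_t(a_t)$. Let $\Pi\subseteq[K]^{\mathcal X}$ be a finite policy class with $N=|\Pi|\ge 2$, and put $d=K\ln N$, $$\mathcal E=T\,\mathbb E_{(x,m,\ell)\sim\mathcal D}\big[\|\ell-m\|_\infty^2\big],\qquad \mathrm{Reg}=\max_{\pi\in\Pi}\mathbb E\Big[\sum_{t=1}^T\ell_t(a_t)-\sum_{t=1}^T\ell_t(\pi(x_t))\Big].$$ The learner has an ERM oracle, which maps any finite collection $S$ of pairs $(x,c)\in\mathcal X\times\mathbb R^K$ to some $\mathrm{ERM}(S)\in\arg\min_{\pi\in\Pi}\sum_{(x,c)\in S}c(\pi(x))$. **Algorithm ($\epsilon$-Greedy.VAR, with integer parameter $1\le B\le T$).** In rounds $1,\dots,B$, draw $a_t$ uniformly from $[K]$. Then let $$\widehat\alpha_i=\frac1B\sum_{t=1}^B\mathbf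 1\big[|\ell_t(a_t)-m_t(a_t)|\in(2^{-i-1},2^{-i}]\big],\qquad \widehat{\mathcal E}=T\sum_{i=0}^{\lceil\log_2T\rceil}\Big[\widehat\alpha_i-\frac{30\ln T}{B}\Big]_+2^{-2i},$$ $\sigma=\sqrt{\widehat{\mathcal E}}\,(dT)^{-1/3}$ and $\mu=\min\{d^{2/3}T^{-1/3},1\}$. In each round $t=B+1,\dots,T$, let $a_t^*\in\arg\min_a m_t(a)$, $\mathcal A_t=\{a:m_t(a)\le m_t(a_t^*)+\sigma\}$, and $\phi_t(a)=a$ if $a\in\mathcal A_t$, $\phi_t(a)=a_t^*$ otherwise. Let $\pi_t=\mathrm{ERM}(\{(x_s,\widetilde\ell_s\circ\phi_s)\}_{B<s<t})$, draw $a_t$ from $$p_t(a)=(1-\mu)\mathbf 1[a=\phi_t(\pi_t(x_t))]+\frac{\mu}{|\mathcal A_t|}\mathbf 1[a\in\mathcal A_t],$$ and set $\widetilde\ell_t(a)=\frac{\ell_t(a)-m_t(a)}{p_t(a)}\mathbf 1[a_t=a]+m_t(a)-m_t(a_t^*)$ for $a\in\mathcal A_t$. Ties in both $\arg\min$'s are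 broken arbitrarily. **Theorem.** There are universal constants $C>0$ and $p\in\mathbb N$ such that, for every choice of the above data and every integer $1\le B\le T$, $\epsilon$-Greedy.VAR guarantees $$\mathrm{Reg}\le C(1+\ln T)^p\Big(B+K\sqrt{\tfrac{\mathcal E T}{B}}+K^2\sqrt{\mathcal E}\,(dT)^{1/3}\Big).$$ Moreover, if $K^2\sqrt{\mathcal E}\,d^{1/3}\ge 1$ (in particular, if $\mathcal E\ge 1$), then with $B=\lceil T^{1/3}\rceil$ it guarantees $$\mathrm{Reg}\le C(1+\ln T)^p\,K^2\sqrt{\mathcal E}\,(dT)^{1/3}.$$ -/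

import Mathlib

open MeasureTheory

/-- What the environment draws in one round: the context `x`, the predicted losses `m` and the
losses `ℓ` of the `K` actions, in this order. -/
abbrev Outcome (X : Type*) (K : ℕ) : Type _ := X × (Fin K → ℝ) × (Fin K → ℝ)

/-- What the learner has seen of a past round: context, predicted losses, the action it played,
and the loss of that action only (bandit feedback). -/
structure Observation (X : Type*) (K : ℕ) where
  context : X
  pred : Fin K → ℝ
  action : Fin K
  loss : ℝ

/-- A randomized learner: from the past observations (in chronological order), the current context
and the current predicted losses it computes the probability of playing each action. -/
abbrev Learner (X : Type*) (K : ℕ) : Type _ :=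
  List (Observation X K) → X → (Fin K → ℝ) → Fin K → ℝ

section Interaction

variable {X : Type*} {K : ℕ}

/-- The feedback for playing action `a` when the outcome of the round is `z = (x, m, ℓ)`. -/
def observe (z : Outcome X K) (a : Fin K) : Observation X K :=
  ⟨z.1, z.2.1, a, z.2.2 a⟩

/-- The observations made before round `t` (rounds are numbered from `0`). -/
def history {T : ℕ} (z : Fin T → Outcome X K) (a : Fin T → Fin K) (t : Fin T) :
    List (Observation X K) :=
  (List.ofFn fun s => observe (z s) (a s)).take t

variable [MeasurableSpace X]

/-- The joint law of the outcomes and of the actions over `T` rounds: the outcomes are i.i.d. with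
distribution `D`, and given the outcomes and the earlier actions, the action of round `t` is drawn
from the distribution computed by the learner (chain rule). -/
noncomputable def interactionLaw (D : Measure (Outcome X K)) (T : ℕ) (alg : Learner X K) :
    Measure ((Fin T → Outcome X K) × (Fin T → Fin K)) :=
  ((Measure.pi fun _ => D).prod Measure.count).withDensity fun w =>
    ENNReal.ofReal (∏ t, alg (history w.1 w.2 t) (w.1 t).1 (w.1 t).2.1 (w.2 t))

/-- Pseudo-regret over `T` rounds against the best policy of a finite class. -/
noncomputable def regret (D : Measure (Outcome X K)) (T : ℕ) (policies : Finset (X → Fin K))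
    (alg : Learner X K) : ℝ :=
  ⨆ π : policies, ∫ w, (∑ t, (w.1 t).2.2 (w.2 t) - ∑ t, (w.1 t).2.2 (π.1 (w.1 t).1))
    ∂(interactionLaw D T alg)

/-- The total prediction error `𝓔 = T · E ‖ℓ - m‖_∞²` (`‖·‖` is the sup norm on `Fin K → ℝ`). -/
noncomputable def predictionError (D : Measure (Outcome X K)) (T : ℕ) : ℝ :=
  T * ∫ z, ‖z.2.2 - z.2.1‖ ^ 2 ∂D

/-- `erm` is an ERM oracle for the class: on every finite list of pairs (context, cost vector) it
returns a policy of the class with the smallest total cost (ties are broken arbitrarily, but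
measurably). -/
structure IsERMOracle (policies : Finset (X → Fin K))
    (erm : List (X × (Fin K → ℝ)) → X → Fin K) : Prop where
  mem : ∀ S : List (X × (Fin K → ℝ)), erm S ∈ policies
  le : ∀ S : List (X × (Fin K → ℝ)), ∀ π ∈ policies,
    (S.map fun q => q.2 (erm S q.1)).sum ≤ (S.map fun q => q.2 (π q.1)).sum
  measurable : ∀ n : ℕ, Measurable fun q : (Fin n → X × (Fin K → ℝ)) × X =>
    erm (List.ofFn q.1) q.2

/-- `best m` is an action with the smallest predicted loss (ties are broken arbitrarily, but
measurably). -/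
structure IsArgmin (best : (Fin K → ℝ) → Fin K) : Prop where
  le : ∀ (m : Fin K → ℝ) (a : Fin K), m (best m) ≤ m a
  measurable : Measurable best

end Interaction

section Algorithm

variable {X : Type*} {K : ℕ}

/-- The actions whose predicted loss exceeds the smallest one by at most `σ`. -/
noncomputable def activeSet (best : (Fin K → ℝ) → Fin K) (σ : ℝ) (m : Fin K → ℝ) :
    Finset (Fin K) :=
  Finset.univ.filter fun a => m a ≤ m (best m) + σ

/-- Action remapping: inactive actions are replaced by the one with the smallest prediction. -/
noncomputable def remap (best : (Fin K → ℝ) → Fin K) (σ : ℝ) (m : Fin K → ℝ) (a : Fin K) :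
    Fin K :=
  if a ∈ activeSet best σ m then a else best m

/-- The action distribution of a round in which the greedy policy is `π`: with probability `1 - μ`
the remapped action of `π`, with probability `μ` a uniformly chosen active action. -/
noncomputable def greedyProb (best : (Fin K → ℝ) → Fin K) (σ μ : ℝ) (π : X → Fin K)
    (x : X) (m : Fin K → ℝ) (a : Fin K) : ℝ :=
  (1 - μ) * (if a = remap best σ m (π x) then 1 else 0)
    + μ / (activeSet best σ m).card * (if a ∈ activeSet best σ m then 1 else 0)

/-- The shifted variance-reduced loss estimator built from an observation in a round in which the
greedy policy was `π`. -/
noncomputable def lossEstimate (best : (Fin K → ℝ) → Fin K) (σ μ : ℝ) (π : X → Fin K)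
    (o : Observation X K) (a : Fin K) : ℝ :=
  (o.loss - o.pred a) / greedyProb best σ μ π o.context o.pred a
      * (if o.action = a then 1 else 0)
    + o.pred a - o.pred (best o.pred)

/-- The data set handed to the ERM oracle after the observations `h`: for every past round `s`, the
pair of the context and the remapped estimator `ℓ̃_s ∘ φ_s`. The greedy policy of each past round is
the oracle's answer on the data set of that time. -/
noncomputable def greedyData (best : (Fin K → ℝ) → Fin K)
    (erm : List (X × (Fin K → ℝ)) → X → Fin K) (σ μ : ℝ) (h : List (Observation X K)) :
    List (X × (Fin K → ℝ)) :=
  h.foldl (fun S o =>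
    S ++ [(o.context, fun a => lossEstimate best σ μ (erm S) o (remap best σ o.pred a))]) []

/-- `ε`-greedy with action remapping, threshold `σ` and exploration probability `μ`. -/
noncomputable def epsGreedyAR (best : (Fin K → ℝ) → Fin K)
    (erm : List (X × (Fin K → ℝ)) → X → Fin K) (σ μ : ℝ) : Learner X K :=
  fun h x m => greedyProb best σ μ (erm (greedyData best erm σ μ h)) x m

/-- The fraction of the `B` observations in `h` with `|ℓ_t(a_t) - m_t(a_t)| ∈ (2^{-i-1}, 2^{-i}]`. -/
noncomputable def binFrequency (B : ℕ) (h : List (Observation X K)) (i : ℕ) : ℝ :=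
  open Classical in
  1 / B * (h.map fun o => if |o.loss - o.pred o.action| ∈
    Set.Ioc ((1 / 2 : ℝ) ^ (i + 1)) ((1 / 2 : ℝ) ^ i) then (1 : ℝ) else 0).sum

/-- The underestimator of the prediction error computed from the `B` observations in `h`. -/
noncomputable def errorEstimate (T B : ℕ) (h : List (Observation X K)) : ℝ :=
  T * ∑ i ∈ Finset.range (⌈Real.logb 2 T⌉₊ + 1),
    max (binFrequency B h i - 30 * Real.log T / B) 0 * (1 / 2 : ℝ) ^ (2 * i)

/-- `ε`-Greedy.VAR: uniform exploration in the first `B` rounds; afterwards a fresh run of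
`ε`-greedy with action remapping, tuned by the error estimate of the first `B` rounds. -/
noncomputable def epsGreedyVAR (T B : ℕ) (d : ℝ) (best : (Fin K → ℝ) → Fin K)
    (erm : List (X × (Fin K → ℝ)) → X → Fin K) : Learner X K :=
  fun h x m a =>
    if h.length < B then 1 / (K : ℝ)
    else
      epsGreedyAR best erm
        (√(errorEstimate T B (h.take B)) * (d * T) ^ (-(1 / 3) : ℝ))
        (min (d ^ (2 / 3 : ℝ) / (T : ℝ) ^ (1 / 3 : ℝ)) 1)
        (h.drop B) x m a

end Algorithm

/-! ### The interaction law, disintegrated round by round -/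

section Play

variable {X : Type*} {K : ℕ}

/-! Fix a comparator π, write v = 𝓔/T, and let L be the mean shifted loss of a remapped policy at
threshold σ. Given the past, a greedy round costs at most (1-μ)(L(π_t) - L(π)) + μ(σ + 2√v) +
bias(σ) + 1/T (`integral_greedyProb_mul_loss_le`): excess risk of the ERM policy, price of exploring
among active actions, loss caused by remapping. An exploration round costs at most 1. All estimates
hold in expectation; no high-probability event is used.

Excess risk. The cost vectors c are unbiased, and the conditional second moment of ‖c‖ is at most V
= 2σ² + 2K²v/μ, because predictions of active actions differ by at most σ. Since e^(-y-y²) ≤ 1 - y +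
y² for every real y, for each policy π' the process exp Σ(η(L(π') - c(π')) - η²‖c‖² - η²V) has mean
at most 1, whatever the size of c. Summing over the N policies controls the data-dependent ERM
policy at price ln N / η; ERM optimality replaces its empirical cost by that of π, which is centred.
Hence after k data points k(L(π_t) - L(π)) is at most a potential of mean at most ln N / η +
2ηk·E[V] (`TwoPhaseSetting.mul_excess_le`, `TwoPhaseSetting.integral_potential_le`). Dividing by k
and summing over rounds gives a harmonic sum (`TwoPhaseSetting.regret_le`). The scale η = d/(K√𝓔)
occurs only in the analysis, so the learner need not know 𝓔.

Remapping. If the comparator's action is inactive, replacing it loses at most twice the larger of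
two prediction errors, minus σ. For the bin with y = 2^(-i) and probability α this costs α(2y - σ)₊
up to a factor K. Either α is of the order of the correction 30 ln T / B, or the empirical frequency
is below α/2, or the bin is detected, which forces σ to be at least of order √(Tαy²)/(dT)^(1/3);
then (2y - σ)₊ ≤ y²/σ suffices. The second case is paid for by the variance of the frequency, and
αy² ≤ 4v always (`mul_max_two_mul_sub_le`, `TwoPhaseSetting.integral_remapBias_le`). Conversely σ is
not too large on average, because the error estimate has mean O(𝓔 ln T) up to constants
(`TwoPhaseSetting.integral_errorEstimate_le`). -/

/-- The outcomes and the actions of `n` rounds. -/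
abbrev Play (X : Type*) (K n : ℕ) : Type _ := (Fin n → Outcome X K) × (Fin n → Fin K)

/-- The observations made during a play. -/
def plays {n : ℕ} (w : Play X K n) : List (Observation X K) :=
  List.ofFn fun s => observe (w.1 s) (w.2 s)

/-- Extend a play by one round. -/
def Play.snoc {n : ℕ} (w : Play X K n) (z : Outcome X K) (a : Fin K) : Play X K (n + 1) :=
  (Fin.snoc (α := fun _ => Outcome X K) w.1 z, Fin.snoc (α := fun _ => Fin K) w.2 a)

@[simp] lemma length_plays {n : ℕ} (w : Play X K n) : (plays w).length = n := by simp [plays]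

lemma plays_snoc {n : ℕ} (w : Play X K n) (z : Outcome X K) (a : Fin K) :
    plays (w.snoc z a) = plays w ++ [observe z a] := by
  rw [plays, List.ofFn_succ_last]
  simp [plays, Play.snoc]

lemma history_eq_take_plays {n : ℕ} (w : Play X K n) (t : Fin n) :
    history w.1 w.2 t = (plays w).take t := rfl

lemma history_snoc_castSucc {n : ℕ} (w : Play X K n) (z : Outcome X K) (a : Fin K) (t : Fin n) :
    history (w.snoc z a).1 (w.snoc z a).2 t.castSucc = history w.1 w.2 t := by
  rw [history_eq_take_plays, history_eq_take_plays, plays_snoc, List.take_append_of_le_length]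
  · rfl
  · simp [t.2.le]

lemma history_snoc_last {n : ℕ} (w : Play X K n) (z : Outcome X K) (a : Fin K) :
    history (w.snoc z a).1 (w.snoc z a).2 (Fin.last n) = plays w := by
  rw [history_eq_take_plays, plays_snoc, List.take_append_of_le_length] <;> simp

/-- The first `k` rounds of a play. -/
def Play.restrict {n : ℕ} (w : Play X K n) (k : ℕ) (h : k ≤ n) : Play X K k :=
  (fun s => w.1 (Fin.castLE h s), fun s => w.2 (Fin.castLE h s))

lemma take_plays {n : ℕ} (w : Play X K n) (k : ℕ) (h : k ≤ n) :
    (plays w).take k = plays (w.restrict k h) := by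
  apply List.ext_getElem
  · simp [h]
  · intro i h1 h2
    simp [plays, Play.restrict]

/-- The data of a round lie in the unit interval. -/
def GoodOutcome (z : Outcome X K) : Prop :=
  ∀ a, z.2.1 a ∈ Set.Icc (0 : ℝ) 1 ∧ z.2.2 a ∈ Set.Icc (0 : ℝ) 1

/-- The data of all rounds of a play lie in the unit interval. -/
def Play.Good {n : ℕ} (w : Play X K n) : Prop := ∀ s, GoodOutcome (w.1 s)

lemma Play.Good.snoc {n : ℕ} {w : Play X K n} (hw : w.Good) {z : Outcome X K}
    (hz : GoodOutcome z) (a : Fin K) : (w.snoc z a).Good := by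
  intro s
  refine Fin.lastCases ?_ (fun i => ?_) s
  · simpa [Play.snoc] using hz
  · simpa [Play.snoc] using hw i

lemma sum_fun_succ {β M : Type*} [Fintype β] [AddCommMonoid M] {n : ℕ}
    (f : (Fin (n + 1) → β) → M) : ∑ a, f a = ∑ a' : Fin n → β, ∑ b, f (Fin.snoc a' b) := by
  rw [← Equiv.sum_comp (Fin.snocEquiv fun _ => β), Fintype.sum_prod_type_right]
  rfl

/-- The probability that the learner plays the actions of `w` on the outcomes of `w`. -/
def playDensity (alg : Learner X K) {n : ℕ} (w : Play X K n) : ℝ :=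
  ∏ t, alg (history w.1 w.2 t) (w.1 t).1 (w.1 t).2.1 (w.2 t)

lemma playDensity_snoc (alg : Learner X K) {n : ℕ} (w : Play X K n) (z : Outcome X K) (a : Fin K) :
    playDensity alg (w.snoc z a) = playDensity alg w * alg (plays w) z.1 z.2.1 a := by
  rw [playDensity, Fin.prod_univ_castSucc, history_snoc_last]
  simp only [history_snoc_castSucc]
  simp [Play.snoc, playDensity]

/-- Forget the last round of a play. -/
def Play.init {n : ℕ} (w : Play X K (n + 1)) : Play X K n := w.restrict n (Nat.le_succ n)

lemma Play.init_snoc {n : ℕ} (w : Play X K n) (z : Outcome X K) (a : Fin K) :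
    Play.init (w.snoc z a) = w := by
  have h : ∀ i : Fin n, Fin.castLE (Nat.le_succ n) i = i.castSucc := fun _ => rfl
  refine Prod.ext ?_ ?_ <;> funext s <;> simp [Play.init, Play.restrict, Play.snoc, h]

lemma Play.Good.init {n : ℕ} {w : Play X K (n + 1)} (hw : w.Good) : w.init.Good :=
  fun _ => hw _

variable [MeasurableSpace X]

/-- A case split over the countably many indices. It handles every place where an action is selected
by the data. -/
lemma measurable_fin_eval {Y β : Type*} [MeasurableSpace Y] [MeasurableSpace β]
    {f : Fin K → Y → β} {g : Y → Fin K} (hf : ∀ b, Measurable (f b)) (hg : Measurable g) :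
    Measurable fun y => f (g y) y := by
  have h : Measurable fun q : Fin K × Y => f q.1 q.2 :=
    measurable_from_prod_countable_right fun b => hf b
  exact h.comp (hg.prodMk measurable_id)

lemma Play.measurable_restrict {n : ℕ} (k : ℕ) (h : k ≤ n) :
    Measurable fun w : Play X K n => w.restrict k h := by
  unfold Play.restrict
  fun_prop

lemma Play.measurable_snoc {n : ℕ} (a : Fin K) :
    Measurable fun q : Play X K n × Outcome X K => q.1.snoc q.2 a := by
  unfold Play.snoc
  refine Measurable.prodMk ?_ ?_
  · refine measurable_pi_lambda _ fun s => ?_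
    refine Fin.lastCases ?_ (fun i => ?_) s
    · simpa using measurable_snd
    · simp only [Fin.snoc_castSucc]; fun_prop
  · refine measurable_pi_lambda _ fun s => ?_
    refine Fin.lastCases ?_ (fun i => ?_) s
    · simp
    · simp only [Fin.snoc_castSucc]; fun_prop

lemma measurableSet_goodOutcome : MeasurableSet {z : Outcome X K | GoodOutcome z} := by
  unfold GoodOutcome
  simp only [Set.ofPred_forall, Set.ofPred_and]
  refine MeasurableSet.iInter fun a => MeasurableSet.inter ?_ ?_
  · exact measurableSet_Icc.preimage (f := fun z : Outcome X K => z.2.1 a) (by fun_prop)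
  · exact measurableSet_Icc.preimage (f := fun z : Outcome X K => z.2.2 a) (by fun_prop)

lemma Play.measurableSet_good {n : ℕ} : MeasurableSet {w : Play X K n | w.Good} := by
  unfold Play.Good
  simp only [Set.ofPred_forall]
  exact MeasurableSet.iInter fun s =>
    measurableSet_goodOutcome.preimage (f := fun w : Play X K n => w.1 s) (by fun_prop)

/-- A learner whose answers are probability distributions, depending measurably on the data. -/
structure IsRandomized (alg : Learner X K) : Prop where
  measurable : ∀ (n : ℕ) (a : Fin K), Measurable fun q : Play X K n × Outcome X K =>
    alg (plays q.1) q.2.1 q.2.2.1 a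
  nonneg : ∀ h x m a, 0 ≤ alg h x m a
  sum_eq_one : ∀ h x m, ∑ a, alg h x m a = 1

variable {alg : Learner X K}

lemma IsRandomized.measurable_density (halg : IsRandomized alg) (n : ℕ) :
    Measurable fun w : Play X K n => playDensity alg w := by
  unfold playDensity
  refine Finset.measurable_prod _ fun t _ => ?_
  refine measurable_fin_eval
    (f := fun a (w : Play X K n) => alg (history w.1 w.2 t) (w.1 t).1 (w.1 t).2.1 a)
    (fun a => ?_) (by fun_prop)
  simp only [history_eq_take_plays]
  have h := fun w : Play X K n => take_plays w t t.2.le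
  simp only [h]
  exact (halg.measurable t a).comp
    ((Play.measurable_restrict _ t.2.le).prodMk (g := fun w : Play X K n => w.1 t) (by fun_prop))

lemma playDensity_nonneg (halg : IsRandomized alg) {n : ℕ} (w : Play X K n) :
    0 ≤ playDensity alg w :=
  Finset.prod_nonneg fun _ _ => halg.nonneg _ _ _ _

lemma measurable_sum_playDensity (halg : IsRandomized alg) (n : ℕ)
    {F : Play X K n → ENNReal} (hF : Measurable F) :
    Measurable fun z : Fin n → Outcome X K =>
      ∑ a, ENNReal.ofReal (playDensity alg (z, a)) * F (z, a) := by
  refine Finset.measurable_sum _ fun a _ => Measurable.mul ?_ ?_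
  · refine Measurable.ennreal_ofReal ?_
    exact (halg.measurable_density n).comp (f := fun z => (z, a)) measurable_prodMk_right
  · exact hF.comp (f := fun z => (z, a)) measurable_prodMk_right

variable {D : Measure (Outcome X K)}

lemma lintegral_interactionLaw (halg : IsRandomized alg) (n : ℕ)
    {F : Play X K n → ENNReal} (hF : Measurable F) :
    ∫⁻ w, F w ∂(interactionLaw D n alg) =
      ∫⁻ z, ∑ a, ENNReal.ofReal (playDensity alg (z, a)) * F (z, a) ∂(Measure.pi fun _ => D) := by
  have hm := (halg.measurable_density n).ennreal_ofReal
  have h : interactionLaw D n alg = ((Measure.pi fun _ => D).prod Measure.count).withDensity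
    fun w => ENNReal.ofReal (playDensity alg w) := rfl
  rw [h, lintegral_withDensity_eq_lintegral_mul _ hm hF, lintegral_prod _ (hm.mul hF).aemeasurable]
  refine lintegral_congr fun z => ?_
  rw [lintegral_count, tsum_fintype]
  rfl

variable [IsProbabilityMeasure D]

lemma measurable_snoc_left {Y : Type*} [MeasurableSpace Y] {n : ℕ} :
    Measurable fun q : (Fin n → Y) × Y => (Fin.snoc q.1 q.2 : Fin (n + 1) → Y) := by
  refine measurable_pi_lambda _ fun s => ?_
  refine Fin.lastCases ?_ (fun i => ?_) s
  · simpa using measurable_snd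
  · simp only [Fin.snoc_castSucc]; fun_prop

lemma lintegral_pi_succ {Y : Type*} [MeasurableSpace Y] (ν : Measure Y) [IsProbabilityMeasure ν]
    (n : ℕ) {G : (Fin (n + 1) → Y) → ENNReal} (hG : Measurable G) :
    ∫⁻ z, G z ∂(Measure.pi fun _ => ν) =
      ∫⁻ z', ∫⁻ z, G (Fin.snoc z' z) ∂ν ∂(Measure.pi fun _ => ν) := by
  have hmp := (measurePreserving_piFinSuccAbove (fun _ : Fin (n + 1) => ν) (Fin.last n)).symm
  have he : ∀ q : Y × (Fin n → Y),
      (MeasurableEquiv.piFinSuccAbove (fun _ => Y) (Fin.last n)).symm q = Fin.snoc q.2 q.1 := by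
    intro q
    change Fin.insertNth (α := fun _ => Y) (Fin.last n) q.1 q.2 = _
    simp
  have h1 := hmp.lintegral_comp hG
  rw [← h1]
  simp only [he]
  exact lintegral_prod_symm _ (hG.comp (measurable_snoc_left.comp measurable_swap)).aemeasurable

/-- The conditional expectation of `F` given the rounds before the last one. -/
noncomputable def condLIntegral (D : Measure (Outcome X K)) (alg : Learner X K) {n : ℕ}
    (F : Play X K (n + 1) → ENNReal) (w : Play X K n) : ENNReal :=
  ∫⁻ z, ∑ a, ENNReal.ofReal (alg (plays w) z.1 z.2.1 a) * F (w.snoc z a) ∂D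

lemma measurable_condLIntegral_integrand (halg : IsRandomized alg) {n : ℕ}
    {F : Play X K (n + 1) → ENNReal} (hF : Measurable F) :
    Measurable fun q : Play X K n × Outcome X K =>
      ∑ a, ENNReal.ofReal (alg (plays q.1) q.2.1 q.2.2.1 a) * F (q.1.snoc q.2 a) :=
  Finset.measurable_sum _ fun a _ =>
    (halg.measurable n a).ennreal_ofReal.mul (hF.comp (Play.measurable_snoc a))

lemma measurable_condLIntegral (halg : IsRandomized alg) {n : ℕ}
    {F : Play X K (n + 1) → ENNReal} (hF : Measurable F) :
    Measurable (condLIntegral D alg F) :=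
  (measurable_condLIntegral_integrand halg hF).lintegral_prod_right'

/-- The tower property: the product density splits off its last factor (`playDensity_snoc`). The
inductions over rounds rest on it. -/
lemma lintegral_interactionLaw_succ (halg : IsRandomized alg) (n : ℕ)
    {F : Play X K (n + 1) → ENNReal} (hF : Measurable F) :
    ∫⁻ w, F w ∂(interactionLaw D (n + 1) alg) =
      ∫⁻ w, condLIntegral D alg F w ∂(interactionLaw D n alg) := by
  have hG := measurable_sum_playDensity halg (n + 1) hF
  rw [lintegral_interactionLaw halg (n + 1) hF,
    lintegral_interactionLaw halg n (measurable_condLIntegral halg hF), lintegral_pi_succ D n hG]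
  refine lintegral_congr fun z' => ?_
  have hin : ∀ a' : Fin n → Fin K, Measurable fun z : Outcome X K =>
      ∑ a, ENNReal.ofReal (alg (plays (z', a')) z.1 z.2.1 a) * F (Play.snoc (z', a') z a) :=
    fun a' => (measurable_condLIntegral_integrand halg hF).comp
      (f := fun z => ((z', a'), z)) measurable_prodMk_left
  simp only [condLIntegral]
  simp_rw [← lintegral_const_mul _ (hin _)]
  rw [← lintegral_finsetSum _ fun a' _ => (hin a').const_mul _]
  refine lintegral_congr fun z => ?_
  rw [sum_fun_succ]
  refine Finset.sum_congr rfl fun a' _ => ?_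
  rw [Finset.mul_sum]
  refine Finset.sum_congr rfl fun a _ => ?_
  rw [← mul_assoc, ← ENNReal.ofReal_mul (playDensity_nonneg halg _), ← playDensity_snoc, Play.snoc]

lemma sum_ofReal_eq_one (halg : IsRandomized alg) (h x m) :
    ∑ a, ENNReal.ofReal (alg h x m a) = 1 := by
  rw [← ENNReal.ofReal_sum_of_nonneg fun a _ => halg.nonneg _ _ _ _, halg.sum_eq_one]
  simp

lemma lintegral_interactionLaw_zero (halg : IsRandomized alg)
    {F : Play X K 0 → ENNReal} (hF : Measurable F) :
    ∫⁻ w, F w ∂(interactionLaw D 0 alg) = F (Fin.elim0, Fin.elim0) := by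
  rw [lintegral_interactionLaw halg _ hF]
  have : ∀ z : Fin 0 → Outcome X K, z = Fin.elim0 := fun z => Subsingleton.elim _ _
  simp only [playDensity, Finset.univ_unique, Finset.prod_of_isEmpty, Finset.sum_singleton]
  rw [lintegral_congr (g := fun _ => F (Fin.elim0, Fin.elim0))]
  · simp
  · intro z
    rw [this z, Subsingleton.elim (default : Fin 0 → Fin K) Fin.elim0]; simp

lemma isProbabilityMeasure_interactionLaw (halg : IsRandomized alg) (n : ℕ) :
    IsProbabilityMeasure (interactionLaw D n alg) := by
  constructor
  rw [← lintegral_one]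
  induction n with
  | zero => exact lintegral_interactionLaw_zero halg measurable_const
  | succ n ih =>
    rw [lintegral_interactionLaw_succ halg n measurable_const]
    simpa [condLIntegral, sum_ofReal_eq_one halg] using ih

lemma ae_good (halg : IsRandomized alg) (hD : ∀ᵐ z ∂D, GoodOutcome z) (n : ℕ) :
    ∀ᵐ w : Play X K n ∂(interactionLaw D n alg), w.Good := by
  induction n with
  | zero => exact ae_of_all _ fun w s => Fin.elim0 s
  | succ n ih =>
    rw [ae_iff]
    have hs : MeasurableSet {w : Play X K (n + 1) | ¬ w.Good} := Play.measurableSet_good.compl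
    rw [← lintegral_indicator_one hs,
      lintegral_interactionLaw_succ halg n (measurable_one.indicator hs), ← lintegral_zero]
    refine lintegral_congr_ae ?_
    filter_upwards [ih] with w hw
    rw [← lintegral_zero]
    refine lintegral_congr_ae ?_
    filter_upwards [hD] with z hz
    refine Finset.sum_eq_zero fun a _ => ?_
    rw [Set.indicator_of_notMem, mul_zero]
    simpa using hw.snoc hz a

/-- The conditional expectation of the real function `f` of the next outcome and action. -/
noncomputable def condExpect (D : Measure (Outcome X K)) (alg : Learner X K)
    (h : List (Observation X K)) (f : Outcome X K → Fin K → ℝ) : ℝ :=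
  ∫ z, ∑ a, alg h z.1 z.2.1 a * f z a ∂D

lemma IsRandomized.measurable_left (halg : IsRandomized alg) {n : ℕ} (w : Play X K n) (a : Fin K) :
    Measurable fun z : Outcome X K => alg (plays w) z.1 z.2.1 a :=
  (halg.measurable n a).comp (f := fun z => (w, z)) measurable_prodMk_left

lemma abs_sum_alg_le (halg : IsRandomized alg) (h : List (Observation X K)) (x : X) (m : Fin K → ℝ)
    {f : Fin K → ℝ} {C : ℝ} (hf : ∀ a, |f a| ≤ C) : |∑ a, alg h x m a * f a| ≤ C := by
  calc |∑ a, alg h x m a * f a| ≤ ∑ a, alg h x m a * C := by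
        refine (Finset.abs_sum_le_sum_abs _ _).trans (Finset.sum_le_sum fun a _ => ?_)
        rw [abs_mul, abs_of_nonneg (halg.nonneg h x m a)]
        exact mul_le_mul_of_nonneg_left (hf a) (halg.nonneg h x m a)
    _ = C := by rw [← Finset.sum_mul, halg.sum_eq_one, one_mul]

lemma integrable_sum_alg (halg : IsRandomized alg) (hD : ∀ᵐ z ∂D, GoodOutcome z) {n : ℕ}
    (w : Play X K n) {f : Outcome X K → Fin K → ℝ} (hf : ∀ a, Measurable fun z => f z a) {C : ℝ}
    (hC : ∀ z, GoodOutcome z → ∀ a, |f z a| ≤ C) :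
    Integrable (fun z => ∑ a, alg (plays w) z.1 z.2.1 a * f z a) D := by
  refine Integrable.of_bound (C := C) ?_ ?_
  · exact (Finset.measurable_sum _ fun a _ =>
      (halg.measurable_left w a).mul (hf a)).aestronglyMeasurable
  · filter_upwards [hD] with z hz
    exact abs_sum_alg_le halg _ _ _ (hC z hz)

/-- Measurable functions of plays which are bounded on good data. -/
structure Tame {n : ℕ} (f : Play X K n → ℝ) : Prop where
  measurable : Measurable f
  bounded : ∃ C : ℝ, ∀ w : Play X K n, w.Good → |f w| ≤ C

lemma Tame.integrable {n : ℕ} {f : Play X K n → ℝ} (hf : Tame f) (halg : IsRandomized alg)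
    (hD : ∀ᵐ z ∂D, GoodOutcome z) : Integrable f (interactionLaw D n alg) := by
  have := isProbabilityMeasure_interactionLaw (D := D) halg n
  obtain ⟨C, hC⟩ := hf.bounded
  refine Integrable.of_bound (C := C) hf.measurable.aestronglyMeasurable ?_
  filter_upwards [ae_good halg hD n] with w hw using hC w hw

/-- Adding a common bound C makes both functions nonnegative on good plays, so the tower property
for `lintegral` applies; C cancels at the end. -/
lemma integral_succ_le (halg : IsRandomized alg) (hD : ∀ᵐ z ∂D, GoodOutcome z) {n : ℕ}
    {f : Play X K (n + 1) → ℝ} {g : Play X K n → ℝ} (hf : Tame f) (hg : Tame g)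
    (h : ∀ w : Play X K n, w.Good →
      condExpect D alg (plays w) (fun z a => f (w.snoc z a)) ≤ g w) :
    ∫ w, f w ∂(interactionLaw D (n + 1) alg) ≤ ∫ w, g w ∂(interactionLaw D n alg) := by
  have hp := isProbabilityMeasure_interactionLaw (D := D) halg n
  have hp' := isProbabilityMeasure_interactionLaw (D := D) halg (n + 1)
  obtain ⟨C₁, hC₁⟩ := hf.bounded
  obtain ⟨C₂, hC₂⟩ := hg.bounded
  set C := max C₁ C₂ with hC
  have hf0 : ∀ w : Play X K (n + 1), w.Good → 0 ≤ f w + C := fun w hw => by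
    have := neg_le_of_abs_le (hC₁ w hw); have := le_max_left C₁ C₂; linarith
  have hg0 : ∀ w : Play X K n, w.Good → 0 ≤ g w + C := fun w hw => by
    have := neg_le_of_abs_le (hC₂ w hw); have := le_max_right C₁ C₂; linarith
  have hfi := hf.integrable halg hD (D := D)
  have hgi := hg.integrable halg hD (D := D)
  have key : ∫ w, (f w + C) ∂(interactionLaw D (n + 1) alg) ≤
      ∫ w, (g w + C) ∂(interactionLaw D n alg) := by
    rw [integral_eq_lintegral_of_nonneg_ae, integral_eq_lintegral_of_nonneg_ae]
    rotate_left
    · filter_upwards [ae_good halg hD n] with w hw using hg0 w hw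
    · exact (hg.measurable.add_const C).aestronglyMeasurable
    · filter_upwards [ae_good halg hD (n + 1)] with w hw using hf0 w hw
    · exact (hf.measurable.add_const C).aestronglyMeasurable
    refine ENNReal.toReal_mono ?_ ?_
    · have := (hgi.add (integrable_const C)).lintegral_lt_top
      exact this.ne
    rw [lintegral_interactionLaw_succ halg n (hf.measurable.add_const C).ennreal_ofReal]
    refine lintegral_mono_ae ?_
    filter_upwards [ae_good halg hD n] with w hw
    have hmeas : ∀ a, Measurable fun z => f (Play.snoc w z a) := fun a =>
      hf.measurable.comp ((Play.measurable_snoc a).comp (f := fun z => (w, z))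
        measurable_prodMk_left)
    have hint := integrable_sum_alg halg hD w (f := fun z a => f (Play.snoc w z a)) hmeas
      (fun z hz a => hC₁ _ (hw.snoc hz a))
    have hint' := integrable_sum_alg halg hD w (f := fun z a => f (Play.snoc w z a) + C) (C := C₁ + |C|)
      (fun a => (hmeas a).add_const C)
      (fun z hz a => (abs_add_le _ _).trans (add_le_add (hC₁ _ (hw.snoc hz a)) le_rfl))
    have e1 : condLIntegral D alg (fun w => ENNReal.ofReal (f w + C)) w =
        ∫⁻ z, ENNReal.ofReal (∑ a, alg (plays w) z.1 z.2.1 a * (f (Play.snoc w z a) + C)) ∂D := by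
      refine lintegral_congr_ae ?_
      filter_upwards [hD] with z hz
      rw [ENNReal.ofReal_sum_of_nonneg fun a _ =>
        mul_nonneg (halg.nonneg _ _ _ _) (hf0 _ (hw.snoc hz a))]
      refine Finset.sum_congr rfl fun a _ => ?_
      rw [ENNReal.ofReal_mul (halg.nonneg _ _ _ _)]
    rw [e1, ← ofReal_integral_eq_lintegral_ofReal hint']
    · refine ENNReal.ofReal_le_ofReal ?_
      have h2 := h w hw
      rw [condExpect] at h2
      simp only [mul_add, Finset.sum_add_distrib, ← Finset.sum_mul, halg.sum_eq_one, one_mul]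
      rw [integral_add hint (integrable_const C), integral_const]
      simpa using h2
    · filter_upwards [hD] with z hz
      exact Finset.sum_nonneg fun a _ =>
        mul_nonneg (halg.nonneg _ _ _ _) (hf0 _ (hw.snoc hz a))
  rw [integral_add hfi (integrable_const C), integral_add hgi (integrable_const C)] at key
  simpa using key

lemma Tame.comp_init {n : ℕ} {f : Play X K n → ℝ} (hf : Tame f) :
    Tame fun w : Play X K (n + 1) => f w.init :=
  ⟨hf.measurable.comp (Play.measurable_restrict _ _), hf.bounded.imp fun _ hC _ hw => hC _ (Play.Good.init hw)⟩

lemma condExpect_const (halg : IsRandomized alg) (h : List (Observation X K)) (c : ℝ) :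
    condExpect D alg h (fun _ _ => c) = c := by
  simp [condExpect, ← Finset.sum_mul, halg.sum_eq_one]

lemma integral_init_le (halg : IsRandomized alg) (hD : ∀ᵐ z ∂D, GoodOutcome z) {n : ℕ}
    {f : Play X K n → ℝ} (hf : Tame f) :
    ∫ w : Play X K (n + 1), f w.init ∂(interactionLaw D (n + 1) alg) ≤
      ∫ w, f w ∂(interactionLaw D n alg) := by
  refine integral_succ_le halg hD hf.comp_init hf fun w _ => ?_
  simp only [Play.init_snoc]
  rw [condExpect_const halg]

lemma Tame.add {n : ℕ} {f g : Play X K n → ℝ} (hf : Tame f) (hg : Tame g) :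
    Tame fun w => f w + g w := by
  obtain ⟨C₁, h₁⟩ := hf.bounded
  obtain ⟨C₂, h₂⟩ := hg.bounded
  exact ⟨hf.measurable.add hg.measurable, C₁ + C₂, fun w hw =>
    (abs_add_le _ _).trans (add_le_add (h₁ w hw) (h₂ w hw))⟩

lemma Tame.mul {n : ℕ} {f g : Play X K n → ℝ} (hf : Tame f) (hg : Tame g) :
    Tame fun w => f w * g w := by
  obtain ⟨C₁, h₁⟩ := hf.bounded
  obtain ⟨C₂, h₂⟩ := hg.bounded
  refine ⟨hf.measurable.mul hg.measurable, C₁ * C₂, fun w hw => ?_⟩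
  rw [abs_mul]
  exact mul_le_mul (h₁ w hw) (h₂ w hw) (abs_nonneg _) ((abs_nonneg _).trans (h₁ w hw))

lemma Tame.const {n : ℕ} (c : ℝ) : Tame fun _ : Play X K n => c :=
  ⟨measurable_const, |c|, fun _ _ => le_rfl⟩

lemma Tame.neg {n : ℕ} {f : Play X K n → ℝ} (hf : Tame f) : Tame fun w => -f w :=
  ⟨hf.measurable.neg, hf.bounded.imp fun _ hC w hw => by simpa using hC w hw⟩

lemma Tame.sub {n : ℕ} {f g : Play X K n → ℝ} (hf : Tame f) (hg : Tame g) :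
    Tame fun w => f w - g w := by
  simpa [sub_eq_add_neg] using hf.add hg.neg

lemma Tame.sum {n : ℕ} {ι : Type*} (s : Finset ι) {f : ι → Play X K n → ℝ}
    (hf : ∀ i ∈ s, Tame (f i)) : Tame fun w => ∑ i ∈ s, f i w := by
  classical
  induction s using Finset.induction_on with
  | empty => simpa using Tame.const 0
  | insert i s hi ih =>
    simp only [Finset.sum_insert hi]
    exact (hf i (by simp)).add (ih fun j hj => hf j (by simp [hj]))

lemma Tame.integrable_snoc {n : ℕ} {f : Play X K (n + 1) → ℝ} (hf : Tame f)
    (halg : IsRandomized alg) (hD : ∀ᵐ z ∂D, GoodOutcome z) {w : Play X K n} (hw : w.Good) :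
    Integrable (fun z => ∑ a, alg (plays w) z.1 z.2.1 a * f (Play.snoc w z a)) D := by
  obtain ⟨C, hC⟩ := hf.bounded
  exact integrable_sum_alg halg hD w (f := fun z a => f (Play.snoc w z a))
    (fun a => hf.measurable.comp ((Play.measurable_snoc a).comp (f := fun z => (w, z))
      measurable_prodMk_left)) (fun z hz a => hC _ (hw.snoc hz a))

/-- A Doob decomposition step: the increments have nonpositive conditional expectation. -/
lemma integral_succ_le_of_add (halg : IsRandomized alg) (hD : ∀ᵐ z ∂D, GoodOutcome z) {n : ℕ}
    {f : Play X K (n + 1) → ℝ} {g : Play X K n → ℝ} (hf : Tame f) (hg : Tame g)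
    (ξ : Play X K n → Outcome X K → Fin K → ℝ)
    (hξ : ∀ w z a, f (Play.snoc w z a) = g w + ξ w z a)
    (h : ∀ w : Play X K n, w.Good → condExpect D alg (plays w) (ξ w) ≤ 0) :
    ∫ w, f w ∂(interactionLaw D (n + 1) alg) ≤ ∫ w, g w ∂(interactionLaw D n alg) := by
  refine integral_succ_le halg hD hf hg fun w hw => ?_
  have hi := (hf.sub (Tame.const (g w))).integrable_snoc halg hD hw
  have h' := h w hw
  simp only [hξ, add_sub_cancel_left] at hi
  simp only [condExpect, hξ, mul_add, Finset.sum_add_distrib, ← Finset.sum_mul, halg.sum_eq_one,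
    one_mul] at h' ⊢
  rw [integral_add (integrable_const _) hi]
  simpa using h'

/-- Summing the conditional expectations of a per-round gain over all rounds. -/
lemma integral_sum_le (halg : IsRandomized alg) (hD : ∀ᵐ z ∂D, GoodOutcome z)
    {g : Outcome X K → Fin K → ℝ} (hg : ∀ a, Measurable fun z => g z a) {C : ℝ}
    (hC : ∀ z, GoodOutcome z → ∀ a, |g z a| ≤ C) (f : (n : ℕ) → Play X K n → ℝ)
    (hf : ∀ n, Tame (f n)) (T : ℕ)
    (h : ∀ n < T, ∀ w : Play X K n, w.Good → condExpect D alg (plays w) g ≤ f n w) :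
    Tame (fun w : Play X K T => ∑ t, g (w.1 t) (w.2 t)) ∧
    ∫ w : Play X K T, ∑ t, g (w.1 t) (w.2 t) ∂(interactionLaw D T alg) ≤
      ∑ n ∈ Finset.range T, ∫ w, f n w ∂(interactionLaw D n alg) := by
  have htame : ∀ n (t : Fin n), Tame fun w : Play X K n => g (w.1 t) (w.2 t) := fun n t =>
    ⟨measurable_fin_eval (f := fun a (w : Play X K n) => g (w.1 t) a)
      (fun a => (hg a).comp (by fun_prop)) (by fun_prop), C, fun w hw => hC _ (hw t) _⟩
  refine ⟨Tame.sum _ fun t _ => htame T t, ?_⟩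
  induction T with
  | zero => simp
  | succ n ih =>
    have ih' := ih fun k hk => h k (hk.trans (Nat.lt_succ_self n))
    rw [Finset.sum_range_succ]
    have hsum : Tame fun w : Play X K n => ∑ t, g (w.1 t) (w.2 t) :=
      Tame.sum _ fun t _ => htame n t
    have hp := isProbabilityMeasure_interactionLaw (D := D) halg n
    refine le_trans ?_ (add_le_add ih' le_rfl)
    rw [← integral_add (hsum.integrable halg hD) ((hf n).integrable halg hD)]
    refine integral_succ_le halg hD (Tame.sum _ fun t _ => htame (n + 1) t)
      (hsum.add (hf n)) fun w hw => ?_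
    have e : ∀ z a, ∑ t, g ((w.snoc z a).1 t) ((w.snoc z a).2 t) =
        ∑ t, g (w.1 t) (w.2 t) + g z a := by
      intro z a
      rw [Fin.sum_univ_castSucc]
      simp [Play.snoc]
    simp only [e]
    refine le_trans (le_of_eq ?_) (add_le_add le_rfl (h n (Nat.lt_succ_self n) w hw))
    simp only [condExpect, mul_add, Finset.sum_add_distrib, ← Finset.sum_mul, halg.sum_eq_one,
      one_mul]
    rw [integral_add (integrable_const _) (integrable_sum_alg halg hD w hg hC)]
    simp

end Play

/-! ### One greedy round: unbiasedness, second moments, exponential moments, remapping loss -/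

section OneRound

variable {X : Type*} {K : ℕ} {best : (Fin K → ℝ) → Fin K} {σ μ : ℝ}

lemma mem_activeSet {m : Fin K → ℝ} {a : Fin K} :
    a ∈ activeSet best σ m ↔ m a ≤ m (best m) + σ := by simp [activeSet]

lemma best_mem_activeSet (hσ : 0 ≤ σ) (m : Fin K → ℝ) : best m ∈ activeSet best σ m := by
  simpa [mem_activeSet] using hσ

lemma remap_mem_activeSet (hσ : 0 ≤ σ) (m : Fin K → ℝ) (a : Fin K) :
    remap best σ m a ∈ activeSet best σ m := by
  unfold remap
  split_ifs with h
  exacts [h, best_mem_activeSet hσ m]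

lemma card_activeSet_pos (hσ : 0 ≤ σ) (m : Fin K → ℝ) :
    (0 : ℝ) < (activeSet best σ m).card := by
  exact_mod_cast Finset.card_pos.2 ⟨_, best_mem_activeSet hσ m⟩

lemma card_activeSet_le (m : Fin K → ℝ) : ((activeSet best σ m).card : ℝ) ≤ K := by
  exact_mod_cast (Finset.card_le_univ _).trans_eq (by simp)

lemma greedyProb_nonneg (hμ : 0 ≤ μ) (hμ1 : μ ≤ 1) (π : X → Fin K) (x : X) (m : Fin K → ℝ)
    (a : Fin K) : 0 ≤ greedyProb best σ μ π x m a := by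
  unfold greedyProb
  refine add_nonneg (mul_nonneg (by linarith) (by split_ifs <;> norm_num))
    (mul_nonneg (by positivity) (by split_ifs <;> norm_num))

lemma sum_greedyProb_mul (π : X → Fin K) (x : X) (m f : Fin K → ℝ) :
    ∑ a, greedyProb best σ μ π x m a * f a = (1 - μ) * f (remap best σ m (π x)) +
      μ / (activeSet best σ m).card * ∑ a ∈ activeSet best σ m, f a := by
  simp only [greedyProb, add_mul, Finset.sum_add_distrib]
  congr 1
  · simp
  · rw [Finset.mul_sum, ← Finset.sum_filter_add_sum_filter_not Finset.univ
      (fun a => a ∈ activeSet best σ m)]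
    rw [Finset.sum_eq_zero (s := Finset.univ.filter fun a => ¬ a ∈ activeSet best σ m), add_zero]
    · rw [Finset.filter_mem_eq_inter, Finset.univ_inter]
      exact Finset.sum_congr rfl fun a ha => by simp [ha]
    · intro a ha
      simp [(Finset.mem_filter.1 ha).2]

lemma sum_greedyProb (hσ : 0 ≤ σ) (π : X → Fin K) (x : X) (m : Fin K → ℝ) :
    ∑ a, greedyProb best σ μ π x m a = 1 := by
  have h := sum_greedyProb_mul (best := best) (σ := σ) (μ := μ) π x m (fun _ => 1)
  have := card_activeSet_pos (best := best) hσ m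
  simp only [mul_one, Finset.sum_const, nsmul_eq_mul] at h
  rw [h]
  field_simp
  ring

lemma greedyProb_of_notMem (hσ : 0 ≤ σ) (π : X → Fin K) (x : X) {m : Fin K → ℝ} {a : Fin K}
    (ha : a ∉ activeSet best σ m) : greedyProb best σ μ π x m a = 0 := by
  have : a ≠ remap best σ m (π x) := fun h => ha (h ▸ remap_mem_activeSet hσ m _)
  simp [greedyProb, ha, this]

lemma le_greedyProb (hσ : 0 ≤ σ) (hμ : 0 ≤ μ) (hμ1 : μ ≤ 1) (π : X → Fin K) (x : X)
    {m : Fin K → ℝ} {a : Fin K} (ha : a ∈ activeSet best σ m) :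
    μ / K ≤ greedyProb best σ μ π x m a := by
  have h1 : μ / K ≤ μ / (activeSet best σ m).card :=
    div_le_div_of_nonneg_left hμ (card_activeSet_pos hσ m) (card_activeSet_le m)
  have h2 : 0 ≤ (1 - μ) * (if a = remap best σ m (π x) then 1 else 0) :=
    mul_nonneg (by linarith) (by split_ifs <;> norm_num)
  simp only [greedyProb, ha, if_true, mul_one]
  linarith

/-- The cost vector handed to the oracle after the observation `o` of a round in which the greedy
policy was `π`. -/
noncomputable def costVec (best : (Fin K → ℝ) → Fin K) (σ μ : ℝ) (π : X → Fin K)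
    (o : Observation X K) (a : Fin K) : ℝ :=
  lossEstimate best σ μ π o (remap best σ o.pred a)

lemma costVec_observe (π : X → Fin K) (z : Outcome X K) (a b : Fin K) :
    costVec best σ μ π (observe z a) b =
      (z.2.2 a - z.2.1 (remap best σ z.2.1 b)) /
          greedyProb best σ μ π z.1 z.2.1 (remap best σ z.2.1 b) *
          (if a = remap best σ z.2.1 b then 1 else 0) +
        z.2.1 (remap best σ z.2.1 b) - z.2.1 (best z.2.1) := rfl

/-- Importance weighting is unbiased because a remapped action is always active, hence played with
positive probability. -/
lemma sum_greedyProb_mul_costVec (hσ : 0 ≤ σ) (hμ : 0 < μ) (hμ1 : μ ≤ 1) (π : X → Fin K)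
    (z : Outcome X K) (b : Fin K) :
    ∑ a, greedyProb best σ μ π z.1 z.2.1 a * costVec best σ μ π (observe z a) b =
      z.2.2 (remap best σ z.2.1 b) - z.2.1 (best z.2.1) := by
  set c := remap best σ z.2.1 b with hc
  have hK : (0 : ℝ) < K := (card_activeSet_pos (best := best) hσ z.2.1).trans_le (card_activeSet_le _)
  have hp : 0 < greedyProb best σ μ π z.1 z.2.1 c :=
    (div_pos hμ hK).trans_le (le_greedyProb hσ hμ.le hμ1 π z.1 (remap_mem_activeSet hσ _ _))
  have h : ∀ a, greedyProb best σ μ π z.1 z.2.1 a * costVec best σ μ π (observe z a) b =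
      (if a = c then z.2.2 c - z.2.1 c else 0) +
        greedyProb best σ μ π z.1 z.2.1 a * (z.2.1 c - z.2.1 (best z.2.1)) := by
    intro a
    simp only [costVec_observe, ← hc]
    split_ifs with h
    · subst h; field_simp; ring
    · ring
  simp only [h, Finset.sum_add_distrib, ← Finset.sum_mul, sum_greedyProb hσ]
  simp

/-- This is what remapping buys: the shifted prediction of an active action lies in [0, σ], so apart
from the weighted prediction error a cost vector has size at most σ. -/
lemma norm_costVec_le (hb : IsArgmin best) (hσ : 0 ≤ σ) (π : X → Fin K) (z : Outcome X K)
    (a : Fin K) : ‖costVec best σ μ π (observe z a)‖ ≤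
      |(z.2.2 a - z.2.1 a) / greedyProb best σ μ π z.1 z.2.1 a| + σ := by
  rw [pi_norm_le_iff_of_nonneg (by positivity)]
  intro b
  have h1 := hb.le z.2.1 (remap best σ z.2.1 b)
  have h2 := mem_activeSet.1 (remap_mem_activeSet (best := best) hσ z.2.1 b)
  rw [Real.norm_eq_abs]
  rw [costVec_observe]
  set c := remap best σ z.2.1 b
  rw [add_sub_assoc]
  refine (abs_add_le _ _).trans (add_le_add ?_ ?_)
  · by_cases h : a = c
    · rw [if_pos h, mul_one, h]
    · rw [if_neg h, mul_zero, abs_zero]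
      exact abs_nonneg _
  · rw [abs_le]; constructor <;> linarith

lemma abs_sub_le_norm_sub (z : Outcome X K) (a : Fin K) :
    |z.2.2 a - z.2.1 a| ≤ ‖z.2.2 - z.2.1‖ := by
  simpa using norm_le_pi_norm (z.2.2 - z.2.1) a

lemma GoodOutcome.norm_sub_le {z : Outcome X K} (hz : GoodOutcome z) : ‖z.2.2 - z.2.1‖ ≤ 1 := by
  rw [pi_norm_le_iff_of_nonneg zero_le_one]
  intro a
  obtain ⟨h1, h2⟩ := hz a
  simp only [Pi.sub_apply, Real.norm_eq_abs, abs_le]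
  constructor <;> linarith [h1.1, h1.2, h2.1, h2.2]

lemma abs_div_greedyProb_le (hσ : 0 ≤ σ) (hμ : 0 < μ) (hμ1 : μ ≤ 1)
    (π : X → Fin K) (z : Outcome X K) (a : Fin K) :
    |(z.2.2 a - z.2.1 a) / greedyProb best σ μ π z.1 z.2.1 a| ≤ K / μ * ‖z.2.2 - z.2.1‖ := by
  by_cases ha : a ∈ activeSet best σ z.2.1
  · have hK : (0 : ℝ) < K :=
      (card_activeSet_pos (best := best) hσ z.2.1).trans_le (card_activeSet_le _)
    have h := le_greedyProb hσ hμ.le hμ1 π z.1 ha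
    have hp := (div_pos hμ hK).trans_le h
    rw [abs_div, abs_of_pos hp, div_le_iff₀ hp]
    calc |z.2.2 a - z.2.1 a| ≤ ‖z.2.2 - z.2.1‖ := abs_sub_le_norm_sub z a
      _ = K / μ * ‖z.2.2 - z.2.1‖ * (μ / K) := by field_simp
      _ ≤ _ := by gcongr
  -- An inactive action has probability 0, and division by zero gives 0.
  · rw [greedyProb_of_notMem hσ _ _ ha]
    simp only [div_zero, abs_zero]
    positivity

lemma norm_costVec_le_of_good (hb : IsArgmin best) (hσ : 0 ≤ σ) (hμ : 0 < μ) (hμ1 : μ ≤ 1)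
    (π : X → Fin K) {z : Outcome X K} (hz : GoodOutcome z) (a : Fin K) :
    ‖costVec best σ μ π (observe z a)‖ ≤ K / μ + σ := by
  refine (norm_costVec_le hb hσ π z a).trans (add_le_add ?_ le_rfl)
  refine (abs_div_greedyProb_le hσ hμ hμ1 π z a).trans ?_
  exact mul_le_of_le_one_right (by positivity) hz.norm_sub_le

/-- One factor 1/p cancels against the sampling probability and the other is at most K/μ; summing
over the K actions produces K²/μ. -/
lemma sum_greedyProb_mul_norm_sq_le (hb : IsArgmin best) (hσ : 0 ≤ σ) (hμ : 0 < μ) (hμ1 : μ ≤ 1)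
    (π : X → Fin K) (z : Outcome X K) :
    ∑ a, greedyProb best σ μ π z.1 z.2.1 a * ‖costVec best σ μ π (observe z a)‖ ^ 2 ≤
      2 * σ ^ 2 + 2 * (K ^ 2 / μ) * ‖z.2.2 - z.2.1‖ ^ 2 := by
  set p := greedyProb best σ μ π z.1 z.2.1 with hp
  set r := ‖z.2.2 - z.2.1‖ with hr
  have h : ∀ a, p a * ‖costVec best σ μ π (observe z a)‖ ^ 2 ≤
      p a * (2 * σ ^ 2) + 2 * (K / μ * r ^ 2) := by
    intro a
    have hp0 : 0 ≤ p a := greedyProb_nonneg hμ.le hμ1 _ _ _ _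
    have h1 : ‖costVec best σ μ π (observe z a)‖ ^ 2 ≤
        2 * ((z.2.2 a - z.2.1 a) / p a) ^ 2 + 2 * σ ^ 2 := by
      have h2 := pow_le_pow_left₀ (norm_nonneg _) (norm_costVec_le (μ := μ) hb hσ π z a) 2
      rw [← sq_abs ((z.2.2 a - z.2.1 a) / p a)]
      nlinarith [sq_nonneg (|(z.2.2 a - z.2.1 a) / p a| - σ)]
    have h3 : p a * ((z.2.2 a - z.2.1 a) / p a) ^ 2 ≤ K / μ * r ^ 2 := by
      have e : p a * ((z.2.2 a - z.2.1 a) / p a) ^ 2 =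
          |z.2.2 a - z.2.1 a| * |(z.2.2 a - z.2.1 a) / p a| := by
        rcases hp0.eq_or_lt with h0 | h0
        · simp [← h0]
        · rw [abs_div, abs_of_pos h0, div_pow, ← sq_abs]; field_simp
      rw [e]
      calc |z.2.2 a - z.2.1 a| * |(z.2.2 a - z.2.1 a) / p a| ≤ r * (K / μ * r) :=
            mul_le_mul (abs_sub_le_norm_sub z a) (abs_div_greedyProb_le hσ hμ hμ1 π z a)
              (abs_nonneg _) (norm_nonneg _)
        _ = _ := by ring
    calc p a * ‖costVec best σ μ π (observe z a)‖ ^ 2 ≤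
        p a * (2 * ((z.2.2 a - z.2.1 a) / p a) ^ 2 + 2 * σ ^ 2) :=
          mul_le_mul_of_nonneg_left h1 hp0
      _ = 2 * (p a * ((z.2.2 a - z.2.1 a) / p a) ^ 2) + p a * (2 * σ ^ 2) := by ring
      _ ≤ _ := by linarith
  refine (Finset.sum_le_sum fun a _ => h a).trans (le_of_eq ?_)
  rw [Finset.sum_add_distrib, ← Finset.sum_mul, hp, sum_greedyProb hσ]
  simp
  ring

/-- From e^x ≥ 1 + x and (1 + y + y²)(1 - y + y²) = 1 + y² + y⁴ ≥ 1. No bound on y is needed, so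
large importance weights do no harm. -/
lemma exp_neg_sub_sq_le (y : ℝ) : Real.exp (-y - y ^ 2) ≤ 1 - y + y ^ 2 := by
  have h1 : 0 < 1 + y + y ^ 2 := by nlinarith [sq_nonneg (y + 1 / 2)]
  have h2 : 1 + y + y ^ 2 ≤ Real.exp (y + y ^ 2) := by
    linarith [Real.add_one_le_exp (y + y ^ 2)]
  rw [show -y - y ^ 2 = -(y + y ^ 2) by ring, Real.exp_neg]
  refine (inv_anti₀ h1 h2).trans ?_
  rw [inv_le_iff_one_le_mul₀ h1]
  nlinarith [sq_nonneg y, sq_nonneg (y ^ 2)]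

/-- The correction uses the sup norm rather than the entry at `b`, so that it is the same for all
policies and its mean can later be taken although the ERM policy depends on the data. -/
lemma sum_greedyProb_mul_exp_le (hb : IsArgmin best) (hσ : 0 ≤ σ) (hμ : 0 < μ) (hμ1 : μ ≤ 1)
    (π : X → Fin K) (z : Outcome X K) (b : Fin K) (η : ℝ) :
    ∑ a, greedyProb best σ μ π z.1 z.2.1 a *
        Real.exp (-η * costVec best σ μ π (observe z a) b -
          η ^ 2 * ‖costVec best σ μ π (observe z a)‖ ^ 2) ≤
      1 - η * (z.2.2 (remap best σ z.2.1 b) - z.2.1 (best z.2.1)) +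
        η ^ 2 * (2 * σ ^ 2 + 2 * (K ^ 2 / μ) * ‖z.2.2 - z.2.1‖ ^ 2) := by
  rw [← sum_greedyProb_mul_costVec hσ hμ hμ1 π z b]
  refine le_trans ?_ (add_le_add le_rfl (mul_le_mul_of_nonneg_left
    (sum_greedyProb_mul_norm_sq_le hb hσ hμ hμ1 π z) (sq_nonneg η)))
  rw [← sum_greedyProb (best := best) (μ := μ) hσ π z.1 z.2.1, Finset.mul_sum, Finset.mul_sum,
    ← Finset.sum_sub_distrib, ← Finset.sum_add_distrib]
  refine Finset.sum_le_sum fun a _ => ?_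
  set p := greedyProb best σ μ π z.1 z.2.1 a
  set c := costVec best σ μ π (observe z a)
  have hp0 : 0 ≤ p := greedyProb_nonneg hμ.le hμ1 _ _ _ _
  have h1 : c b ^ 2 ≤ ‖c‖ ^ 2 := by
    rw [← sq_abs (c b)]
    exact pow_le_pow_left₀ (abs_nonneg _) (norm_le_pi_norm c b) 2
  have h2 := exp_neg_sub_sq_le (η * c b)
  have h3 : Real.exp (-η * c b - η ^ 2 * ‖c‖ ^ 2) ≤ Real.exp (-(η * c b) - (η * c b) ^ 2) := by
    refine Real.exp_le_exp.2 ?_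
    nlinarith [mul_le_mul_of_nonneg_left h1 (sq_nonneg η)]
  have h4 : Real.exp (-η * c b - η ^ 2 * ‖c‖ ^ 2) ≤ 1 - η * c b + η ^ 2 * ‖c‖ ^ 2 := by
    refine h3.trans (h2.trans ?_)
    nlinarith [mul_le_mul_of_nonneg_left h1 (sq_nonneg η)]
  calc _ ≤ p * (1 - η * c b + η ^ 2 * ‖c‖ ^ 2) := mul_le_mul_of_nonneg_left h4 hp0
    _ = _ := by ring

/-- The dyadic interval `(2^{-i-1}, 2^{-i}]`. -/
noncomputable def dyadicBin (i : ℕ) : Set ℝ := Set.Ioc ((1 / 2 : ℝ) ^ (i + 1)) ((1 / 2 : ℝ) ^ i)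

lemma exists_mem_dyadicBin {x : ℝ} (hx : x ≤ 1) {k : ℕ} (h : (1 / 2 : ℝ) ^ k < x) :
    ∃ i < k, x ∈ dyadicBin i := by
  induction k with
  | zero => simp at h; linarith
  | succ k ih =>
    by_cases hk : (1 / 2 : ℝ) ^ k < x
    · obtain ⟨i, hi, hxi⟩ := ih hk
      exact ⟨i, hi.trans (Nat.lt_succ_self k), hxi⟩
    · exact ⟨k, Nat.lt_succ_self k, h, not_lt.1 hk⟩

/-- Number of dyadic bins used for horizon `T`. -/
noncomputable def numBins (T : ℕ) : ℕ := ⌈Real.logb 2 T⌉₊ + 1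

/-- The `+ 1` in the number of bins absorbs the factor 2. -/
lemma two_mul_pow_numBins_le {T : ℕ} (hT : 1 ≤ T) : 2 * (1 / 2 : ℝ) ^ numBins T ≤ 1 / T := by
  have hT' : (0 : ℝ) < T := by exact_mod_cast hT
  rw [numBins, pow_succ]
  have h1 : (T : ℝ) ≤ 2 ^ (⌈Real.logb 2 T⌉₊) := by
    have h := Nat.le_ceil (Real.logb 2 T)
    rw [Real.logb_le_iff_le_rpow one_lt_two hT'] at h
    simpa using h
  rw [one_div_pow]
  have := one_div_le_one_div_of_le hT' h1
  linarith

/-- The loss of remapping is controlled by the prediction errors, bin by bin. -/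
lemma remap_loss_le (hσ : 0 ≤ σ) {T : ℕ} (hT : 1 ≤ T) {z : Outcome X K} (hz : GoodOutcome z)
    (b : Fin K) : z.2.2 (remap best σ z.2.1 b) - z.2.2 b ≤
      ∑ i ∈ Finset.range (numBins T), (∑ a, (dyadicBin i).indicator 1 |z.2.2 a - z.2.1 a|) *
        max (2 * (1 / 2) ^ i - σ) 0 + 1 / T := by
  have hind : ∀ i a, 0 ≤ (dyadicBin i).indicator (1 : ℝ → ℝ) |z.2.2 a - z.2.1 a| := fun i a =>
    Set.indicator_nonneg (fun _ _ => zero_le_one) _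
  have hterm : ∀ i, 0 ≤ (∑ a, (dyadicBin i).indicator (1 : ℝ → ℝ) |z.2.2 a - z.2.1 a|) *
        max (2 * (1 / 2) ^ i - σ) 0 := fun i =>
    mul_nonneg (Finset.sum_nonneg fun a _ => hind i a) (le_max_right _ _)
  have hsum := Finset.sum_nonneg (s := Finset.range (numBins T)) fun i _ => hterm i
  have hT' : (0 : ℝ) ≤ 1 / T := by positivity
  by_cases hbA : b ∈ activeSet best σ z.2.1
  · simp only [remap, hbA, if_true, sub_self]
    exact add_nonneg hsum hT'
  simp only [remap, hbA, if_false]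
  set c := best z.2.1
  have hlt : z.2.1 c + σ < z.2.1 b := by simpa [mem_activeSet] using hbA
  -- Passing from losses to predictions costs the errors at `b` and `c`, and inactivity of `b` gains
  -- σ; the witness is whichever of the two has the larger error.
  obtain ⟨a, ha⟩ : ∃ a, z.2.2 c - z.2.2 b ≤ 2 * |z.2.2 a - z.2.1 a| - σ := by
    have h1 := le_abs_self (z.2.2 c - z.2.1 c)
    have h2 := neg_abs_le (z.2.2 b - z.2.1 b)
    rcases le_total |z.2.2 c - z.2.1 c| |z.2.2 b - z.2.1 b| with h | h
    · exact ⟨b, by linarith⟩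
    · exact ⟨c, by linarith⟩
  by_cases hsm : (1 / 2 : ℝ) ^ numBins T < |z.2.2 a - z.2.1 a|
  · obtain ⟨i, hi, hmem⟩ := exists_mem_dyadicBin
      ((abs_sub_le_norm_sub z a).trans hz.norm_sub_le) hsm
    -- Since the action with the larger error is not known in advance, its indicator is bounded by
    -- the sum over all actions. Uniform exploration estimates 1/K of the mean of that sum.
    have h1 : max (2 * (1 / 2 : ℝ) ^ i - σ) 0 ≤
        (∑ a, (dyadicBin i).indicator (1 : ℝ → ℝ) |z.2.2 a - z.2.1 a|) *
        max (2 * (1 / 2) ^ i - σ) 0 := by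
      refine le_mul_of_one_le_left (le_max_right _ _) ?_
      have := Finset.single_le_sum (fun a _ => hind i a) (Finset.mem_univ a)
      rwa [Set.indicator_of_mem hmem, Pi.one_apply] at this
    have h2 := Finset.single_le_sum (fun i _ => hterm i) (Finset.mem_range.2 hi)
    have h3 := le_max_left (2 * (1 / 2 : ℝ) ^ i - σ) 0
    have h4 := hmem.2
    linarith
  -- Errors below the last bin cost at most 1/T.
  · have h1 := two_mul_pow_numBins_le hT
    have h2 := not_lt.1 hsm
    linarith

lemma loss_le_of_mem_activeSet (hb : IsArgmin best) (z : Outcome X K) {a a' : Fin K}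
    (ha : a ∈ activeSet best σ z.2.1) :
    z.2.2 a ≤ z.2.2 a' + (σ + 2 * ‖z.2.2 - z.2.1‖) := by
  have h1 := abs_le.1 (abs_sub_le_norm_sub z a)
  have h2 := abs_le.1 (abs_sub_le_norm_sub z a')
  have h3 := hb.le z.2.1 a'
  have h4 := mem_activeSet.1 ha
  linarith [h1.2, h2.1]

lemma sum_greedyProb_mul_loss_le (hb : IsArgmin best) (hσ : 0 ≤ σ) (hμ : 0 ≤ μ)
    (π : X → Fin K) (z : Outcome X K) (b : Fin K) :
    ∑ a, greedyProb best σ μ π z.1 z.2.1 a * (z.2.2 a - z.2.2 b) ≤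
      (1 - μ) * (z.2.2 (remap best σ z.2.1 (π z.1)) - z.2.2 (remap best σ z.2.1 b)) +
        μ * (σ + 2 * ‖z.2.2 - z.2.1‖) + (z.2.2 (remap best σ z.2.1 b) - z.2.2 b) := by
  rw [sum_greedyProb_mul π z.1 z.2.1 (fun a => z.2.2 a - z.2.2 b)]
  have hc := card_activeSet_pos (best := best) hσ z.2.1
  -- Explored actions are also compared with the remapped comparator, so the remapping loss appears
  -- with total weight (1 - μ) + μ = 1.
  have h : μ / (activeSet best σ z.2.1).card * ∑ a ∈ activeSet best σ z.2.1, (z.2.2 a - z.2.2 b) ≤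
      μ * (z.2.2 (remap best σ z.2.1 b) - z.2.2 b + (σ + 2 * ‖z.2.2 - z.2.1‖)) := by
    have h1 : ∑ a ∈ activeSet best σ z.2.1, (z.2.2 a - z.2.2 b) ≤
        (activeSet best σ z.2.1).card *
          (z.2.2 (remap best σ z.2.1 b) - z.2.2 b + (σ + 2 * ‖z.2.2 - z.2.1‖)) := by
      rw [← nsmul_eq_mul]
      refine Finset.sum_le_card_nsmul _ _ _ fun a ha => ?_
      linarith [loss_le_of_mem_activeSet hb z (a' := remap best σ z.2.1 b) ha]
    refine (mul_le_mul_of_nonneg_left h1 (by positivity)).trans (le_of_eq ?_)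
    field_simp
  linarith

end OneRound

/-! ### Joint measurability in threshold and outcome -/

section Measurability

variable {X : Type*} {K : ℕ} {best : (Fin K → ℝ) → Fin K} {μ : ℝ}

/-- The shifted loss of the remapped policy `π` in one round. -/
noncomputable def remapLoss (best : (Fin K → ℝ) → Fin K) (σ : ℝ) (π : X → Fin K)
    (z : Outcome X K) : ℝ :=
  z.2.2 (remap best σ z.2.1 (π z.1)) - z.2.1 (best z.2.1)

lemma GoodOutcome.abs_remapLoss_le {z : Outcome X K} (hz : GoodOutcome z) (σ : ℝ)
    (π : X → Fin K) : |remapLoss best σ π z| ≤ 1 := by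
  have h1 := (hz (remap best σ z.2.1 (π z.1))).2
  have h2 := (hz (best z.2.1)).1
  rw [remapLoss, abs_le]
  constructor <;> linarith [h1.1, h1.2, h2.1, h2.2]

lemma IsArgmin.measurable_apply (hb : IsArgmin best) : Measurable fun m : Fin K → ℝ => m (best m) :=
  measurable_fin_eval (f := fun b (m : Fin K → ℝ) => m b) (fun b => measurable_pi_apply b)
    hb.measurable

lemma measurableSet_mem_activeSet (hb : IsArgmin best) (a : Fin K) :
    MeasurableSet {q : ℝ × (Fin K → ℝ) | a ∈ activeSet best q.1 q.2} := by
  simp only [mem_activeSet]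
  exact measurableSet_le (by fun_prop) ((hb.measurable_apply.comp measurable_snd).add measurable_fst)

lemma measurable_remap (hb : IsArgmin best) (b : Fin K) :
    Measurable fun q : ℝ × (Fin K → ℝ) => remap best q.1 q.2 b := by
  unfold remap
  exact Measurable.ite (measurableSet_mem_activeSet hb b) measurable_const
    (hb.measurable.comp measurable_snd)

variable [MeasurableSpace X]

/-- A constant policy is enough: a policy enters only through its value at the current context, and
a data-dependent value is restored by `measurable_fin_eval`. -/
lemma measurable_greedyProb (hb : IsArgmin best) (b a : Fin K) :
    Measurable fun q : ℝ × Outcome X K =>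
      greedyProb best q.1 μ (fun _ : X => b) q.2.1 q.2.2.1 a := by
  have hmem : ∀ a, MeasurableSet {q : ℝ × Outcome X K | a ∈ activeSet best q.1 q.2.2.1} := fun a =>
    (measurableSet_mem_activeSet hb a).preimage
      (f := fun q : ℝ × Outcome X K => (q.1, q.2.2.1)) (by fun_prop)
  have hcard : Measurable fun q : ℝ × Outcome X K => ((activeSet best q.1 q.2.2.1).card : ℝ) := by
    have h : ∀ q : ℝ × Outcome X K, ((activeSet best q.1 q.2.2.1).card : ℝ) =
        ∑ a, if a ∈ activeSet best q.1 q.2.2.1 then 1 else 0 := by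
      intro q; simp
    simp only [h]
    exact Finset.measurable_sum _ fun a _ =>
      Measurable.ite (hmem a) measurable_const measurable_const
  have hr : MeasurableSet {q : ℝ × Outcome X K | a = remap best q.1 q.2.2.1 b} := by
    simp only [eq_comm (a := a)]
    exact (measurable_remap hb b).comp (f := fun q : ℝ × Outcome X K => (q.1, q.2.2.1))
      (by fun_prop) (measurableSet_singleton a)
  unfold greedyProb
  exact Measurable.add (measurable_const.mul (Measurable.ite hr measurable_const measurable_const))
    ((measurable_const.div hcard).mul (Measurable.ite (hmem a) measurable_const measurable_const))

lemma measurable_costVec (hb : IsArgmin best) (c a : Fin K) :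
    Measurable fun q : ℝ × Outcome X K =>
      costVec best q.1 μ (fun _ => c) (observe q.2 a) := by
  refine measurable_pi_lambda _ fun b => ?_
  have hm := (measurable_remap hb b).comp (f := fun q : ℝ × Outcome X K => (q.1, q.2.2.1))
    (by fun_prop)
  simp only [costVec_observe]
  refine measurable_fin_eval (f := fun (b' : Fin K) (q : ℝ × Outcome X K) =>
    (q.2.2.2 a - q.2.2.1 b') / greedyProb best q.1 μ (fun _ => c) q.2.1 q.2.2.1 b' *
      (if a = b' then 1 else 0) + q.2.2.1 b' - q.2.2.1 (best q.2.2.1)) (fun b' => ?_) hm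
  have hbest := hb.measurable_apply.comp (f := fun q : ℝ × Outcome X K => q.2.2.1) (by fun_prop)
  refine Measurable.sub (Measurable.add (Measurable.mul
    (Measurable.div ?_ (measurable_greedyProb hb c b')) measurable_const) ?_) hbest
  · fun_prop
  · fun_prop

lemma measurable_remapLoss (hb : IsArgmin best) {π : X → Fin K} (hπ : Measurable π) :
    Measurable fun q : ℝ × Outcome X K => remapLoss best q.1 π q.2 := by
  unfold remapLoss
  refine Measurable.sub ?_ (hb.measurable_apply.comp (f := fun q : ℝ × Outcome X K => q.2.2.1)
    (by fun_prop))
  refine measurable_fin_eval (f := fun b (q : ℝ × Outcome X K) => q.2.2.2 b) (fun b => by fun_prop) ?_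
  refine measurable_fin_eval (f := fun b (q : ℝ × Outcome X K) => remap best q.1 q.2.2.1 b)
    (fun b => ?_) (hπ.comp (by fun_prop))
  exact (measurable_remap hb b).comp (f := fun q : ℝ × Outcome X K => (q.1, q.2.2.1)) (by fun_prop)

end Measurability

/-! ### One-round bounds integrated over the outcome distribution -/

section Integrated

variable {X : Type*} [MeasurableSpace X] {K : ℕ} {best : (Fin K → ℝ) → Fin K} {σ μ : ℝ}
  {D : Measure (Outcome X K)}

/-- The expected shifted loss of the remapped policy `π`. -/
noncomputable def meanRemapLoss (D : Measure (Outcome X K)) (best : (Fin K → ℝ) → Fin K) (σ : ℝ)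
    (π : X → Fin K) : ℝ := ∫ z, remapLoss best σ π z ∂D

/-- The mean squared prediction error of one round. -/
noncomputable def meanSqError (D : Measure (Outcome X K)) : ℝ := ∫ z, ‖z.2.2 - z.2.1‖ ^ 2 ∂D

lemma meanSqError_nonneg : 0 ≤ meanSqError D := integral_nonneg fun _ => by positivity

/-- Bound on the conditional second moment of the cost vectors. -/
noncomputable def costVariance (D : Measure (Outcome X K)) (σ μ : ℝ) : ℝ :=
  2 * σ ^ 2 + 2 * (K ^ 2 / μ) * meanSqError D

/-- The probability that the prediction error of a uniformly chosen action lies in the `i`-th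
dyadic bin. -/
noncomputable def binProb (D : Measure (Outcome X K)) (i : ℕ) : ℝ :=
  1 / K * ∫ z, ∑ a, (dyadicBin i).indicator 1 |z.2.2 a - z.2.1 a| ∂D

variable [IsProbabilityMeasure D]

lemma measurable_meanRemapLoss (hb : IsArgmin best) {π : X → Fin K} (hπ : Measurable π) :
    Measurable fun σ => meanRemapLoss D best σ π :=
  (measurable_remapLoss hb hπ).stronglyMeasurable.integral_prod_right.measurable

lemma integrable_remapLoss (hb : IsArgmin best) (hD : ∀ᵐ z ∂D, GoodOutcome z) {π : X → Fin K}
    (hπ : Measurable π) : Integrable (remapLoss best σ π) D := by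
  refine Integrable.of_bound (C := 1) ?_ ?_
  · exact ((measurable_remapLoss hb hπ).comp (f := fun z => (σ, z))
      measurable_prodMk_left).aestronglyMeasurable
  · filter_upwards [hD] with z hz using hz.abs_remapLoss_le σ π

lemma abs_meanRemapLoss_le (hD : ∀ᵐ z ∂D, GoodOutcome z) (σ : ℝ) (π : X → Fin K) :
    |meanRemapLoss D best σ π| ≤ 1 := by
  have h := norm_integral_le_of_norm_le_const (μ := D) (f := remapLoss best σ π) (C := 1)
    (by filter_upwards [hD] with z hz using hz.abs_remapLoss_le σ π)
  simpa [meanRemapLoss] using h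

lemma integrable_norm_sub (hD : ∀ᵐ z ∂D, GoodOutcome z) :
    Integrable (fun z : Outcome X K => ‖z.2.2 - z.2.1‖) D := by
  refine Integrable.of_bound (C := 1) (Measurable.aestronglyMeasurable (by fun_prop)) ?_
  filter_upwards [hD] with z hz
  simpa using hz.norm_sub_le

lemma integrable_norm_sub_sq (hD : ∀ᵐ z ∂D, GoodOutcome z) :
    Integrable (fun z : Outcome X K => ‖z.2.2 - z.2.1‖ ^ 2) D := by
  refine Integrable.of_bound (C := 1) (Measurable.aestronglyMeasurable (by fun_prop)) ?_
  filter_upwards [hD] with z hz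
  rw [Real.norm_of_nonneg (by positivity)]
  exact pow_le_one₀ (norm_nonneg _) hz.norm_sub_le

/-- Nonnegativity of the variance of ‖ℓ - m‖. -/
lemma integral_norm_sub_le (hD : ∀ᵐ z ∂D, GoodOutcome z) :
    ∫ z, ‖z.2.2 - z.2.1‖ ∂D ≤ √(meanSqError D) := by
  refine Real.le_sqrt_of_sq_le ?_
  set c := ∫ z, ‖z.2.2 - z.2.1‖ ∂D with hc
  have h : 0 ≤ ∫ z : Outcome X K, (‖z.2.2 - z.2.1‖ ^ 2 - 2 * c * ‖z.2.2 - z.2.1‖ + c ^ 2) ∂D :=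
    integral_nonneg fun z => by
      have := sq_nonneg (‖z.2.2 - z.2.1‖ - c)
      simp only [Pi.zero_apply]; nlinarith
  rw [integral_add, integral_sub (integrable_norm_sub_sq hD) ((integrable_norm_sub hD).const_mul _),
    integral_const_mul, ← hc, integral_const] at h
  · simp only [probReal_univ, one_smul] at h
    rw [meanSqError]; nlinarith
  · exact (integrable_norm_sub_sq hD).sub ((integrable_norm_sub hD).const_mul _)
  · exact integrable_const _

lemma integral_greedyProb_mul_exp_le (hb : IsArgmin best) (hD : ∀ᵐ z ∂D, GoodOutcome z)
    (hσ : 0 ≤ σ) (hμ : 0 < μ) (hμ1 : μ ≤ 1) (π : X → Fin K) {π' : X → Fin K}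
    (hπ' : Measurable π') (η : ℝ) :
    ∫ z, ∑ a, greedyProb best σ μ π z.1 z.2.1 a *
        Real.exp (η * meanRemapLoss D best σ π' - η * costVec best σ μ π (observe z a) (π' z.1) -
          η ^ 2 * ‖costVec best σ μ π (observe z a)‖ ^ 2 - η ^ 2 * costVariance D σ μ) ∂D ≤ 1 := by
  set E := Real.exp (η * meanRemapLoss D best σ π' - η ^ 2 * costVariance D σ μ) with hE
  have e : ∀ (z : Outcome X K) a, greedyProb best σ μ π z.1 z.2.1 a *
        Real.exp (η * meanRemapLoss D best σ π' - η * costVec best σ μ π (observe z a) (π' z.1) -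
          η ^ 2 * ‖costVec best σ μ π (observe z a)‖ ^ 2 - η ^ 2 * costVariance D σ μ) =
      E * (greedyProb best σ μ π z.1 z.2.1 a *
        Real.exp (-η * costVec best σ μ π (observe z a) (π' z.1) -
          η ^ 2 * ‖costVec best σ μ π (observe z a)‖ ^ 2)) := by
    intro z a
    rw [mul_left_comm, hE, ← Real.exp_add]
    congr 2
    ring
  simp only [e, ← Finset.mul_sum]
  rw [integral_const_mul]
  have hL := integrable_remapLoss (σ := σ) hb hD hπ'
  have hg1 : Integrable (fun z : Outcome X K => 1 - η * remapLoss best σ π' z) D :=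
    (integrable_const 1).sub (hL.const_mul η)
  have hg2 : Integrable (fun z : Outcome X K =>
      η ^ 2 * (2 * σ ^ 2 + 2 * (K ^ 2 / μ) * ‖z.2.2 - z.2.1‖ ^ 2)) D :=
    ((integrable_const _).add ((integrable_norm_sub_sq hD).const_mul _)).const_mul _
  have h : ∫ z, ∑ a, greedyProb best σ μ π z.1 z.2.1 a *
        Real.exp (-η * costVec best σ μ π (observe z a) (π' z.1) -
          η ^ 2 * ‖costVec best σ μ π (observe z a)‖ ^ 2) ∂D ≤
      1 - η * meanRemapLoss D best σ π' + η ^ 2 * costVariance D σ μ := by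
    calc _ ≤ ∫ z : Outcome X K, (1 - η * remapLoss best σ π' z +
          η ^ 2 * (2 * σ ^ 2 + 2 * (K ^ 2 / μ) * ‖z.2.2 - z.2.1‖ ^ 2)) ∂D := by
          refine integral_mono_of_nonneg (ae_of_all _ fun z => ?_) (hg1.add hg2)
            (ae_of_all _ fun z => sum_greedyProb_mul_exp_le hb hσ hμ hμ1 π z (π' z.1) η)
          exact Finset.sum_nonneg fun a _ =>
            mul_nonneg (greedyProb_nonneg hμ.le hμ1 _ _ _ _) (Real.exp_pos _).le
      _ = _ := by
          rw [integral_add hg1 hg2, integral_sub (integrable_const 1) (hL.const_mul η),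
            integral_const_mul, integral_const_mul, integral_add (integrable_const _)
            ((integrable_norm_sub_sq hD).const_mul _),
            integral_const_mul (2 * (K ^ 2 / μ) : ℝ), integral_const,
            integral_const, costVariance, meanSqError, meanRemapLoss]
          simp
  -- By 1 + x ≤ e^x the deterministic compensator `E` exactly cancels the conditional mean.
  have h2 : 1 - η * meanRemapLoss D best σ π' + η ^ 2 * costVariance D σ μ ≤ E⁻¹ := by
    rw [hE, ← Real.exp_neg]
    refine le_trans (le_of_eq ?_) (Real.add_one_le_exp _)
    ring
  calc E * _ ≤ E * E⁻¹ := mul_le_mul_of_nonneg_left (h.trans h2) (Real.exp_pos _).le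
    _ = 1 := mul_inv_cancel₀ (Real.exp_pos _).ne'

lemma integrable_sum_indicator (i : ℕ) : Integrable
    (fun z : Outcome X K => ∑ a, (dyadicBin i).indicator (1 : ℝ → ℝ) |z.2.2 a - z.2.1 a|) D := by
  refine integrable_finsetSum _ fun a _ => ?_
  refine Integrable.of_bound (C := 1) (Measurable.aestronglyMeasurable ?_) (ae_of_all _ fun z => ?_)
  · exact (measurable_one.indicator measurableSet_Ioc).comp
      (f := fun z : Outcome X K => |z.2.2 a - z.2.1 a|) (by fun_prop)
  · by_cases h : |z.2.2 a - z.2.1 a| ∈ dyadicBin i <;> simp [h]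

/-- The expected loss caused by remapping, beyond `1 / T`. -/
noncomputable def remapBias (D : Measure (Outcome X K)) (T : ℕ) (σ : ℝ) : ℝ :=
  ∑ i ∈ Finset.range (numBins T), K * (binProb D i * max (2 * (1 / 2) ^ i - σ) 0)

lemma integral_greedyProb_mul_loss_le (hb : IsArgmin best) (hD : ∀ᵐ z ∂D, GoodOutcome z)
    (hσ : 0 ≤ σ) (hμ : 0 ≤ μ) {T : ℕ} (hT : 1 ≤ T) {π π' : X → Fin K} (hπ : Measurable π)
    (hπ' : Measurable π')
    (hint : Integrable (fun z : Outcome X K =>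
      ∑ a, greedyProb best σ μ π z.1 z.2.1 a * (z.2.2 a - z.2.2 (π' z.1))) D) :
    ∫ z, ∑ a, greedyProb best σ μ π z.1 z.2.1 a * (z.2.2 a - z.2.2 (π' z.1)) ∂D ≤
      (1 - μ) * (meanRemapLoss D best σ π - meanRemapLoss D best σ π') +
        μ * (σ + 2 * √(meanSqError D)) + (remapBias D T σ + 1 / T) := by
  rcases Nat.eq_zero_or_pos K with hK | hK
  · subst hK
    have : IsEmpty (Outcome X 0) := ⟨fun z => (best z.2.1).elim0⟩
    have h1 : D Set.univ = 0 := by rw [Set.univ_eq_empty_iff.2 this]; simp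
    simp [measure_univ] at h1
  have hK' : (0 : ℝ) < K := by exact_mod_cast hK
  have hL := integrable_remapLoss (σ := σ) hb hD hπ
  have hL' := integrable_remapLoss (σ := σ) hb hD hπ'
  have hN := integrable_norm_sub hD
  have i1 : Integrable (fun z : Outcome X K => (1 - μ) * (remapLoss best σ π z -
      remapLoss best σ π' z)) D := (hL.sub hL').const_mul _
  have i2 : Integrable (fun z : Outcome X K => μ * (σ + 2 * ‖z.2.2 - z.2.1‖)) D :=
    ((integrable_const _).add (hN.const_mul _)).const_mul _
  have i3 : Integrable (fun z : Outcome X K => ∑ i ∈ Finset.range (numBins T),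
      (∑ a, (dyadicBin i).indicator 1 |z.2.2 a - z.2.1 a|) * max (2 * (1 / 2 : ℝ) ^ i - σ) 0) D :=
    integrable_finsetSum _ fun i _ => (integrable_sum_indicator i).mul_const _
  calc _ ≤ ∫ z : Outcome X K, ((1 - μ) * (remapLoss best σ π z - remapLoss best σ π' z) +
        μ * (σ + 2 * ‖z.2.2 - z.2.1‖) + (∑ i ∈ Finset.range (numBins T),
          (∑ a, (dyadicBin i).indicator 1 |z.2.2 a - z.2.1 a|) * max (2 * (1 / 2 : ℝ) ^ i - σ) 0
          + 1 / T)) ∂D := by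
        refine integral_mono_ae hint ((i1.add i2).add (i3.add (integrable_const _))) ?_
        filter_upwards [hD] with z hz
        have h1 := sum_greedyProb_mul_loss_le hb hσ hμ π z (π' z.1)
        have h2 := remap_loss_le (best := best) hσ hT hz (π' z.1)
        simp only [remapLoss]
        linarith
    _ = (∫ z, (1 - μ) * (remapLoss best σ π z - remapLoss best σ π' z) ∂D +
          ∫ z : Outcome X K, μ * (σ + 2 * ‖z.2.2 - z.2.1‖) ∂D) + ((∑ i ∈ Finset.range (numBins T),
          (∫ z : Outcome X K, ∑ a, (dyadicBin i).indicator 1 |z.2.2 a - z.2.1 a| ∂D) *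
            max (2 * (1 / 2 : ℝ) ^ i - σ) 0) + 1 / T) := by
        have e1 := integral_add (i1.add i2) (i3.add (integrable_const (1 / (T : ℝ))))
        have e2 := integral_add i1 i2
        have e3 := integral_add i3 (integrable_const (1 / (T : ℝ)))
        simp only [Pi.add_apply] at e1
        rw [e1, e2, e3, integral_finsetSum _ fun i _ => (integrable_sum_indicator i).mul_const _]
        simp only [integral_mul_const, integral_const, probReal_univ, one_smul]
    _ ≤ _ := by
        have h := integral_norm_sub_le hD
        have e : ∀ i, (∫ z : Outcome X K, ∑ a, (dyadicBin i).indicator 1 |z.2.2 a - z.2.1 a| ∂D) *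
            max (2 * (1 / 2 : ℝ) ^ i - σ) 0 =
            K * (binProb D i * max (2 * (1 / 2) ^ i - σ) 0) := by
          intro i
          rw [binProb]
          field_simp
        simp only [e]
        rw [integral_const_mul, integral_sub hL hL', integral_const_mul,
          integral_add (integrable_const _) (hN.const_mul _), integral_const_mul (2 : ℝ)]
        simp only [integral_const, probReal_univ, one_smul]
        rw [← meanRemapLoss, ← meanRemapLoss, remapBias]
        gcongr

end Integrated

/-! ### The two-phase learner and supermartingales along its data set -/

section TwoPhase

variable {X : Type*} {K : ℕ}

/-- Uniform exploration for `B` rounds, then `ε`-greedy with action remapping whose threshold is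
the function `s` of the first `B` observations. -/
noncomputable def twoPhase (B : ℕ) (best : (Fin K → ℝ) → Fin K)
    (erm : List (X × (Fin K → ℝ)) → X → Fin K) (s : List (Observation X K) → ℝ) (μ : ℝ) :
    Learner X K :=
  fun h x m a =>
    if h.length < B then 1 / (K : ℝ)
    else epsGreedyAR best erm (s (h.take B)) μ (h.drop B) x m a

/-- The data set of the second phase after the observations `h`. -/
noncomputable def phaseData (B : ℕ) (best : (Fin K → ℝ) → Fin K)
    (erm : List (X × (Fin K → ℝ)) → X → Fin K) (s : List (Observation X K) → ℝ) (μ : ℝ)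
    (h : List (Observation X K)) : List (X × (Fin K → ℝ)) :=
  greedyData best erm (s (h.take B)) μ (h.drop B)

variable {B : ℕ} {best : (Fin K → ℝ) → Fin K} {erm : List (X × (Fin K → ℝ)) → X → Fin K}
  {s : List (Observation X K) → ℝ} {μ : ℝ}

lemma greedyData_append (σ : ℝ) (h : List (Observation X K)) (o : Observation X K) :
    greedyData best erm σ μ (h ++ [o]) = greedyData best erm σ μ h ++
      [(o.context, costVec best σ μ (erm (greedyData best erm σ μ h)) o)] := by
  simp only [greedyData, List.foldl_append]
  rfl

lemma phaseData_append {h : List (Observation X K)} (hB : B ≤ h.length) (o : Observation X K) :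
    phaseData B best erm s μ (h ++ [o]) = phaseData B best erm s μ h ++
      [(o.context, costVec best (s (h.take B)) μ (erm (phaseData B best erm s μ h)) o)] := by
  simp only [phaseData, List.take_append_of_le_length hB, List.drop_append_of_le_length hB,
    greedyData_append]

lemma twoPhase_of_le {h : List (Observation X K)} (hB : B ≤ h.length) (x : X) (m : Fin K → ℝ)
    (a : Fin K) : twoPhase B best erm s μ h x m a =
      greedyProb best (s (h.take B)) μ (erm (phaseData B best erm s μ h)) x m a := by
  rw [twoPhase, if_neg (not_lt.2 hB)]
  rfl

lemma twoPhase_of_lt {h : List (Observation X K)} (hB : h.length < B) (x : X) (m : Fin K → ℝ)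
    (a : Fin K) : twoPhase B best erm s μ h x m a = 1 / K := by
  rw [twoPhase, if_pos hB]

/-- A sum over the data set of the second phase. -/
noncomputable def phaseSum (B : ℕ) (best : (Fin K → ℝ) → Fin K)
    (erm : List (X × (Fin K → ℝ)) → X → Fin K) (s : List (Observation X K) → ℝ) (μ : ℝ)
    (F : ℝ → X × (Fin K → ℝ) → ℝ) (h : List (Observation X K)) : ℝ :=
  ((phaseData B best erm s μ h).map (F (s (h.take B)))).sum

lemma phaseSum_append {h : List (Observation X K)} (hB : B ≤ h.length) (o : Observation X K)
    (F : ℝ → X × (Fin K → ℝ) → ℝ) :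
    phaseSum B best erm s μ F (h ++ [o]) = phaseSum B best erm s μ F h +
      F (s (h.take B)) (o.context,
        costVec best (s (h.take B)) μ (erm (phaseData B best erm s μ h)) o) := by
  simp only [phaseSum, phaseData_append hB, List.take_append_of_le_length hB]
  simp

lemma phaseSum_of_length {h : List (Observation X K)} (hB : h.length = B)
    (F : ℝ → X × (Fin K → ℝ) → ℝ) : phaseSum B best erm s μ F h = 0 := by
  have : h.drop B = [] := List.drop_eq_nil_of_le hB.le
  simp [phaseSum, phaseData, this, greedyData]

lemma plays_eq_append {n : ℕ} (w : Play X K (n + 1)) :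
    plays w = plays w.init ++ [observe (w.1 (Fin.last n)) (w.2 (Fin.last n))] := by
  rw [plays, List.ofFn_succ_last]
  rfl

variable [MeasurableSpace X] {D : Measure (Outcome X K)}
  {policies : Finset (X → Fin K)}

/-- The standing assumptions of the analysis. -/
structure TwoPhaseSetting (D : Measure (Outcome X K)) (policies : Finset (X → Fin K)) (B : ℕ)
    (best : (Fin K → ℝ) → Fin K) (erm : List (X × (Fin K → ℝ)) → X → Fin K)
    (s : List (Observation X K) → ℝ) (μ : ℝ) : Prop where
  good : ∀ᵐ z ∂D, GoodOutcome z
  policy : ∀ π ∈ policies, Measurable π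
  argmin : IsArgmin best
  oracle : IsERMOracle policies erm
  mu_pos : 0 < μ
  mu_le : μ ≤ 1
  nonneg : ∀ h, 0 ≤ s h
  tame : Tame fun w : Play X K B => s (plays w)

lemma TwoPhaseSetting.tame_threshold (H : TwoPhaseSetting D policies B best erm s μ) (k : ℕ) :
    Tame fun w : Play X K (B + k) => s ((plays w).take B) := by
  have h : ∀ w : Play X K (B + k), s ((plays w).take B) =
      s (plays (w.restrict B (Nat.le_add_right B k))) := fun w => by rw [take_plays]
  simp only [h]
  exact ⟨H.tame.measurable.comp (Play.measurable_restrict _ _),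
    H.tame.bounded.imp fun C hC w hw => hC _ fun i => hw _⟩

-- The data set is a list, so its measurability is expressed by listing it as a measurable vector of
-- fixed length k. The induction must carry the data itself because each cost vector depends on the
-- oracle's answer to the earlier ones.
set_option maxHeartbeats 800000 in
lemma TwoPhaseSetting.exists_phaseData (H : TwoPhaseSetting D policies B best erm s μ) (k : ℕ) :
    ∃ v : Play X K (B + k) → Fin k → X × (Fin K → ℝ), Measurable v ∧
      ∀ w, phaseData B best erm s μ (plays w) = List.ofFn (v w) := by
  induction k with
  | zero =>
    refine ⟨fun _ => Fin.elim0, measurable_const, fun w => ?_⟩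
    have : (plays w).drop B = [] := List.drop_eq_nil_of_le (by simp)
    simp [phaseData, this, greedyData]
  | succ k ih =>
    obtain ⟨v, hv, hvw⟩ := ih
    have hinit : Measurable fun w : Play X K (B + k + 1) => w.init := Play.measurable_restrict _ _
    have hz : Measurable fun w : Play X K (B + k + 1) => w.1 (Fin.last (B + k)) := by fun_prop
    have ha : Measurable fun w : Play X K (B + k + 1) => w.2 (Fin.last (B + k)) := by fun_prop
    have herm : Measurable fun w : Play X K (B + k + 1) =>
        erm (List.ofFn (v w.init)) (w.1 (Fin.last (B + k))).1 :=
      (H.oracle.measurable k).comp ((hv.comp hinit).prodMk hz.fst)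
    have hs := (H.tame_threshold k).measurable.comp hinit
    refine ⟨fun w => Fin.snoc (α := fun _ => X × (Fin K → ℝ)) (v (Play.init w))
      ((w.1 (Fin.last (B + k))).1, costVec best (s ((plays (Play.init w)).take B)) μ
        -- The greedy policy may be frozen at its value in the current context, the only place where
        -- the cost vector consults it.
        (fun _ => erm (List.ofFn (v (Play.init w))) (w.1 (Fin.last (B + k))).1)
        (observe (w.1 (Fin.last (B + k))) (w.2 (Fin.last (B + k))))), ?_, fun w => ?_⟩
    · refine measurable_snoc_left.comp ((hv.comp hinit).prodMk (hz.fst.prodMk ?_))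
      refine measurable_fin_eval (f := fun a (w : Play X K (B + k + 1)) =>
        costVec best (s ((plays (Play.init w)).take B)) μ
        (fun _ => erm (List.ofFn (v (Play.init w))) (w.1 (Fin.last (B + k))).1)
        (observe (w.1 (Fin.last (B + k))) a)) (fun a => ?_) ha
      refine measurable_fin_eval (f := fun c (w : Play X K (B + k + 1)) =>
        costVec best (s ((plays (Play.init w)).take B)) μ
        (fun _ => c) (observe (w.1 (Fin.last (B + k))) a)) (fun c => ?_) herm
      exact (measurable_costVec H.argmin c a).comp (hs.prodMk hz)
    · have e := plays_eq_append (n := B + k) w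
      change phaseData B best erm s μ (plays (n := B + k + 1) w) = _
      rw [e, phaseData_append (by simp), hvw (Play.init w), List.ofFn_succ_last]
      simp only [Fin.snoc_castSucc, Fin.snoc_last]
      rfl

lemma TwoPhaseSetting.isRandomized (H : TwoPhaseSetting D policies B best erm s μ) :
    IsRandomized (twoPhase B best erm s μ) where
  measurable n a := by
    rcases lt_or_ge n B with hn | hn
    · simp [twoPhase_of_lt, hn]
    · obtain ⟨k, rfl⟩ := Nat.exists_eq_add_of_le hn
      obtain ⟨v, hv, hvw⟩ := H.exists_phaseData k
      have e : ∀ q : Play X K (B + k) × Outcome X K,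
          twoPhase B best erm s μ (plays q.1) q.2.1 q.2.2.1 a =
          greedyProb best (s ((plays q.1).take B)) μ
            (fun _ => erm (List.ofFn (v q.1)) q.2.1) q.2.1 q.2.2.1 a := by
        intro q
        rw [twoPhase_of_le (by simp), hvw]
        rfl
      simp only [e]
      refine measurable_fin_eval (f := fun c (q : Play X K (B + k) × Outcome X K) =>
        greedyProb best (s ((plays q.1).take B)) μ (fun _ => c) q.2.1 q.2.2.1 a) (fun c => ?_)
        ((H.oracle.measurable k).comp (f := fun q : Play X K (B + k) × Outcome X K => (v q.1, q.2.1))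
          ((hv.comp measurable_fst).prodMk (measurable_fst.comp measurable_snd)))
      exact (measurable_greedyProb H.argmin c a).comp
        (f := fun q : Play X K (B + k) × Outcome X K => (s ((plays q.1).take B), q.2))
        (((H.tame_threshold k).measurable.comp measurable_fst).prodMk measurable_snd)
  nonneg h x m a := by
    rw [twoPhase]
    split_ifs
    · positivity
    · exact greedyProb_nonneg H.mu_pos.le H.mu_le _ _ _ _
  sum_eq_one h x m := by
    have hK : (K : ℝ) ≠ 0 := by
      have := (best fun _ => 0).pos
      exact_mod_cast this.ne'
    by_cases hB : h.length < B
    · simp [twoPhase_of_lt hB, hK]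
    · simp only [twoPhase_of_le (not_lt.1 hB)]
      exact sum_greedyProb (H.nonneg _) _ _ _

lemma TwoPhaseSetting.norm_le_of_mem (H : TwoPhaseSetting D policies B best erm s μ) (k : ℕ)
    {w : Play X K (B + k)} (hw : w.Good) {q : X × (Fin K → ℝ)}
    (hq : q ∈ phaseData B best erm s μ (plays w)) :
    ‖q.2‖ ≤ K / μ + s ((plays w).take B) := by
  induction k with
  | zero =>
    have : (plays w).drop B = [] := List.drop_eq_nil_of_le (by simp)
    simp [phaseData, this, greedyData] at hq
  | succ k ih =>
    have e := plays_eq_append (n := B + k) w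
    change q ∈ phaseData B best erm s μ (plays (n := B + k + 1) w) at hq
    change _ ≤ _ + s ((plays (n := B + k + 1) w).take B)
    rw [e, phaseData_append (by simp)] at hq
    rw [e, List.take_append_of_le_length (by simp)]
    rcases List.mem_append.1 hq with h | h
    · exact ih (Play.Good.init hw) h
    · rw [List.mem_singleton.1 h]
      exact norm_costVec_le_of_good H.argmin (H.nonneg _) H.mu_pos H.mu_le _ (hw _) _

/-- Measurable functions of a threshold and a data point which are bounded on bounded sets. -/
structure TameCost (F : ℝ → X × (Fin K → ℝ) → ℝ) : Prop where
  measurable : Measurable fun q : ℝ × (X × (Fin K → ℝ)) => F q.1 q.2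
  bounded : ∀ C, ∃ C', ∀ σ q, 0 ≤ σ → σ ≤ C → ‖q.2‖ ≤ C → |F σ q| ≤ C'

lemma TwoPhaseSetting.tame_phaseSum (H : TwoPhaseSetting D policies B best erm s μ) (k : ℕ)
    {F : ℝ → X × (Fin K → ℝ) → ℝ} (hF : TameCost F) :
    Tame fun w : Play X K (B + k) => phaseSum B best erm s μ F (plays w) := by
  obtain ⟨v, hv, hvw⟩ := H.exists_phaseData k
  have hs := H.tame_threshold k
  obtain ⟨C, hC⟩ := hs.bounded
  have hC' : ∀ w : Play X K (B + k), w.Good → s ((plays w).take B) ≤ C :=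
    fun w hw => (le_abs_self _).trans (hC w hw)
  have e : ∀ w : Play X K (B + k), phaseSum B best erm s μ F (plays w) =
      ∑ i, F (s ((plays w).take B)) (v w i) := by
    intro w
    rw [phaseSum, hvw, List.map_ofFn, List.sum_ofFn]
    rfl
  simp only [e]
  refine Tame.sum _ fun i _ => ⟨?_, ?_⟩
  · exact hF.measurable.comp (hs.measurable.prodMk ((measurable_pi_apply i).comp hv))
  · obtain ⟨C', hC''⟩ := hF.bounded (K / μ + C)
    refine ⟨C', fun w hw => hC'' _ _ (H.nonneg _) ?_ ?_⟩
    · exact (hC' w hw).trans (le_add_of_nonneg_left (div_nonneg (Nat.cast_nonneg _) H.mu_pos.le))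
    · refine (H.norm_le_of_mem k hw ?_).trans (add_le_add le_rfl (hC' w hw))
      rw [hvw, List.mem_ofFn]
      exact ⟨i, rfl⟩

lemma TwoPhaseSetting.condExpect_eq {h : List (Observation X K)} (hB : B ≤ h.length)
    (f : Outcome X K → Fin K → ℝ) :
    condExpect D (twoPhase B best erm s μ) h f =
      ∫ z, ∑ a, greedyProb best (s (h.take B)) μ (erm (phaseData B best erm s μ h)) z.1 z.2.1 a *
        f z a ∂D := by
  simp only [condExpect, twoPhase_of_le hB]

variable [IsProbabilityMeasure D]

/-- Increments of nonpositive conditional mean, for every threshold and every policy the oracle may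
return, form a supermartingale starting at 0 in round B. -/
lemma TwoPhaseSetting.integral_phaseSum_nonpos (H : TwoPhaseSetting D policies B best erm s μ)
    {F : ℝ → X × (Fin K → ℝ) → ℝ} (hF : TameCost F)
    (h : ∀ σ, 0 ≤ σ → ∀ π ∈ policies, ∫ z, ∑ a, greedyProb best σ μ π z.1 z.2.1 a *
      F σ (z.1, costVec best σ μ π (observe z a)) ∂D ≤ 0) (k : ℕ) :
    ∫ w : Play X K (B + k), phaseSum B best erm s μ F (plays w)
      ∂(interactionLaw D (B + k) (twoPhase B best erm s μ)) ≤ 0 := by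
  induction k with
  | zero =>
    refine le_of_eq ?_
    rw [integral_congr_ae (g := fun _ => 0)]
    · simp
    · exact ae_of_all _ fun w => phaseSum_of_length (by simp) F
  | succ k ih =>
    refine le_trans ?_ ih
    refine integral_succ_le_of_add (n := B + k) H.isRandomized H.good (H.tame_phaseSum (k + 1) hF)
      (H.tame_phaseSum k hF) (fun w z a => F (s ((plays w).take B)) (z.1,
        costVec best (s ((plays w).take B)) μ (erm (phaseData B best erm s μ (plays w)))
          (observe z a))) (fun w z a => ?_) fun w _ => ?_
    · rw [plays_snoc, phaseSum_append (by simp)]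
      rfl
    · rw [TwoPhaseSetting.condExpect_eq (by simp)]
      exact h _ (H.nonneg _) _ (H.oracle.mem _)

/-- If the exponentials of the increments have conditional mean at most one, the exponential of the
sum has mean at most one. -/
lemma TwoPhaseSetting.integral_exp_phaseSum_le (H : TwoPhaseSetting D policies B best erm s μ)
    {F : ℝ → X × (Fin K → ℝ) → ℝ} (hF : TameCost F)
    (h : ∀ σ, 0 ≤ σ → ∀ π ∈ policies, ∫ z, ∑ a, greedyProb best σ μ π z.1 z.2.1 a *
      Real.exp (F σ (z.1, costVec best σ μ π (observe z a))) ∂D ≤ 1) (k : ℕ) :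
    Tame (fun w : Play X K (B + k) => Real.exp (phaseSum B best erm s μ F (plays w))) ∧
    ∫ w : Play X K (B + k), Real.exp (phaseSum B best erm s μ F (plays w))
      ∂(interactionLaw D (B + k) (twoPhase B best erm s μ)) ≤ 1 := by
  have htame : ∀ k, Tame fun w : Play X K (B + k) =>
      Real.exp (phaseSum B best erm s μ F (plays w)) := by
    intro k
    obtain ⟨C, hC⟩ := (H.tame_phaseSum k hF).bounded
    refine ⟨(H.tame_phaseSum k hF).measurable.exp, Real.exp C, fun w hw => ?_⟩
    rw [abs_of_pos (Real.exp_pos _)]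
    exact Real.exp_le_exp.2 ((le_abs_self _).trans (hC w hw))
  refine ⟨htame k, ?_⟩
  induction k with
  | zero =>
    have := isProbabilityMeasure_interactionLaw (D := D) H.isRandomized (B + 0)
    refine le_of_eq ?_
    rw [integral_congr_ae (g := fun _ => 1)]
    · simp
    · refine ae_of_all _ fun w => ?_
      simp [phaseSum_of_length]
  | succ k ih =>
    refine le_trans ?_ ih
    refine integral_succ_le (n := B + k) H.isRandomized H.good (htame (k + 1)) (htame k)
      fun w hw => ?_
    rw [TwoPhaseSetting.condExpect_eq (by simp)]
    have e : ∀ z a, phaseSum B best erm s μ F (plays (Play.snoc w z a)) =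
        phaseSum B best erm s μ F (plays w) + F (s ((plays w).take B)) (z.1,
          costVec best (s ((plays w).take B)) μ (erm (phaseData B best erm s μ (plays w)))
            (observe z a)) := by
      intro z a
      rw [plays_snoc, phaseSum_append (by simp)]
      rfl
    simp only [e, Real.exp_add, mul_left_comm _ (Real.exp (phaseSum B best erm s μ F (plays w))),
      ← Finset.mul_sum]
    rw [integral_const_mul]
    exact mul_le_of_le_one_right (Real.exp_pos _).le (h _ (H.nonneg _) _ (H.oracle.mem _))

end TwoPhase

/-! ### Closure properties of tame functions -/

section TameCost

variable {X : Type*} {K : ℕ} [MeasurableSpace X]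

lemma Tame.comp_continuous {n : ℕ} {f : Play X K n → ℝ} (hf : Tame f) {G : ℝ → ℝ}
    (hG : Continuous G) : Tame fun w => G (f w) := by
  obtain ⟨C, hC⟩ := hf.bounded
  obtain ⟨C', hC'⟩ := (isCompact_Icc (a := -C) (b := C)).exists_bound_of_continuousOn hG.continuousOn
  exact ⟨hG.measurable.comp hf.measurable, C', fun w hw => hC' _ (abs_le.1 (hC w hw))⟩

lemma TameCost.add {F G : ℝ → X × (Fin K → ℝ) → ℝ} (hF : TameCost F) (hG : TameCost G) :
    TameCost fun σ q => F σ q + G σ q := by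
  refine ⟨hF.measurable.add hG.measurable, fun C => ?_⟩
  obtain ⟨C₁, h₁⟩ := hF.bounded C
  obtain ⟨C₂, h₂⟩ := hG.bounded C
  exact ⟨C₁ + C₂, fun σ q h0 h1 h2 => (abs_add_le _ _).trans
    (add_le_add (h₁ σ q h0 h1 h2) (h₂ σ q h0 h1 h2))⟩

lemma TameCost.const_mul {F : ℝ → X × (Fin K → ℝ) → ℝ} (hF : TameCost F) (c : ℝ) :
    TameCost fun σ q => c * F σ q := by
  refine ⟨hF.measurable.const_mul c, fun C => ?_⟩
  obtain ⟨C₁, h₁⟩ := hF.bounded C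
  refine ⟨|c| * C₁, fun σ q h0 h1 h2 => ?_⟩
  rw [abs_mul]
  exact mul_le_mul_of_nonneg_left (h₁ σ q h0 h1 h2) (abs_nonneg c)

lemma TameCost.sub {F G : ℝ → X × (Fin K → ℝ) → ℝ} (hF : TameCost F) (hG : TameCost G) :
    TameCost fun σ q => F σ q - G σ q := by
  simpa [sub_eq_add_neg] using hF.add (hG.const_mul (-1))

lemma tameCost_norm_sq : TameCost fun (_ : ℝ) (q : X × (Fin K → ℝ)) => ‖q.2‖ ^ 2 := by
  refine ⟨by fun_prop, fun C => ⟨C ^ 2, fun σ q _ _ h => ?_⟩⟩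
  rw [abs_of_nonneg (by positivity)]
  exact pow_le_pow_left₀ (norm_nonneg _) h 2

lemma tameCost_apply {π : X → Fin K} (hπ : Measurable π) :
    TameCost fun (_ : ℝ) (q : X × (Fin K → ℝ)) => q.2 (π q.1) := by
  refine ⟨?_, fun C => ⟨C, fun σ q _ _ h => (norm_le_pi_norm q.2 _).trans h⟩⟩
  exact measurable_fin_eval (f := fun b (q : ℝ × (X × (Fin K → ℝ))) => q.2.2 b)
    (fun b => by fun_prop) (hπ.comp (by fun_prop))

variable {best : (Fin K → ℝ) → Fin K} {μ : ℝ} {D : Measure (Outcome X K)}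

lemma tameCost_costVariance : TameCost fun (σ : ℝ) (_ : X × (Fin K → ℝ)) => costVariance D σ μ := by
  have hc : Continuous fun σ => costVariance D σ μ := by unfold costVariance; fun_prop
  refine ⟨hc.measurable.comp measurable_fst, fun C => ?_⟩
  obtain ⟨C', hC'⟩ := (isCompact_Icc (a := 0) (b := C)).exists_bound_of_continuousOn hc.continuousOn
  exact ⟨C', fun σ q h0 h1 _ => hC' _ ⟨h0, h1⟩⟩

lemma tameCost_meanRemapLoss [IsProbabilityMeasure D] (hb : IsArgmin best)
    (hD : ∀ᵐ z ∂D, GoodOutcome z) {π : X → Fin K} (hπ : Measurable π) :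
    TameCost fun (σ : ℝ) (_ : X × (Fin K → ℝ)) => meanRemapLoss D best σ π :=
  ⟨(measurable_meanRemapLoss hb hπ).comp measurable_fst,
    fun _ => ⟨1, fun σ _ _ _ _ => abs_meanRemapLoss_le hD σ π⟩⟩

end TameCost

/-! ### Excess risk of the ERM policy through an exponential potential -/

section Potential

variable {X : Type*} {K : ℕ} [MeasurableSpace X] {B : ℕ} {best : (Fin K → ℝ) → Fin K}
  {erm : List (X × (Fin K → ℝ)) → X → Fin K} {s : List (Observation X K) → ℝ} {μ η : ℝ}
  {D : Measure (Outcome X K)} {policies : Finset (X → Fin K)}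

/-- Exponent of the self-normalized exponential process of the policy `π`. -/
noncomputable def expCost (D : Measure (Outcome X K)) (best : (Fin K → ℝ) → Fin K) (μ η : ℝ)
    (π : X → Fin K) (σ : ℝ) (q : X × (Fin K → ℝ)) : ℝ :=
  η * meanRemapLoss D best σ π - η * q.2 (π q.1) - η ^ 2 * ‖q.2‖ ^ 2 -
    η ^ 2 * costVariance D σ μ

/-- The centred cost of the comparator and the centred squared norm of the cost vector. -/
noncomputable def centredCost (D : Measure (Outcome X K)) (best : (Fin K → ℝ) → Fin K) (μ η : ℝ)
    (π : X → Fin K) (σ : ℝ) (q : X × (Fin K → ℝ)) : ℝ :=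
  η * ‖q.2‖ ^ 2 - η * costVariance D σ μ + (q.2 (π q.1) - meanRemapLoss D best σ π)

/-- Upper bound on the excess risk of the greedy policy, in terms of the data. -/
noncomputable def potential (D : Measure (Outcome X K)) (policies : Finset (X → Fin K)) (B : ℕ)
    (best : (Fin K → ℝ) → Fin K) (erm : List (X × (Fin K → ℝ)) → X → Fin K)
    (s : List (Observation X K) → ℝ) (μ η : ℝ) (π : X → Fin K) (k : ℕ)
    (h : List (Observation X K)) : ℝ :=
  1 / η * ((∑ π' ∈ policies, Real.exp (phaseSum B best erm s μ (expCost D best μ η π') h)) /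
      policies.card - 1 + Real.log policies.card) +
    phaseSum B best erm s μ (centredCost D best μ η π) h +
    2 * η * k * costVariance D (s (h.take B)) μ

/-- A pathwise inequality. The exponential of the ERM policy is one summand of the total Φ, its
exponent is at most ln(Φ/N) + ln N, and the logarithm is linearized so that only the mean of Φ/N
will matter. ERM optimality then exchanges the empirical cost of the ERM policy for that of the
comparator. -/
lemma TwoPhaseSetting.mul_excess_le (H : TwoPhaseSetting D policies B best erm s μ) (hη : 0 < η)
    {π : X → Fin K} (hπ : π ∈ policies) (k : ℕ) (w : Play X K (B + k)) :
    k * (meanRemapLoss D best (s ((plays w).take B)) (erm (phaseData B best erm s μ (plays w))) -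
      meanRemapLoss D best (s ((plays w).take B)) π) ≤
      potential D policies B best erm s μ η π k (plays w) := by
  obtain ⟨v, -, hvw⟩ := H.exists_phaseData k
  set σ := s ((plays w).take B) with hσ
  set S := phaseData B best erm s μ (plays w) with hS
  have hN : (0 : ℝ) < policies.card := by exact_mod_cast Finset.card_pos.2 ⟨π, hπ⟩
  have hmem := H.oracle.mem S
  have hle := H.oracle.le S π hπ
  have hsum : ∀ F : ℝ → X × (Fin K → ℝ) → ℝ, phaseSum B best erm s μ F (plays w) =
      ∑ i, F σ (v w i) := fun F => by
    rw [phaseSum, hvw, List.map_ofFn, List.sum_ofFn]; rfl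
  have hlist : ∀ π' : X → Fin K, (S.map fun q => q.2 (π' q.1)).sum = ∑ i, (v w i).2 (π' (v w i).1) := fun π' => by
    rw [hS, hvw, List.map_ofFn, List.sum_ofFn]; rfl
  rw [hlist, hlist] at hle
  set Φ := ∑ π' ∈ policies, Real.exp (phaseSum B best erm s μ (expCost D best μ η π') (plays w))
    with hΦ
  have h1 : Real.exp (phaseSum B best erm s μ (expCost D best μ η (erm S)) (plays w)) ≤ Φ :=
    Finset.single_le_sum (f := fun π' =>
      Real.exp (phaseSum B best erm s μ (expCost D best μ η π') (plays w)))
      (fun _ _ => (Real.exp_pos _).le) hmem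
  have hΦ0 : 0 < Φ := (Real.exp_pos _).trans_le h1
  have h2 : phaseSum B best erm s μ (expCost D best μ η (erm S)) (plays w) ≤
      Φ / policies.card - 1 + Real.log policies.card := by
    have h3 := (Real.le_log_iff_exp_le hΦ0).2 h1
    have h4 := Real.log_le_sub_one_of_pos (div_pos hΦ0 hN)
    rw [Real.log_div hΦ0.ne' hN.ne'] at h4
    linarith
  have h3 := mul_le_mul_of_nonneg_left h2 (one_div_pos.2 hη).le
  rw [potential, ← hΦ, ← hσ]
  -- The variance is subtracted once in `expCost` and once in `centredCost`; the term 2ηkV of the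
  -- potential returns both.
  refine le_trans ?_ (add_le_add (add_le_add h3 le_rfl) le_rfl)
  rw [hsum, hsum]
  simp only [expCost, centredCost, Finset.sum_add_distrib, Finset.sum_sub_distrib, ← Finset.mul_sum,
    Finset.sum_const, Finset.card_univ, Fintype.card_fin, nsmul_eq_mul]
  have e : 1 / η * (η * (k * meanRemapLoss D best σ (erm S)) -
      η * ∑ i, (v w i).2 (erm S (v w i).1) - η ^ 2 * ∑ i, ‖(v w i).2‖ ^ 2 -
      η ^ 2 * (k * costVariance D σ μ)) = k * meanRemapLoss D best σ (erm S) -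
      ∑ i, (v w i).2 (erm S (v w i).1) - η * ∑ i, ‖(v w i).2‖ ^ 2 -
      η * (k * costVariance D σ μ) := by
    field_simp
  rw [e]
  linarith

variable [IsProbabilityMeasure D]

lemma TwoPhaseSetting.tameCost_expCost (H : TwoPhaseSetting D policies B best erm s μ)
    {π : X → Fin K} (hπ : π ∈ policies) : TameCost (expCost D best μ η π) :=
  ((((tameCost_meanRemapLoss H.argmin H.good (H.policy π hπ)).const_mul η).sub
    ((tameCost_apply (H.policy π hπ)).const_mul η)).sub
    (tameCost_norm_sq.const_mul (η ^ 2))).sub (tameCost_costVariance.const_mul (η ^ 2))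

lemma TwoPhaseSetting.tameCost_centredCost (H : TwoPhaseSetting D policies B best erm s μ)
    {π : X → Fin K} (hπ : π ∈ policies) : TameCost (centredCost D best μ η π) :=
  ((tameCost_norm_sq.const_mul η).sub (tameCost_costVariance.const_mul η)).add
    ((tameCost_apply (H.policy π hπ)).sub
      (tameCost_meanRemapLoss H.argmin H.good (H.policy π hπ)))

lemma integral_centredCost_nonpos (hb : IsArgmin best) (hD : ∀ᵐ z ∂D, GoodOutcome z) {σ : ℝ}
    (hσ : 0 ≤ σ) (hμ : 0 < μ) (hμ1 : μ ≤ 1) (hη : 0 ≤ η) (π : X → Fin K) {π' : X → Fin K}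
    (hπ' : Measurable π') :
    ∫ z, ∑ a, greedyProb best σ μ π z.1 z.2.1 a *
      centredCost D best μ η π' σ (z.1, costVec best σ μ π (observe z a)) ∂D ≤ 0 := by
  -- The policy `π` is not assumed measurable; without integrability the integral is 0 by
  -- convention.
  by_cases hint : Integrable (fun z : Outcome X K => ∑ a, greedyProb best σ μ π z.1 z.2.1 a *
      centredCost D best μ η π' σ (z.1, costVec best σ μ π (observe z a))) D
  swap
  · rw [integral_undef hint]
  have hL := integrable_remapLoss (σ := σ) hb hD hπ'
  have i1 : Integrable (fun z : Outcome X K =>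
      η * (2 * σ ^ 2 + 2 * (K ^ 2 / μ) * ‖z.2.2 - z.2.1‖ ^ 2)) D :=
    ((integrable_const _).add ((integrable_norm_sub_sq hD).const_mul _)).const_mul _
  have i2 : Integrable (fun z : Outcome X K => remapLoss best σ π' z -
      (η * costVariance D σ μ + meanRemapLoss D best σ π')) D := hL.sub (integrable_const _)
  calc _ ≤ ∫ z : Outcome X K, (η * (2 * σ ^ 2 + 2 * (K ^ 2 / μ) * ‖z.2.2 - z.2.1‖ ^ 2) +
        (remapLoss best σ π' z - (η * costVariance D σ μ + meanRemapLoss D best σ π'))) ∂D := by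
        refine integral_mono hint (i1.add i2) fun z => ?_
        have h1 := mul_le_mul_of_nonneg_left (sum_greedyProb_mul_norm_sq_le hb hσ hμ hμ1 π z) hη
        have h2 := sum_greedyProb_mul_costVec (best := best) hσ hμ hμ1 π z (π' z.1)
        have h3 := sum_greedyProb (best := best) (μ := μ) hσ π z.1 z.2.1
        have e : ∑ a, greedyProb best σ μ π z.1 z.2.1 a *
            centredCost D best μ η π' σ (z.1, costVec best σ μ π (observe z a)) =
            η * ∑ a, greedyProb best σ μ π z.1 z.2.1 a *
              ‖costVec best σ μ π (observe z a)‖ ^ 2 +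
            (∑ a, greedyProb best σ μ π z.1 z.2.1 a * costVec best σ μ π (observe z a) (π' z.1) -
            (∑ a, greedyProb best σ μ π z.1 z.2.1 a) *
              (η * costVariance D σ μ + meanRemapLoss D best σ π')) := by
          rw [Finset.mul_sum, Finset.sum_mul, ← Finset.sum_sub_distrib, ← Finset.sum_add_distrib]
          refine Finset.sum_congr rfl fun a _ => ?_
          simp only [centredCost]
          ring
        simp only [e, h2, h3, one_mul]
        exact add_le_add h1 le_rfl
    _ = 0 := by
        rw [integral_add i1 i2, integral_const_mul, integral_add (integrable_const _)
          ((integrable_norm_sub_sq hD).const_mul _), integral_const_mul (2 * (K ^ 2 / μ) : ℝ),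
          integral_sub hL (integrable_const _)]
        simp only [integral_const, probReal_univ, one_smul]
        rw [← meanSqError, ← meanRemapLoss, costVariance]
        ring

/-- The threshold is fixed after B rounds, so later rounds integrate out. -/
lemma TwoPhaseSetting.integral_threshold_le (H : TwoPhaseSetting D policies B best erm s μ)
    {G : ℝ → ℝ} (hG : Continuous G) (k : ℕ) :
    ∫ w : Play X K (B + k), G (s ((plays w).take B))
        ∂(interactionLaw D (B + k) (twoPhase B best erm s μ)) ≤
      ∫ w : Play X K B, G (s (plays w)) ∂(interactionLaw D B (twoPhase B best erm s μ)) := by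
  induction k with
  | zero =>
    refine le_of_eq (integral_congr_ae (ae_of_all _ fun w => ?_))
    simp only [Nat.add_zero]
    rw [List.take_of_length_le (by simp)]
  | succ k ih =>
    refine le_trans ?_ ih
    refine le_trans (le_of_eq (integral_congr_ae (ae_of_all _ fun w => ?_)))
      (integral_init_le (n := B + k) H.isRandomized H.good
        ((H.tame_threshold k).comp_continuous hG))
    have e := plays_eq_append (n := B + k) w
    change G (s ((plays (n := B + k + 1) w).take B)) = _
    rw [e, List.take_append_of_le_length (by simp)]

/-- Each exponential has mean at most 1, so Φ/N - 1 has nonpositive mean and leaves ln N / η; the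
centred part has nonpositive mean; the rest is the accumulated variance. -/
lemma TwoPhaseSetting.integral_potential_le (H : TwoPhaseSetting D policies B best erm s μ)
    (hη : 0 < η) {π : X → Fin K} (hπ : π ∈ policies) (k : ℕ) :
    Tame (fun w : Play X K (B + k) => potential D policies B best erm s μ η π k (plays w)) ∧
    ∫ w : Play X K (B + k), potential D policies B best erm s μ η π k (plays w)
      ∂(interactionLaw D (B + k) (twoPhase B best erm s μ)) ≤
    Real.log policies.card / η + 2 * η * k *
      ∫ w : Play X K B, costVariance D (s (plays w)) μ
        ∂(interactionLaw D B (twoPhase B best erm s μ)) := by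
  have hN : (0 : ℝ) < policies.card := by exact_mod_cast Finset.card_pos.2 ⟨π, hπ⟩
  have hp := isProbabilityMeasure_interactionLaw (D := D) H.isRandomized (B + k)
  have hW : Continuous fun σ => costVariance D σ μ := by unfold costVariance; fun_prop
  have hexp : ∀ π' ∈ policies, _ := fun π' hπ' =>
    H.integral_exp_phaseSum_le (H.tameCost_expCost (η := η) hπ')
      (fun σ hσ π'' _ => integral_greedyProb_mul_exp_le H.argmin H.good hσ H.mu_pos H.mu_le π''
        (H.policy π' hπ') η) k
  have hcen := H.integral_phaseSum_nonpos (H.tameCost_centredCost (η := η) hπ)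
    (fun σ hσ π'' _ => integral_centredCost_nonpos H.argmin H.good hσ H.mu_pos H.mu_le hη.le π''
        (H.policy π hπ)) k
  have t1 : Tame fun w : Play X K (B + k) => ∑ π' ∈ policies,
      Real.exp (phaseSum B best erm s μ (expCost D best μ η π') (plays w)) :=
    Tame.sum _ fun π' hπ' => (hexp π' hπ').1
  have t2 := H.tame_phaseSum k (H.tameCost_centredCost (η := η) hπ)
  have t3 := (H.tame_threshold k).comp_continuous hW
  have t4 : Tame fun w : Play X K (B + k) => 1 / η * ((∑ π' ∈ policies,
      Real.exp (phaseSum B best erm s μ (expCost D best μ η π') (plays w))) / policies.card - 1 +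
        Real.log policies.card) := by
    simp only [div_eq_mul_inv]
    exact (Tame.const _).mul (((t1.mul (Tame.const _)).sub (Tame.const 1)).add (Tame.const _))
  have t5 : Tame fun w : Play X K (B + k) =>
      2 * η * k * costVariance D (s ((plays w).take B)) μ := (Tame.const _).mul t3
  refine ⟨(t4.add t2).add t5, ?_⟩
  have i1 := t1.integrable H.isRandomized H.good
  have i2 := t2.integrable H.isRandomized H.good
  have i4 := t4.integrable H.isRandomized H.good
  have i5 := t5.integrable H.isRandomized H.good
  simp only [potential]
  have i42 := (t4.add t2).integrable H.isRandomized H.good (D := D)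
  have i11 : Integrable (fun w : Play X K (B + k) => (∑ π' ∈ policies,
      Real.exp (phaseSum B best erm s μ (expCost D best μ η π') (plays w))) / policies.card - 1)
      (interactionLaw D (B + k) (twoPhase B best erm s μ)) :=
    (i1.div_const _).sub (integrable_const _)
  rw [integral_add i42 i5, integral_add i4 i2, integral_const_mul, integral_const_mul,
    integral_add i11 (integrable_const _), integral_sub (i1.div_const _) (integrable_const _), integral_div,
    integral_finsetSum _ fun π' hπ' => (hexp π' hπ').1.integrable H.isRandomized H.good]
  simp only [integral_const, probReal_univ, one_smul]
  have h1 : (∑ π' ∈ policies, ∫ w : Play X K (B + k),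
      Real.exp (phaseSum B best erm s μ (expCost D best μ η π') (plays w))
      ∂(interactionLaw D (B + k) (twoPhase B best erm s μ))) / policies.card ≤ 1 := by
    rw [div_le_one hN]
    refine (Finset.sum_le_card_nsmul _ _ 1 fun π' hπ' => (hexp π' hπ').2).trans ?_
    simp
  have h2 := H.integral_threshold_le hW k
  have h3 : 0 ≤ 2 * η * k := by positivity
  have h4 := mul_le_mul_of_nonneg_left h2 h3
  have h5 := mul_le_mul_of_nonneg_left h1 (one_div_pos.2 hη).le
  have h6 : 1 / η * Real.log policies.card = Real.log policies.card / η := by ring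
  linarith

end Potential

/-! ### Regret in terms of moments of the threshold -/

section Regret

variable {X : Type*} {K : ℕ} [MeasurableSpace X] {B : ℕ} {best : (Fin K → ℝ) → Fin K}
  {erm : List (X × (Fin K → ℝ)) → X → Fin K} {s : List (Observation X K) → ℝ} {μ η : ℝ}
  {D : Measure (Outcome X K)} {policies : Finset (X → Fin K)}

/-- The term k = 0 is 1/0 = 0. -/
lemma sum_range_inv_le {m T : ℕ} (hmT : m ≤ T) :
    ∑ k ∈ Finset.range m, 1 / (k : ℝ) ≤ 1 + Real.log T := by
  have hlog : 0 ≤ Real.log T := Real.log_natCast_nonneg T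
  rcases m with _ | m
  · simp; linarith
  · rw [Finset.sum_range_succ']
    have h := harmonic_le_one_add_log m
    have e : ((harmonic m : ℚ) : ℝ) = ∑ k ∈ Finset.range m, 1 / ((k + 1 : ℕ) : ℝ) := by
      simp [harmonic]
    rw [e] at h
    have h2 : Real.log m ≤ Real.log T := by
      rcases Nat.eq_zero_or_pos m with h0 | h0
      · simpa [h0] using hlog
      · exact Real.log_le_log (by exact_mod_cast h0) (by exact_mod_cast (Nat.le_succ m).trans hmT)
    simp only [Nat.cast_zero, div_zero, add_zero]
    linarith

lemma binProb_nonneg (i : ℕ) : 0 ≤ binProb D i :=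
  mul_nonneg (by positivity) (integral_nonneg fun _ =>
    Finset.sum_nonneg fun _ _ => Set.indicator_nonneg (fun _ _ => zero_le_one) _)

lemma continuous_remapBias (T : ℕ) : Continuous fun σ => remapBias D T σ := by
  unfold remapBias
  fun_prop

lemma remapBias_nonneg (T : ℕ) (σ : ℝ) : 0 ≤ remapBias D T σ :=
  Finset.sum_nonneg fun i _ => mul_nonneg (Nat.cast_nonneg _)
    (mul_nonneg (binProb_nonneg i) (le_max_right _ _))

variable [IsProbabilityMeasure D]

/-- Regret of the two-phase learner against one policy, in terms of moments of the threshold. -/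
lemma TwoPhaseSetting.regret_le (H : TwoPhaseSetting D policies B best erm s μ) (hη : 0 < η)
    {T : ℕ} (hT : 1 ≤ T) (hBT : B ≤ T) {π : X → Fin K} (hπ : π ∈ policies) :
    ∫ w : Play X K T, (∑ t, (w.1 t).2.2 (w.2 t) - ∑ t, (w.1 t).2.2 (π (w.1 t).1))
      ∂(interactionLaw D T (twoPhase B best erm s μ)) ≤
    B + 2 + (1 - μ) * (Real.log policies.card / η * (1 + Real.log T) + 2 * η * T *
      ∫ w : Play X K B, costVariance D (s (plays w)) μ
        ∂(interactionLaw D B (twoPhase B best erm s μ))) +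
    T * (μ * ∫ w : Play X K B, s (plays w) ∂(interactionLaw D B (twoPhase B best erm s μ)) +
      2 * μ * √(meanSqError D) +
      ∫ w : Play X K B, remapBias D T (s (plays w))
        ∂(interactionLaw D B (twoPhase B best erm s μ))) := by
  have hT' : (0 : ℝ) < T := by exact_mod_cast hT
  have halg := H.isRandomized
  have hμ0 := H.mu_pos.le
  have hμ1 : 0 ≤ 1 - μ := by linarith [H.mu_le]
  have hN : (1 : ℝ) ≤ policies.card := by exact_mod_cast Finset.card_pos.2 ⟨π, hπ⟩
  set alg := twoPhase B best erm s μ with halgdef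
  set g : Outcome X K → Fin K → ℝ := fun z a => z.2.2 a - z.2.2 (π z.1) with hg
  have hgm : ∀ a, Measurable fun z => g z a := fun a => by
    refine Measurable.sub (by fun_prop) ?_
    exact measurable_fin_eval (f := fun b (z : Outcome X K) => z.2.2 b) (fun b => by fun_prop)
      ((H.policy π hπ).comp measurable_fst)
  have hgC : ∀ z, GoodOutcome z → ∀ a, |g z a| ≤ 1 := fun z hz a => by
    have h1 := (hz a).2
    have h2 := (hz (π z.1)).2
    rw [hg, abs_le]
    constructor <;> linarith [h1.1, h1.2, h2.1, h2.2]
  set R : ℝ → ℝ := fun σ => μ * (σ + 2 * √(meanSqError D)) + (remapBias D T σ + 1 / T) with hR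
  have hRc : Continuous R := by
    have := continuous_remapBias (D := D) T
    fun_prop
  have hR0 : ∀ σ, 0 ≤ σ → 0 ≤ R σ := fun σ hσ => by
    have := remapBias_nonneg (D := D) T σ
    positivity
  -- Budget of the round after n observations. The case n = B is the first greedy round: it has no
  -- data yet, so it too is charged the trivial bound 1.
  set f : (n : ℕ) → Play X K n → ℝ := fun n w => if n ≤ B then 1 else
    (1 - μ) / (n - B : ℕ) * potential D policies B best erm s μ η π (n - B) (plays w) +
      R (s ((plays w).take B)) with hf
  have hfB : ∀ k, f (B + (k + 1)) = fun w => (1 - μ) / (k + 1 : ℕ) *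
      potential D policies B best erm s μ η π (k + 1) (plays w) + R (s ((plays w).take B)) := by
    intro k
    have : B + (k + 1) - B = k + 1 := by omega
    have h2 : ¬ (B + (k + 1) ≤ B) := by omega
    simp only [hf, this, h2, if_false]
  have hft : ∀ n, Tame (f n) := by
    intro n
    by_cases hn : n ≤ B
    · simp only [hf, hn, if_true]
      exact Tame.const 1
    · obtain ⟨k, rfl⟩ : ∃ k, n = B + (k + 1) := ⟨n - B - 1, by omega⟩
      rw [hfB]
      exact ((Tame.const _).mul (H.integral_potential_le hη hπ (k + 1)).1).add
        ((H.tame_threshold (k + 1)).comp_continuous hRc)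
  have hcond : ∀ n < T, ∀ w : Play X K n, w.Good → condExpect D alg (plays w) g ≤ f n w := by
    intro n _ w hw
    by_cases hn : n ≤ B
    · simp only [hf, hn, if_true]
      rw [condExpect]
      have h1 := norm_integral_le_of_norm_le_const (μ := D)
        (f := fun z => ∑ a, alg (plays w) z.1 z.2.1 a * g z a) (C := 1)
        (by filter_upwards [H.good] with z hz using abs_sum_alg_le halg _ _ _ (hgC z hz))
      refine (le_abs_self _).trans ?_
      simpa using h1
    · obtain ⟨k, rfl⟩ : ∃ k, n = B + (k + 1) := ⟨n - B - 1, by omega⟩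
      rw [hfB]
      have hint := integrable_sum_alg halg H.good w hgm hgC
      simp only [halgdef, twoPhase_of_le (h := plays w) (by simp : B ≤ (plays w).length)] at hint
      rw [TwoPhaseSetting.condExpect_eq (by simp)]
      refine (integral_greedyProb_mul_loss_le H.argmin H.good (H.nonneg _) hμ0 hT
        (H.policy _ (H.oracle.mem _)) (H.policy π hπ) hint).trans ?_
      have h1 := H.mul_excess_le hη hπ (k + 1) w
      have hk : (0 : ℝ) < (k + 1 : ℕ) := by positivity
      have h2 : (1 - μ) * (meanRemapLoss D best (s ((plays w).take B))
          (erm (phaseData B best erm s μ (plays w))) -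
          meanRemapLoss D best (s ((plays w).take B)) π) ≤ (1 - μ) / (k + 1 : ℕ) *
          potential D policies B best erm s μ η π (k + 1) (plays w) := by
        rw [div_mul_eq_mul_div, le_div_iff₀ hk, mul_assoc]
        refine mul_le_mul_of_nonneg_left ?_ hμ1
        rwa [mul_comm]
      simp only [hR]
      linarith
  have hmain := (integral_sum_le halg H.good hgm hgC f hft T hcond).2
  simp only [hg, Finset.sum_sub_distrib] at hmain
  refine hmain.trans ?_
  obtain ⟨m, rfl⟩ := Nat.exists_eq_add_of_le hBT
  rw [Finset.sum_range_add]
  have hpB := isProbabilityMeasure_interactionLaw (D := D) halg B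
  set W := ∫ w : Play X K B, costVariance D (s (plays w)) μ ∂(interactionLaw D B alg) with hW
  set R' := ∫ w : Play X K B, R (s (plays w)) ∂(interactionLaw D B alg) with hR'
  have hW0 : 0 ≤ W := integral_nonneg fun w => by
    have := meanSqError_nonneg (D := D)
    have := H.mu_pos
    simp only [costVariance, Pi.zero_apply]
    positivity
  have hR'0 : 0 ≤ R' := integral_nonneg fun w => hR0 _ (H.nonneg _)
  have hlogN : 0 ≤ Real.log policies.card := Real.log_nonneg hN
  have h1 : ∑ n ∈ Finset.range B, ∫ w, f n w ∂(interactionLaw D n alg) ≤ B := by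
    have : ∀ n ∈ Finset.range B, ∫ w, f n w ∂(interactionLaw D n alg) = 1 := by
      intro n hn
      have hp := isProbabilityMeasure_interactionLaw (D := D) halg n
      simp [hf, (Finset.mem_range.1 hn).le]
    rw [Finset.sum_congr rfl this]
    simp
  have h2 : ∀ k ∈ Finset.range m, ∫ w, f (B + k) w ∂(interactionLaw D (B + k) alg) ≤
      (if k = 0 then 1 else 0) +
        ((1 - μ) * (Real.log policies.card / η * (1 / k) + 2 * η * W) + R') := by
    intro k _
    rcases k with _ | k
    · have hp := isProbabilityMeasure_interactionLaw (D := D) halg (B + 0)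
      have e : ∫ w, f (B + 0) w ∂(interactionLaw D (B + 0) alg) = 1 := by simp [hf]
      rw [e]
      simp only [if_true, Nat.cast_zero, div_zero, mul_zero, zero_add]
      have : 0 ≤ (1 - μ) * (2 * η * W) := by positivity
      linarith
    · rw [hfB, integral_add ((Tame.const _).mul
        (H.integral_potential_le hη hπ (k + 1)).1 |>.integrable halg H.good)
        (((H.tame_threshold (k + 1)).comp_continuous hRc).integrable halg H.good),
        integral_const_mul]
      have hk : (0 : ℝ) < (k + 1 : ℕ) := by positivity
      have h3 := mul_le_mul_of_nonneg_left (H.integral_potential_le hη hπ (k + 1)).2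
        (div_nonneg hμ1 hk.le)
      have h4 := H.integral_threshold_le hRc (k + 1)
      rw [if_neg (Nat.succ_ne_zero k), zero_add]
      refine (add_le_add h3 h4).trans (le_of_eq ?_)
      rw [← halgdef, ← hW, ← hR']
      field_simp
  have h3 := Finset.sum_le_sum h2
  have h4 : ∑ k ∈ Finset.range m, ((if k = 0 then (1 : ℝ) else 0) +
      ((1 - μ) * (Real.log policies.card / η * (1 / k) + 2 * η * W) + R')) ≤
      1 + ((1 - μ) * (Real.log policies.card / η * (1 + Real.log (B + m : ℕ)) +
        2 * η * (B + m : ℕ) * W) + (B + m : ℕ) * R') := by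
    rw [Finset.sum_add_distrib, Finset.sum_add_distrib, ← Finset.mul_sum, Finset.sum_add_distrib,
      ← Finset.mul_sum]
    simp only [Finset.sum_const, Finset.card_range, nsmul_eq_mul]
    have hm : (m : ℝ) ≤ (B + m : ℕ) := by exact_mod_cast Nat.le_add_left m B
    refine add_le_add ?_ (add_le_add (mul_le_mul_of_nonneg_left (add_le_add
      (mul_le_mul_of_nonneg_left (sum_range_inv_le (Nat.le_add_left m B)) (by positivity)) ?_) hμ1)
      (mul_le_mul_of_nonneg_right hm hR'0))
    · rw [Finset.sum_ite_eq']
      split_ifs <;> norm_num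
    · have := mul_le_mul_of_nonneg_right hm (by positivity : 0 ≤ 2 * η * W)
      linarith
  have h5 : R' = μ * ∫ w : Play X K B, s (plays w) ∂(interactionLaw D B alg) +
      2 * μ * √(meanSqError D) +
      ∫ w : Play X K B, remapBias D (B + m) (s (plays w)) ∂(interactionLaw D B alg) +
      1 / (B + m : ℕ) := by
    have t1 := H.tame.integrable halg H.good (D := D)
    have t2 := (H.tame.comp_continuous (continuous_remapBias (D := D) (B + m))).integrable halg
      H.good (D := D)
    have t3 : Integrable (fun w : Play X K B => μ * (s (plays w) + 2 * √(meanSqError D)))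
      (interactionLaw D B alg) := (t1.add (integrable_const _)).const_mul _
    have t4 : Integrable (fun w : Play X K B => remapBias D (B + m) (s (plays w)) +
      1 / ((B + m : ℕ) : ℝ)) (interactionLaw D B alg) := t2.add (integrable_const _)
    simp only [hR', hR]
    rw [integral_add t3 t4, integral_const_mul, integral_add t1 (integrable_const _),
      integral_add t2 (integrable_const _)]
    simp only [integral_const, probReal_univ, one_smul]
    ring
  -- The total of the 1/T terms; with the first greedy round it makes up the 2 in `B + 2`.
  have h6 : ((B + m : ℕ) : ℝ) * (1 / (B + m : ℕ)) = 1 := by field_simp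
  have h7 := h3.trans h4
  refine (add_le_add h1 h7).trans (le_of_eq ?_)
  rw [h5, mul_add _ _ (1 / ((B + m : ℕ) : ℝ)), h6]
  ring

end Regret

/-! ### Moments of the empirical bin frequencies and of the error estimate -/

section Exploration

variable {X : Type*} {K : ℕ}

/-- Number of observations whose prediction error lies in the `i`-th dyadic bin. -/
noncomputable def binCount (i : ℕ) (h : List (Observation X K)) : ℝ :=
  (h.map fun o => (dyadicBin i).indicator 1 |o.loss - o.pred o.action|).sum

lemma binCount_append (i : ℕ) (h : List (Observation X K)) (z : Outcome X K) (a : Fin K) :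
    binCount i (h ++ [observe z a]) =
      binCount i h + (dyadicBin i).indicator 1 |z.2.2 a - z.2.1 a| := by
  simp [binCount, observe]

lemma binFrequency_eq (B : ℕ) (h : List (Observation X K)) (i : ℕ) :
    binFrequency B h i = 1 / B * binCount i h := by
  unfold binFrequency binCount
  congr 3
  funext o
  by_cases ho : |o.loss - o.pred o.action| ∈ dyadicBin i
  · rw [Set.indicator_of_mem ho]
    exact if_pos ho
  · rw [Set.indicator_of_notMem ho]
    exact if_neg ho

lemma indicator_dyadicBin_le (i : ℕ) (x : ℝ) : (dyadicBin i).indicator (1 : ℝ → ℝ) x ≤ 1 :=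
  Set.indicator_le' (fun _ _ => le_rfl) (fun _ _ => zero_le_one) x

lemma indicator_dyadicBin_nonneg (i : ℕ) (x : ℝ) : 0 ≤ (dyadicBin i).indicator (1 : ℝ → ℝ) x :=
  Set.indicator_nonneg (fun _ _ => zero_le_one) x

lemma indicator_dyadicBin_mul_self (i : ℕ) (x : ℝ) :
    (dyadicBin i).indicator (1 : ℝ → ℝ) x * (dyadicBin i).indicator 1 x =
      (dyadicBin i).indicator 1 x := by
  by_cases h : x ∈ dyadicBin i <;> simp [h]

lemma indicator_dyadicBin_mul_le (i : ℕ) (x : ℝ) :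
    (dyadicBin i).indicator (1 : ℝ → ℝ) x * (1 / 2) ^ (2 * i) ≤ 4 * x ^ 2 := by
  by_cases h : x ∈ dyadicBin i
  · rw [Set.indicator_of_mem h, Pi.one_apply, one_mul]
    have h1 := pow_le_pow_left₀ (by positivity) h.1.le 2
    have e : ((1 / 2 : ℝ) ^ (i + 1)) ^ 2 = 1 / 4 * (1 / 2) ^ (2 * i) := by
      rw [← pow_mul, show (i + 1) * 2 = 2 * i + 2 by ring, pow_add]; norm_num; ring
    linarith
  · rw [Set.indicator_of_notMem h, zero_mul]
    positivity

lemma errorEstimate_nonneg (T B : ℕ) (h : List (Observation X K)) : 0 ≤ errorEstimate T B h :=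
  mul_nonneg (Nat.cast_nonneg _) (Finset.sum_nonneg fun _ _ =>
    mul_nonneg (le_max_right _ _) (by positivity))

variable [MeasurableSpace X]

lemma tame_binCount (i n : ℕ) : Tame fun w : Play X K n => binCount i (plays w) := by
  have e : ∀ w : Play X K n, binCount i (plays w) =
      ∑ t, (dyadicBin i).indicator 1 |(w.1 t).2.2 (w.2 t) - (w.1 t).2.1 (w.2 t)| := by
    intro w
    rw [binCount, plays, List.map_ofFn, List.sum_ofFn]
    rfl
  simp only [e]
  refine Tame.sum _ fun t _ => ⟨?_, 1, fun w _ => ?_⟩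
  · refine (measurable_one.indicator measurableSet_Ioc).comp (f := fun w : Play X K n =>
      |(w.1 t).2.2 (w.2 t) - (w.1 t).2.1 (w.2 t)|) ?_
    exact measurable_fin_eval (f := fun a (w : Play X K n) => |(w.1 t).2.2 a - (w.1 t).2.1 a|)
      (fun a => by fun_prop) (by fun_prop)
  · rw [abs_of_nonneg (indicator_dyadicBin_nonneg i _)]
    exact indicator_dyadicBin_le i _

variable {B : ℕ} {best : (Fin K → ℝ) → Fin K}
  {erm : List (X × (Fin K → ℝ)) → X → Fin K} {s : List (Observation X K) → ℝ} {μ : ℝ}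
  {D : Measure (Outcome X K)} {policies : Finset (X → Fin K)} [IsProbabilityMeasure D]

/-- Markov's inequality for the squared error: on the i-th bin, 2^(-i) is at most twice the error.
-/
lemma binProb_mul_le (hK : 0 < K) (hD : ∀ᵐ z ∂D, GoodOutcome z) (i : ℕ) :
    binProb D i * (1 / 2) ^ (2 * i) ≤ 4 * meanSqError D := by
  have hK' : (0 : ℝ) < K := by exact_mod_cast hK
  rw [binProb, mul_assoc, ← integral_mul_const, one_div, inv_mul_le_iff₀ hK', meanSqError,
    ← integral_const_mul, ← integral_const_mul]
  refine integral_mono ((integrable_sum_indicator i).mul_const _)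
    (((integrable_norm_sub_sq hD).const_mul _).const_mul _) fun z => ?_
  rw [Finset.sum_mul]
  refine (Finset.sum_le_card_nsmul _ _ (4 * ‖z.2.2 - z.2.1‖ ^ 2) fun a _ => ?_).trans (by simp)
  refine (indicator_dyadicBin_mul_le i _).trans ?_
  exact mul_le_mul_of_nonneg_left
    (pow_le_pow_left₀ (abs_nonneg _) (abs_sub_le_norm_sub z a) 2) (by norm_num)

lemma condExpect_explore (hK : 0 < K) {h : List (Observation X K)} (hB : h.length < B) (i : ℕ)
    (c₁ c₂ : ℝ) :
    condExpect D (twoPhase B best erm s μ) h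
      (fun z a => c₁ * (dyadicBin i).indicator 1 |z.2.2 a - z.2.1 a| + c₂) =
      c₁ * binProb D i + c₂ := by
  have hK' : (K : ℝ) ≠ 0 := by exact_mod_cast hK.ne'
  have e : ∀ z : Outcome X K, ∑ a, 1 / (K : ℝ) *
      (c₁ * (dyadicBin i).indicator 1 |z.2.2 a - z.2.1 a| + c₂) =
      c₁ * (1 / K) * ∑ a, (dyadicBin i).indicator 1 |z.2.2 a - z.2.1 a| + c₂ := by
    intro z
    rw [← Finset.mul_sum, Finset.sum_add_distrib, ← Finset.mul_sum]
    simp only [Finset.sum_const, Finset.card_univ, Fintype.card_fin, nsmul_eq_mul]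
    field_simp
  simp only [condExpect, twoPhase_of_lt hB, e]
  rw [integral_add ((integrable_sum_indicator i).const_mul _) (integrable_const _),
    integral_const_mul, binProb]
  simp [mul_assoc]

lemma TwoPhaseSetting.integral_binCount_le (H : TwoPhaseSetting D policies B best erm s μ)
    (i n : ℕ) (hn : n ≤ B) :
    ∫ w : Play X K n, (binCount i (plays w) - n * binProb D i)
      ∂(interactionLaw D n (twoPhase B best erm s μ)) ≤ 0 := by
  have hK := (best fun _ => 0).pos
  induction n with
  | zero => simp [binCount, plays]
  | succ n ih =>
    refine (integral_succ_le_of_add H.isRandomized H.good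
      ((tame_binCount i (n + 1)).sub (Tame.const _)) ((tame_binCount i n).sub (Tame.const _))
      (fun _ z a => 1 * (dyadicBin i).indicator 1 |z.2.2 a - z.2.1 a| + -binProb D i)
      (fun w z a => ?_) fun w _ => ?_).trans (ih (by omega))
    · rw [plays_snoc, binCount_append]
      push_cast
      ring
    · rw [condExpect_explore hK (by simp; omega)]
      linarith

/-- The variance of a sum of centred indicators, as a compensated square: each exploration round
adds conditional variance α - α² ≤ α. -/
lemma TwoPhaseSetting.integral_binCount_sq_le (H : TwoPhaseSetting D policies B best erm s μ)
    (i n : ℕ) (hn : n ≤ B) :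
    ∫ w : Play X K n, ((binCount i (plays w) - n * binProb D i) *
        (binCount i (plays w) - n * binProb D i) - n * binProb D i)
      ∂(interactionLaw D n (twoPhase B best erm s μ)) ≤ 0 := by
  have hK := (best fun _ => 0).pos
  have ht : ∀ n : ℕ, Tame fun w : Play X K n => (binCount i (plays w) - n * binProb D i) *
        (binCount i (plays w) - n * binProb D i) - n * binProb D i := fun n =>
    (((tame_binCount i n).sub (Tame.const _)).mul ((tame_binCount i n).sub (Tame.const _))).sub
      (Tame.const _)
  induction n with
  | zero => simp [binCount, plays]
  | succ n ih =>
    refine (integral_succ_le_of_add H.isRandomized H.good (ht (n + 1)) (ht n)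
      -- With Z the centred count and I the new indicator, this is (Z + I - α)² - Z² - α after I² =
      -- I, arranged to be affine in I; its conditional mean is -α².
      (fun w z a => (2 * (binCount i (plays w) - n * binProb D i) + 1 - 2 * binProb D i) *
        (dyadicBin i).indicator 1 |z.2.2 a - z.2.1 a| +
        (-2 * (binCount i (plays w) - n * binProb D i) * binProb D i + binProb D i ^ 2 -
          binProb D i)) (fun w z a => ?_) fun w _ => ?_).trans (ih (by omega))
    · rw [plays_snoc, binCount_append]
      have h := indicator_dyadicBin_mul_self i |z.2.2 a - z.2.1 a|
      push_cast
      linear_combination h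
    · rw [condExpect_explore hK (by simp; omega)]
      nlinarith [sq_nonneg (binProb D i)]

lemma sq_integral_abs_le {Ω : Type*} [MeasurableSpace Ω] {P : Measure Ω} [IsProbabilityMeasure P]
    {f : Ω → ℝ} (hf : Integrable f P) (hf2 : Integrable (fun w => f w * f w) P) :
    ∫ w, |f w| ∂P ≤ √(∫ w, f w * f w ∂P) := by
  refine Real.le_sqrt_of_sq_le ?_
  set c := ∫ w, |f w| ∂P with hc
  have h : 0 ≤ ∫ w, (f w * f w - 2 * c * |f w| + c ^ 2) ∂P :=
    integral_nonneg fun w => by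
      have := sq_nonneg (|f w| - c)
      have h2 := abs_mul_abs_self (f w)
      simp only [Pi.zero_apply]; nlinarith
  have i1 : Integrable (fun w => f w * f w - 2 * c * |f w|) P := hf2.sub (hf.abs.const_mul _)
  rw [integral_add i1 (integrable_const _), integral_sub hf2 (hf.abs.const_mul _),
    integral_const_mul, ← hc, integral_const] at h
  simp only [probReal_univ, one_smul] at h
  nlinarith

lemma TwoPhaseSetting.integral_abs_binFrequency_sub_le
    (H : TwoPhaseSetting D policies B best erm s μ) (hB : 1 ≤ B) (i : ℕ) :
    ∫ w : Play X K B, |binFrequency B (plays w) i - binProb D i|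
      ∂(interactionLaw D B (twoPhase B best erm s μ)) ≤ √(binProb D i / B) := by
  have hB' : (0 : ℝ) < B := by exact_mod_cast hB
  have hp := isProbabilityMeasure_interactionLaw (D := D) H.isRandomized B
  have ht : Tame fun w : Play X K B => binFrequency B (plays w) i - binProb D i := by
    simp only [binFrequency_eq]
    exact ((Tame.const _).mul (tame_binCount i B)).sub (Tame.const _)
  refine (sq_integral_abs_le (ht.integrable H.isRandomized H.good)
    ((ht.mul ht).integrable H.isRandomized H.good)).trans (Real.sqrt_le_sqrt ?_)
  have h := H.integral_binCount_sq_le i B le_rfl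
  have tc : Tame fun w : Play X K B => (binCount i (plays w) - B * binProb D i) *
      (binCount i (plays w) - B * binProb D i) :=
    ((tame_binCount i B).sub (Tame.const _)).mul ((tame_binCount i B).sub (Tame.const _))
  rw [integral_sub (tc.integrable H.isRandomized H.good) (integrable_const _)] at h
  simp only [integral_const, probReal_univ, one_smul] at h
  have e : ∀ w : Play X K B, (binFrequency B (plays w) i - binProb D i) *
      (binFrequency B (plays w) i - binProb D i) =
      1 / (B : ℝ) ^ 2 * ((binCount i (plays w) - B * binProb D i) *
      (binCount i (plays w) - B * binProb D i)) := by
    intro w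
    rw [binFrequency_eq]
    field_simp
  simp only [e]
  rw [integral_const_mul, one_div, inv_mul_le_iff₀ (by positivity)]
  have e2 : (B : ℝ) ^ 2 * (binProb D i / B) = B * binProb D i := by field_simp
  linarith

lemma tame_errorEstimate (T B n : ℕ) : Tame fun w : Play X K n => errorEstimate T B (plays w) := by
  refine (Tame.const _).mul (Tame.sum _ fun i _ => Tame.mul ?_ (Tame.const _))
  simp only [binFrequency_eq]
  exact (((Tame.const _).mul (tame_binCount i n)).sub (Tame.const _)).comp_continuous
    (G := fun x => max x 0) (by fun_prop)

/-- Dropping the correction 30 ln T / B only increases the estimate, and each bin then contributes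
at most 4𝓔 on average. -/
lemma TwoPhaseSetting.integral_errorEstimate_le
    (H : TwoPhaseSetting D policies B best erm s μ) (hB : 1 ≤ B) (T : ℕ) :
    ∫ w : Play X K B, errorEstimate T B (plays w)
      ∂(interactionLaw D B (twoPhase B best erm s μ)) ≤ 4 * numBins T * (T * meanSqError D) := by
  have hB' : (0 : ℝ) < B := by exact_mod_cast hB
  have hK := (best fun _ => 0).pos
  have hlog : 0 ≤ 30 * Real.log T / B := div_nonneg
    (mul_nonneg (by norm_num) (Real.log_natCast_nonneg T)) hB'.le
  have hp := isProbabilityMeasure_interactionLaw (D := D) H.isRandomized B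
  have hc0 : ∀ i (h : List (Observation X K)), 0 ≤ binFrequency B h i := fun i h => by
    rw [binFrequency_eq]
    refine mul_nonneg (by positivity) (List.sum_nonneg fun x hx => ?_)
    obtain ⟨o, -, rfl⟩ := List.mem_map.1 hx
    exact indicator_dyadicBin_nonneg i _
  have t1 : ∀ i, Tame fun w : Play X K B => binFrequency B (plays w) i := fun i => by
    simp only [binFrequency_eq]
    exact (Tame.const _).mul (tame_binCount i B)
  have t2 : Tame fun w : Play X K B => T * ∑ i ∈ Finset.range (numBins T),
      binFrequency B (plays w) i * (1 / 2 : ℝ) ^ (2 * i) :=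
    (Tame.const _).mul (Tame.sum _ fun i _ => (t1 i).mul (Tame.const _))
  refine (integral_mono ((tame_errorEstimate T B B).integrable H.isRandomized H.good)
    (t2.integrable H.isRandomized H.good) fun w => ?_).trans ?_
  · refine mul_le_mul_of_nonneg_left (Finset.sum_le_sum fun i _ =>
      mul_le_mul_of_nonneg_right (max_le ?_ (hc0 i _)) (by positivity)) (Nat.cast_nonneg _)
    linarith
  · rw [integral_const_mul, integral_finsetSum _ fun i _ =>
      ((t1 i).mul (Tame.const _)).integrable H.isRandomized H.good]
    have h : ∀ i ∈ Finset.range (numBins T), ∫ w : Play X K B,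
        binFrequency B (plays w) i * (1 / 2 : ℝ) ^ (2 * i)
        ∂(interactionLaw D B (twoPhase B best erm s μ)) ≤ 4 * meanSqError D := by
      intro i _
      refine le_trans ?_ (binProb_mul_le hK H.good i)
      rw [integral_mul_const]
      refine mul_le_mul_of_nonneg_right ?_ (by positivity)
      have h1 := H.integral_binCount_le i B le_rfl
      rw [integral_sub ((tame_binCount i B).integrable H.isRandomized H.good)
        (integrable_const _)] at h1
      simp only [integral_const, probReal_univ, one_smul] at h1
      simp only [binFrequency_eq]
      rw [integral_const_mul, one_div, inv_mul_le_iff₀ hB']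
      linarith
    have h2 := Finset.sum_le_card_nsmul _ _ _ h
    simp only [Finset.card_range, nsmul_eq_mul] at h2
    refine (mul_le_mul_of_nonneg_left h2 (Nat.cast_nonneg T)).trans (le_of_eq (by ring))

end Exploration

/-! ### The bias of a single bin -/

section Bias

/-- This is 2ys₀ ≤ y² + s₀². A large threshold thus makes the bias small without having to exceed
2y. -/
lemma max_two_mul_sub_le {y s s₀ : ℝ} (hs₀ : 0 < s₀) (hs : s₀ ≤ s) :
    max (2 * y - s) 0 ≤ y ^ 2 / s₀ := by
  refine max_le ?_ (by positivity)
  rw [le_div_iff₀ hs₀]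
  nlinarith [sq_nonneg (y - s₀)]

/-- The bias of one bin: it is small if the bin is rare or is detected, and detection fails only if
the empirical frequency is far from its mean. -/
lemma mul_max_two_mul_sub_le {α y s θ T u e a : ℝ} (hα : 0 ≤ α) (hy : 0 ≤ y)
    (hT : 0 < T) (hu : 0 < u) (hs : √e ≤ s * u) (hs0 : 0 ≤ s)
    (he : T * (max (a - θ) 0 * y ^ 2) ≤ e) :
    α * max (2 * y - s) 0 ≤
      4 * √(α * y ^ 2) * √θ + 2 * u * (√(α * y ^ 2) / √T) + 4 * y * |a - α| := by
  have hαy : 0 ≤ √(α * y ^ 2) := Real.sqrt_nonneg _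
  have h1 : 0 ≤ 4 * √(α * y ^ 2) * √θ := by positivity
  have h2 : 0 ≤ 2 * u * (√(α * y ^ 2) / √T) := by positivity
  have h3 : 0 ≤ 4 * y * |a - α| := by positivity
  have hle : α * max (2 * y - s) 0 ≤ 2 * α * y := by
    have : max (2 * y - s) 0 ≤ 2 * y := max_le (by linarith) (by linarith)
    nlinarith
  -- Rare bin: 2αy = 2√α·(√α y), and one √α is at most 2√θ.
  by_cases hsmall : α < 4 * θ
  · have e1 : √(α * y ^ 2) = √α * y := by rw [Real.sqrt_mul hα, Real.sqrt_sq hy]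
    have e2 : √α ≤ 2 * √θ := by
      rw [show (2 : ℝ) * √θ = √(4 * θ) by
        rw [Real.sqrt_mul (by norm_num), show (4 : ℝ) = 2 ^ 2 by norm_num,
          Real.sqrt_sq (by norm_num)]]
      exact Real.sqrt_le_sqrt hsmall.le
    have e3 : 2 * α * y ≤ 4 * √(α * y ^ 2) * √θ := by
      rw [e1]
      calc 2 * α * y = 2 * (√α * √α) * y := by rw [Real.mul_self_sqrt hα]
        _ = 2 * (√α * y) * √α := by ring
        _ ≤ 2 * (√α * y) * (2 * √θ) := by gcongr
        _ = _ := by ring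
    linarith
  -- Undetected bin: the deviation of the frequency is at least α/2.
  by_cases hdev : a < α / 2
  · have : α / 2 ≤ |a - α| := by
      rw [abs_sub_comm]
      exact le_trans (by linarith) (le_abs_self _)
    have : 2 * α * y ≤ 4 * y * |a - α| := by nlinarith
    linarith
  rcases (mul_nonneg hα (sq_nonneg y)).eq_or_lt with h0 | hpos
  · have hz : α = 0 ∨ y = 0 := by
      rcases mul_eq_zero.1 h0.symm with h | h
      · exact Or.inl h
      · exact Or.inr (by simpa using h)
    have : 2 * α * y = 0 := by rcases hz with h | h <;> simp [h]
    linarith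
  -- Detected bin: a - θ ≥ α/2 - α/4, so this bin alone keeps the error estimate, and with it the
  -- threshold, large.
  have hd : T * (α * y ^ 2) / 4 ≤ e := by
    refine le_trans ?_ he
    have : α / 4 ≤ max (a - θ) 0 := le_trans (by linarith) (le_max_left _ _)
    have := mul_le_mul_of_nonneg_right this (sq_nonneg y)
    nlinarith
  have hs1 : √T * √(α * y ^ 2) / 2 / u ≤ s := by
    rw [div_le_iff₀ hu]
    refine le_trans ?_ ((Real.sqrt_le_sqrt hd).trans hs)
    rw [Real.sqrt_div' _ (by norm_num), Real.sqrt_mul hT.le, show (4 : ℝ) = 2 ^ 2 by norm_num,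
      Real.sqrt_sq (by norm_num)]
  have hq : 0 < √(α * y ^ 2) := Real.sqrt_pos.2 hpos
  have hT' : 0 < √T := Real.sqrt_pos.2 hT
  have hfin := mul_le_mul_of_nonneg_left (max_two_mul_sub_le (y := y) (by positivity) hs1) hα
  have e4 : α * (y ^ 2 / (√T * √(α * y ^ 2) / 2 / u)) = 2 * u * (√(α * y ^ 2) / √T) := by
    have hsq := Real.mul_self_sqrt hpos.le
    field_simp
    linear_combination (-1 : ℝ) * hsq
  linarith

end Bias

/-! ### Expected remapping bias -/

section Explore

variable {X : Type*} {K : ℕ} [MeasurableSpace X] {B : ℕ} {best : (Fin K → ℝ) → Fin K}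
  {erm : List (X × (Fin K → ℝ)) → X → Fin K} {s : List (Observation X K) → ℝ} {μ : ℝ}
  {D : Measure (Outcome X K)} {policies : Finset (X → Fin K)} [IsProbabilityMeasure D]

lemma TwoPhaseSetting.integral_remapBias_le (H : TwoPhaseSetting D policies B best erm s μ)
    (hB : 1 ≤ B) {T : ℕ} (hT : 1 ≤ T) {u : ℝ} (hu : 0 < u)
    (hs : ∀ h, √(errorEstimate T B h) ≤ s h * u) :
    ∫ w : Play X K B, remapBias D T (s (plays w))
      ∂(interactionLaw D B (twoPhase B best erm s μ)) ≤
    numBins T * (K * (8 * √(meanSqError D) * √(30 * Real.log T / B) +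
      4 * u * (√(meanSqError D) / √T) + 8 * (√(meanSqError D) / √B))) := by
  have hK := (best fun _ => 0).pos
  have hT' : (0 : ℝ) < T := by exact_mod_cast hT
  have hB' : (0 : ℝ) < B := by exact_mod_cast hB
  have hp := isProbabilityMeasure_interactionLaw (D := D) H.isRandomized B
  set θ := 30 * Real.log T / B
  have ht : ∀ i, Tame fun w : Play X K B =>
      K * (binProb D i * max (2 * (1 / 2 : ℝ) ^ i - s (plays w)) 0) := fun i =>
    H.tame.comp_continuous (G := fun σ => K * (binProb D i * max (2 * (1 / 2 : ℝ) ^ i - σ) 0))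
      (by fun_prop)
  simp only [remapBias]
  rw [integral_finsetSum _ fun i _ => (ht i).integrable H.isRandomized H.good]
  refine (Finset.sum_le_card_nsmul _ _ (K * (8 * √(meanSqError D) * √θ +
      4 * u * (√(meanSqError D) / √T) + 8 * (√(meanSqError D) / √B))) fun i hi => ?_).trans
    (by simp)
  rw [integral_const_mul]
  refine mul_le_mul_of_nonneg_left ?_ (Nat.cast_nonneg K)
  have hbin : √(binProb D i * ((1 / 2 : ℝ) ^ i) ^ 2) ≤ 2 * √(meanSqError D) := by
    have h := binProb_mul_le hK H.good i
    rw [pow_mul'] at h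
    refine (Real.sqrt_le_sqrt h).trans (le_of_eq ?_)
    rw [Real.sqrt_mul (by norm_num), show (4 : ℝ) = 2 ^ 2 by norm_num, Real.sqrt_sq (by norm_num)]
  have tf : Tame fun w : Play X K B => binFrequency B (plays w) i - binProb D i := by
    simp only [binFrequency_eq]
    exact ((Tame.const _).mul (tame_binCount i B)).sub (Tame.const _)
  have ta := tf.comp_continuous (G := fun x => |x|) (by fun_prop)
  have tr : Tame fun w : Play X K B => 8 * √(meanSqError D) * √θ +
      4 * u * (√(meanSqError D) / √T) +
      4 * (1 / 2 : ℝ) ^ i * |binFrequency B (plays w) i - binProb D i| :=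
    (Tame.const _).add ((Tame.const _).mul ta)
  have tl : Tame fun w : Play X K B =>
      binProb D i * max (2 * (1 / 2 : ℝ) ^ i - s (plays w)) 0 :=
    H.tame.comp_continuous (G := fun σ => binProb D i * max (2 * (1 / 2 : ℝ) ^ i - σ) 0)
      (by fun_prop)
  refine (integral_mono (tl.integrable H.isRandomized H.good)
    (tr.integrable H.isRandomized H.good) fun w => ?_).trans ?_
  · refine (mul_max_two_mul_sub_le (θ := θ) (e := errorEstimate T B (plays w)) (binProb_nonneg i)
      (by positivity) hT' hu (hs _) (H.nonneg _) (a := binFrequency B (plays w) i) ?_).trans ?_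
    · rw [errorEstimate]
      refine mul_le_mul_of_nonneg_left ?_ hT'.le
      rw [← pow_mul']
      exact Finset.single_le_sum (f := fun i => max (binFrequency B (plays w) i - θ) 0 *
        (1 / 2 : ℝ) ^ (2 * i)) (fun i _ => mul_nonneg (le_max_right _ _) (by positivity)) hi
    · have h1 : 4 * √(binProb D i * ((1 / 2 : ℝ) ^ i) ^ 2) * √θ ≤
          4 * (2 * √(meanSqError D)) * √θ := by gcongr
      have h2 : 2 * u * (√(binProb D i * ((1 / 2 : ℝ) ^ i) ^ 2) / √T) ≤
          2 * u * (2 * √(meanSqError D) / √T) := by gcongr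
      have h3 : 2 * u * (2 * √(meanSqError D) / √T) = 4 * u * (√(meanSqError D) / √T) := by ring
      linarith
  · rw [integral_add (integrable_const _)
      (((Tame.const _).mul ta).integrable H.isRandomized H.good), integral_const_mul]
    simp only [integral_const, probReal_univ, one_smul]
    refine add_le_add le_rfl ?_
    have h1 := H.integral_abs_binFrequency_sub_le hB i
    -- The weight y turns the standard deviation √(α/B) into √(αy²/B), so rare bins of large error
    -- and frequent bins of small error are both covered by αy² ≤ 4v.
    have h2 : (1 / 2 : ℝ) ^ i * √(binProb D i / B) = √(binProb D i * ((1 / 2 : ℝ) ^ i) ^ 2) / √B := by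
      rw [Real.sqrt_div' _ hB'.le, Real.sqrt_mul (binProb_nonneg i), Real.sqrt_sq (by positivity)]
      ring
    calc 4 * (1 / 2 : ℝ) ^ i * ∫ w : Play X K B, |binFrequency B (plays w) i - binProb D i|
          ∂(interactionLaw D B (twoPhase B best erm s μ))
        ≤ 4 * (1 / 2 : ℝ) ^ i * √(binProb D i / B) := by gcongr
      _ = 4 * (√(binProb D i * ((1 / 2 : ℝ) ^ i) ^ 2) / √B) := by rw [mul_assoc, h2]
      _ ≤ 4 * (2 * √(meanSqError D) / √B) := by gcongr
      _ = _ := by ring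

/-- Uses 1/ln 2 < 2. -/
lemma numBins_le {T : ℕ} (hT : 1 ≤ T) : (numBins T : ℝ) ≤ 2 * (1 + Real.log T) := by
  have hlog : 0 ≤ Real.log T := Real.log_natCast_nonneg T
  have h1 : (⌈Real.logb 2 T⌉₊ : ℝ) < Real.logb 2 T + 1 :=
    Nat.ceil_lt_add_one (Real.logb_nonneg one_lt_two (by exact_mod_cast hT))
  have h2 : Real.logb 2 T ≤ 2 * Real.log T := by
    rw [Real.logb, div_le_iff₀ (Real.log_pos one_lt_two)]
    nlinarith [Real.log_two_gt_d9]
  rw [numBins]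
  push_cast
  linarith

end Explore

/-! ### Tuning of the parameters -/

section Arithmetic

/-- Here δ³ = d, τ³ = T, Λ = 1 + ln T, m is the number of bins, g bounds √𝓔 and S₂ is the second
moment of the threshold. The scale η = δ³/(Kg) is chosen so that L/η = g; the variance part then has
order Kδτ·E/g up to m. -/
lemma learning_cost_le {K δ τ m Λ E g S₂ v L : ℝ} (hK : 1 ≤ K) (hδ : 1 ≤ δ) (hτ : 1 ≤ τ)
    (hm : 1 ≤ m) (hΛ : 1 ≤ Λ) (hE : 0 ≤ E) (hg : 0 < g) (hEg : E ≤ g ^ 2)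
    (hv : E = τ ^ 3 * v) (hS : S₂ ≤ 4 * m * E / (δ * τ) ^ 2) (hL : δ ^ 3 = K * L) :
    (1 - min (δ ^ 2 / τ) 1) * (L / (δ ^ 3 / (K * g)) * Λ + 2 * (δ ^ 3 / (K * g)) * τ ^ 3 *
      (2 * S₂ + 2 * (K ^ 2 / min (δ ^ 2 / τ) 1) * v)) ≤ Λ * g + 20 * m * K * (δ * τ) * g := by
  have hδ0 : 0 < δ := by linarith
  have hτ0 : 0 < τ := by linarith
  have hK0 : 0 < K := by linarith
  -- If μ = 1 there is no greedy play, and the factor 1 - μ removes the whole term.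
  rcases le_total 1 (δ ^ 2 / τ) with h | h
  · rw [min_eq_right h, sub_self, zero_mul]
    positivity
  rw [min_eq_left h]
  have hL' : L = δ ^ 3 / K := by rw [hL]; field_simp
  have hv' : v = E / τ ^ 3 := by rw [hv]; field_simp
  have e1 : L / (δ ^ 3 / (K * g)) = g := by rw [hL']; field_simp
  have h1 : 2 * (δ ^ 3 / (K * g)) * τ ^ 3 * (2 * S₂ + 2 * (K ^ 2 / (δ ^ 2 / τ)) * v) ≤
      2 * (δ ^ 3 / (K * g)) * τ ^ 3 *
        (2 * (4 * m * E / (δ * τ) ^ 2) + 2 * (K ^ 2 / (δ ^ 2 / τ)) * v) := by gcongr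
  have e2 : 2 * (δ ^ 3 / (K * g)) * τ ^ 3 *
      (2 * (4 * m * E / (δ * τ) ^ 2) + 2 * (K ^ 2 / (δ ^ 2 / τ)) * v) =
      2 * (δ * τ) * (8 * m + 2 * K ^ 2) / K * (E / g) := by
    rw [hv']; field_simp; ring
  have h2 : E / g ≤ g := by rw [div_le_iff₀ hg]; nlinarith
  have h3 : (8 * m + 2 * K ^ 2) / K ≤ 10 * m * K := by
    rw [div_le_iff₀ hK0]
    nlinarith [mul_nonneg (sub_nonneg.2 hm) (sq_nonneg K), mul_le_mul hK hK (by norm_num) hK0.le]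
  have h4 : 2 * (δ * τ) * (8 * m + 2 * K ^ 2) / K * (E / g) ≤ 20 * m * K * (δ * τ) * g := by
    calc 2 * (δ * τ) * (8 * m + 2 * K ^ 2) / K * (E / g) =
        2 * (δ * τ) * ((8 * m + 2 * K ^ 2) / K) * (E / g) := by ring
      _ ≤ 2 * (δ * τ) * (10 * m * K) * g := by gcongr
      _ = _ := by ring
  have h5 : 0 ≤ 2 * (δ * τ) * (8 * m + 2 * K ^ 2) / K * (E / g) := by positivity
  rw [e1]
  have h6 : g * Λ + 2 * (δ ^ 3 / (K * g)) * τ ^ 3 * (2 * S₂ + 2 * (K ^ 2 / (δ ^ 2 / τ)) * v) ≤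
      Λ * g + 20 * m * K * (δ * τ) * g := by linarith
  have h7 : 0 ≤ Λ * g + 20 * m * K * (δ * τ) * g := by positivity
  have h8 : 0 ≤ δ ^ 2 / τ := by positivity
  calc (1 - δ ^ 2 / τ) * _ ≤ (1 - δ ^ 2 / τ) * (Λ * g + 20 * m * K * (δ * τ) * g) :=
        mul_le_mul_of_nonneg_left h6 (by linarith)
    _ ≤ _ := mul_le_of_le_one_left h7 (by linarith)

lemma exploration_cost_le {δ τ m e t S₁ r : ℝ} (hδ : 1 ≤ δ) (hτ : 1 ≤ τ)
    (he : 0 ≤ e) (ht : 0 < t) (htτ : t ^ 2 = τ ^ 3) (hm : 0 ≤ m)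
    (hS : S₁ ≤ 2 * m * e / (δ * τ)) (hr : r = e / t) :
    τ ^ 3 * (min (δ ^ 2 / τ) 1 * S₁ + 2 * min (δ ^ 2 / τ) 1 * r) ≤
      2 * m * e * (δ * τ) + 2 * e * (δ * τ) := by
  have hδ0 : 0 < δ := by linarith
  have hτ0 : 0 < τ := by linarith
  set μ := min (δ ^ 2 / τ) 1 with hμ
  have hμ0 : 0 ≤ μ := le_min (by positivity) zero_le_one
  have h1 : μ * τ ≤ δ ^ 2 := by
    rw [← le_div_iff₀ hτ0]
    exact min_le_left _ _
  have hμ1 : μ ≤ 1 := min_le_right _ _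
  -- With t = √T: (μt)² = μ·(μτ)·τ², where μ ≤ 1 and μτ ≤ δ².
  have h2 : μ * t ≤ δ * τ := by
    refine le_of_sq_le_sq ?_ (by positivity)
    have : (μ * t) ^ 2 = μ * (μ * τ) * τ ^ 2 := by rw [mul_pow, htτ]; ring
    rw [this]
    calc μ * (μ * τ) * τ ^ 2 ≤ 1 * δ ^ 2 * τ ^ 2 := by gcongr
      _ = _ := by ring
  have h3 : τ ^ 3 * (μ * S₁) ≤ 2 * m * e * (δ * τ) := by
    calc τ ^ 3 * (μ * S₁) ≤ τ ^ 3 * (μ * (2 * m * e / (δ * τ))) := by gcongr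
      _ = (μ * τ) * (2 * m * e * τ / δ) := by field_simp
      _ ≤ δ ^ 2 * (2 * m * e * τ / δ) := by gcongr
      _ = _ := by field_simp
  have h4 : τ ^ 3 * (2 * μ * r) ≤ 2 * e * (δ * τ) := by
    rw [hr, ← htτ]
    calc t ^ 2 * (2 * μ * (e / t)) = 2 * e * (μ * t) := by field_simp
      _ ≤ _ := by gcongr
  linarith

/-- Used with e = √𝓔, t = √T, b = √B, r = √v; here θ stands for the square root of the frequency
correction. -/
lemma bias_cost_le {K u m Λ e t b θ r T : ℝ} (hK : 0 ≤ K) (hm : 0 ≤ m) (he : 0 ≤ e)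
    (ht : 0 < t) (htT : t ^ 2 = T) (hb : 0 < b) (hθ : θ ≤ 6 * Λ / b) (hΛ : 1 ≤ Λ)
    (hr : r = e / t) :
    T * (m * (K * (8 * r * θ + 4 * u * (r / t) + 8 * (r / b)))) ≤
      m * K * (56 * Λ * (e * t / b) + 4 * u * e) := by
  have e1 : T * (m * (K * (8 * r * θ + 4 * u * (r / t) + 8 * (r / b)))) =
      m * K * (8 * e * t * θ + 4 * u * e + 8 * (e * t / b)) := by
    rw [hr, ← htT]; field_simp
  rw [e1]
  refine mul_le_mul_of_nonneg_left ?_ (mul_nonneg hm hK)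
  have h1 : 8 * e * t * θ ≤ 48 * Λ * (e * t / b) := by
    calc 8 * e * t * θ ≤ 8 * e * t * (6 * Λ / b) := by gcongr
      _ = _ := by ring
  have h2 : e * t / b ≤ Λ * (e * t / b) := le_mul_of_one_le_left (by positivity) hΛ
  linarith

/-- The constant 112 = 2 · 56 comes from the bias term in q = √(𝓔T/B); the other terms need less. -/
lemma total_cost_le {B K u m Λ g e q : ℝ} (hB : 1 ≤ B) (hK : 1 ≤ K) (hu : 1 ≤ u) (hm : m ≤ 2 * Λ)
    (hΛ : 1 ≤ Λ) (he : 0 ≤ e) (heg : e ≤ g) (hq : 0 ≤ q) :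
    B + 2 + (Λ * g + 20 * m * K * u * g) + ((2 * m * e * u + 2 * e * u) +
      m * K * (56 * Λ * q + 4 * u * e)) ≤ 112 * Λ ^ 2 * (B + K * q + K ^ 2 * g * u) := by
  have hg : 0 ≤ g := he.trans heg
  have hΛ2 : Λ ≤ Λ ^ 2 := by nlinarith
  have hΛ3 : 1 ≤ Λ ^ 2 := by nlinarith
  have hK2 : K ≤ K ^ 2 := by nlinarith
  have hug : 0 ≤ u * g := by positivity
  have hP : g ≤ K ^ 2 * g * u := by
    calc g = 1 * g * 1 := by ring
      _ ≤ K ^ 2 * g * u := by gcongr; nlinarith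
  have hQ : u * g ≤ K ^ 2 * g * u := by
    calc u * g = 1 * g * u := by ring
      _ ≤ K ^ 2 * g * u := by gcongr; nlinarith
  have hR : K * (u * g) ≤ K ^ 2 * g * u := by
    calc K * (u * g) = K * g * u := by ring
      _ ≤ K ^ 2 * g * u := by gcongr
  set P := K ^ 2 * g * u
  have hP0 : 0 ≤ P := hug.trans hQ
  have hue : e * u ≤ P := (by nlinarith : e * u ≤ u * g).trans hQ
  have hKue : K * (u * e) ≤ P := (by gcongr : K * (u * e) ≤ K * (u * g)).trans hR
  have a1 : Λ * g ≤ Λ ^ 2 * P := by gcongr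
  have a2 : 20 * m * K * u * g ≤ 40 * (Λ ^ 2 * P) := by
    calc 20 * m * K * u * g = 20 * m * (K * (u * g)) := by ring
      _ ≤ 20 * (2 * Λ) * (K * (u * g)) := by gcongr
      _ = 40 * (Λ * (K * (u * g))) := by ring
      _ ≤ 40 * (Λ ^ 2 * P) := by gcongr
  have a3 : 2 * m * e * u ≤ 4 * (Λ ^ 2 * P) := by
    calc 2 * m * e * u = 2 * m * (e * u) := by ring
      _ ≤ 2 * (2 * Λ) * (e * u) := by gcongr
      _ = 4 * (Λ * (e * u)) := by ring
      _ ≤ 4 * (Λ ^ 2 * P) := by gcongr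
  have a4 : e * u ≤ Λ ^ 2 * P := hue.trans (le_mul_of_one_le_left hP0 hΛ3)
  have a5 : m * K * (4 * u * e) ≤ 8 * (Λ ^ 2 * P) := by
    calc m * K * (4 * u * e) = 4 * m * (K * (u * e)) := by ring
      _ ≤ 4 * (2 * Λ) * (K * (u * e)) := by gcongr
      _ = 8 * (Λ * (K * (u * e))) := by ring
      _ ≤ 8 * (Λ ^ 2 * P) := by gcongr
  have a6 : m * K * (56 * Λ * q) ≤ 112 * (Λ ^ 2 * (K * q)) := by
    calc m * K * (56 * Λ * q) ≤ (2 * Λ) * K * (56 * Λ * q) := by gcongr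
      _ = _ := by ring
  have a7 : B + 2 ≤ 3 * (Λ ^ 2 * B) := by nlinarith
  have a8 : 0 ≤ Λ ^ 2 * P := by positivity
  have a9 : 0 ≤ Λ ^ 2 * B := by positivity
  nlinarith

/-- Removes the division by √E in the choice of η: when E = 0, V tends to 0. -/
lemma le_add_mul_sqrt_of_forall {r a c E : ℝ} (hE : 0 ≤ E) (hc : 0 ≤ c)
    (h : ∀ V, 0 < V → E ≤ V → r ≤ a + c * √V) : r ≤ a + c * √E := by
  rcases hE.eq_or_lt with h0 | h0
  · subst h0
    rw [Real.sqrt_zero, mul_zero, add_zero]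
    refine le_of_forall_pos_le_add fun ε hε => ?_
    have hq : 0 < ε / (c + 1) := by positivity
    have h1 := h ((ε / (c + 1)) ^ 2) (by positivity) (by positivity)
    rw [Real.sqrt_sq hq.le] at h1
    have h2 : c * (ε / (c + 1)) ≤ ε := by
      rw [mul_div_assoc', div_le_iff₀ (by linarith)]
      nlinarith
    linarith
  · exact h E h0 le_rfl

end Arithmetic

/-! ### Assembly -/

section Main

variable {X : Type*} {K : ℕ} [MeasurableSpace X] {B : ℕ} {best : (Fin K → ℝ) → Fin K}
  {erm : List (X × (Fin K → ℝ)) → X → Fin K} {D : Measure (Outcome X K)}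
  {policies : Finset (X → Fin K)} [IsProbabilityMeasure D]

lemma two_le_of_card {α : Type*} {K : ℕ} {s : Finset (α → Fin K)} (hs : 2 ≤ s.card) : 2 ≤ K := by
  by_contra h
  have : Subsingleton (Fin K) := by
    rw [Fin.subsingleton_iff_le_one]; omega
  have h1 := Finset.card_le_one_of_subsingleton s
  omega

set_option maxHeartbeats 1600000 in
/-- Regret of `ε`-Greedy.VAR with the exponents `1 / 3` made explicit. -/
lemma regret_epsGreedyVAR_le {T : ℕ} {E d : ℝ} (hT : 1 ≤ T) (hD : ∀ᵐ z ∂D, GoodOutcome z)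
    (hmeas : ∀ π ∈ policies, Measurable π) (hcard : 2 ≤ policies.card) (hb : IsArgmin best)
    (herm : IsERMOracle policies erm) (hE : E = predictionError D T)
    (hd : d = K * Real.log policies.card) (hB : 1 ≤ B) (hBT : B ≤ T) :
    regret D T policies (epsGreedyVAR T B d best erm) ≤
      112 * (1 + Real.log T) ^ 2 *
        (B + K * √(E * T / B) + K ^ 2 * √E * (d * T) ^ (1 / 3 : ℝ)) := by
  have hK2 : (2 : ℝ) ≤ K := by exact_mod_cast two_le_of_card hcard
  have hK1 : (1 : ℝ) ≤ K := by linarith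
  have hT1 : (1 : ℝ) ≤ T := by exact_mod_cast hT
  have hT0 : (0 : ℝ) < T := by linarith
  have hB1 : (1 : ℝ) ≤ B := by exact_mod_cast hB
  have hB0 : (0 : ℝ) < B := by linarith
  have hcard' : (2 : ℝ) ≤ policies.card := by exact_mod_cast hcard
  have hlogN : Real.log 2 ≤ Real.log policies.card := Real.log_le_log (by norm_num) hcard'
  -- Two policies require K ≥ 2 and N ≥ 2, and 2 ln 2 > 1.
  have hd1 : 1 ≤ d := by
    rw [hd]; nlinarith [Real.log_two_gt_d9]
  have hd0 : 0 < d := by linarith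
  set δ := d ^ (1 / 3 : ℝ) with hδ
  set τ := (T : ℝ) ^ (1 / 3 : ℝ) with hτ
  have hδ1 : 1 ≤ δ := Real.one_le_rpow hd1 (by norm_num)
  have hτ1 : 1 ≤ τ := Real.one_le_rpow hT1 (by norm_num)
  have hδ0 : 0 < δ := by linarith
  have hτ0 : 0 < τ := by linarith
  have hδ3 : δ ^ 3 = d := by
    rw [hδ, ← Real.rpow_natCast, ← Real.rpow_mul hd0.le]; norm_num
  have hτ3 : τ ^ 3 = T := by
    rw [hτ, ← Real.rpow_natCast, ← Real.rpow_mul hT0.le]; norm_num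
  have hδ2 : d ^ (2 / 3 : ℝ) = δ ^ 2 := by
    rw [hδ, ← Real.rpow_natCast, ← Real.rpow_mul hd0.le]; norm_num
  have hu : (d * T) ^ (1 / 3 : ℝ) = δ * τ := Real.mul_rpow hd0.le hT0.le
  have hu' : (d * T) ^ (-(1 / 3) : ℝ) = (δ * τ)⁻¹ := by
    rw [Real.rpow_neg (by positivity), hu]
  have hu0 : 0 < δ * τ := by positivity
  have hu1 : 1 ≤ δ * τ := by nlinarith
  set s : List (Observation X K) → ℝ := fun h => √(errorEstimate T B h) * (δ * τ)⁻¹ with hs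
  set μ := min (δ ^ 2 / τ) 1 with hμ
  have halg : epsGreedyVAR T B d best erm = twoPhase B best erm s μ := by
    rw [hs, hμ, ← hu', ← hδ2]
    rfl
  have H : TwoPhaseSetting D policies B best erm s μ := by
    refine ⟨hD, hmeas, hb, herm, lt_min (by positivity) one_pos, min_le_right _ _,
      fun h => by positivity, ?_⟩
    exact (tame_errorEstimate T B B).comp_continuous (G := fun x => √x * (δ * τ)⁻¹) (by fun_prop)
  have hp := isProbabilityMeasure_interactionLaw (D := D) H.isRandomized B
  set v := meanSqError D with hv
  have hv0 : 0 ≤ v := meanSqError_nonneg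
  have hEv : E = T * v := hE
  have hE0 : 0 ≤ E := by rw [hEv]; positivity
  set m : ℝ := (numBins T : ℝ) with hm
  have hm1 : 1 ≤ m := by rw [hm, numBins]; push_cast; linarith [Nat.cast_nonneg (α := ℝ) ⌈Real.logb 2 T⌉₊]
  have hmΛ : m ≤ 2 * (1 + Real.log T) := numBins_le hT
  set Λ := 1 + Real.log T with hΛ
  have hlogT : 0 ≤ Real.log T := Real.log_natCast_nonneg T
  have hΛ1 : 1 ≤ Λ := by linarith
  set S₁ := ∫ w : Play X K B, s (plays w) ∂(interactionLaw D B (twoPhase B best erm s μ)) with hS₁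
  set S₂ := ∫ w : Play X K B, s (plays w) * s (plays w)
    ∂(interactionLaw D B (twoPhase B best erm s μ)) with hS₂
  have bS₂ : S₂ ≤ 4 * m * E / (δ * τ) ^ 2 := by
    have h1 := H.integral_errorEstimate_le hB T
    have e : ∀ w : Play X K B, s (plays w) * s (plays w) =
        errorEstimate T B (plays w) * ((δ * τ) ^ 2)⁻¹ := fun w => by
      simp only [hs]
      rw [mul_mul_mul_comm, Real.mul_self_sqrt (errorEstimate_nonneg T B _), ← mul_inv, ← sq]
    simp only [hS₂, e]
    rw [integral_mul_const, ← div_eq_mul_inv, hEv]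
    gcongr
  have bS₁ : S₁ ≤ 2 * m * √E / (δ * τ) := by
    have h1 := sq_integral_abs_le (H.tame.integrable H.isRandomized H.good (D := D))
      ((H.tame.mul H.tame).integrable H.isRandomized H.good)
    simp only [abs_of_nonneg (H.nonneg _)] at h1
    refine h1.trans ((Real.sqrt_le_sqrt bS₂).trans ?_)
    refine Real.sqrt_le_iff.2 ⟨by positivity, ?_⟩
    rw [div_pow, mul_pow, mul_pow, Real.sq_sqrt hE0]
    -- Since m ≥ 1, the square root of m may be replaced by m.
    have h4 : 4 * m ≤ (2 * m) ^ 2 := by nlinarith only [hm1]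
    gcongr
  have bW : ∫ w : Play X K B, costVariance D (s (plays w)) μ
      ∂(interactionLaw D B (twoPhase B best erm s μ)) = 2 * S₂ + 2 * (K ^ 2 / μ) * v := by
    have i1 := (H.tame.mul H.tame).integrable H.isRandomized H.good (D := D)
    simp only [costVariance, sq (s _)]
    rw [integral_add (i1.const_mul _) (integrable_const _), integral_const_mul]
    simp only [integral_const, probReal_univ, one_smul]
    rfl
  have hbias := H.integral_remapBias_le hB hT hu0 (fun h => by
    simp only [hs]; rw [mul_assoc, inv_mul_cancel₀ hu0.ne', mul_one])
  have hsT : √(T : ℝ) ^ 2 = T := Real.sq_sqrt hT0.le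
  have hr : √v = √E / √T := by
    rw [hEv, Real.sqrt_mul hT0.le]
    have := Real.sqrt_pos.2 hT0
    field_simp
  have hθ : √(30 * Real.log T / B) ≤ 6 * Λ / √B := by
    rw [Real.sqrt_div' _ hB0.le]
    gcongr
    refine Real.sqrt_le_iff.2 ⟨by positivity, ?_⟩
    nlinarith only [hlogT, hΛ]
  have hq : √(E * T / B) = √E * √T / √B := by
    rw [Real.sqrt_div' _ hB0.le, Real.sqrt_mul hE0]
  rw [regret, halg]
  have hne : Nonempty policies := by
    obtain ⟨π, hπ⟩ := Finset.card_pos.1 (by omega : 0 < policies.card)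
    exact ⟨⟨π, hπ⟩⟩
  refine ciSup_le fun π => ?_
  -- A positive V above E keeps η well defined even when all predictions are exact.
  have key : ∀ V, 0 < V → E ≤ V → ∫ w : Play X K T,
      (∑ t, (w.1 t).2.2 (w.2 t) - ∑ t, (w.1 t).2.2 (π.1 (w.1 t).1))
      ∂(interactionLaw D T (twoPhase B best erm s μ)) ≤
      112 * Λ ^ 2 * (B + K * √(E * T / B)) + 112 * Λ ^ 2 * K ^ 2 * (δ * τ) * √V := by
    intro V hV hEV
    have hg : 0 < √V := Real.sqrt_pos.2 hV
    have hη : 0 < δ ^ 3 / (K * √V) := by positivity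
    have h0 := H.regret_le hη hT hBT π.2
    have h1 := learning_cost_le (L := Real.log policies.card) hK1 hδ1 hτ1 hm1 hΛ1 hE0 hg
      (by rwa [Real.sq_sqrt hV.le]) (by rw [hτ3]; exact hEv) bS₂ (by rw [hδ3, hd])
    have h2 := exploration_cost_le hδ1 hτ1 (Real.sqrt_nonneg E) (Real.sqrt_pos.2 hT0)
      (by rw [hτ3, hsT]) (by linarith) bS₁ hr
    have h3 := bias_cost_le (u := δ * τ) (K := K) (m := m) (by positivity) (by linarith)
      (Real.sqrt_nonneg E) (Real.sqrt_pos.2 hT0) hsT (Real.sqrt_pos.2 hB0) hθ hΛ1 hr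
    have h4 := total_cost_le hB1 hK1 hu1 hmΛ hΛ1 (Real.sqrt_nonneg E) (Real.sqrt_le_sqrt hEV)
      (q := √E * √T / √B) (by positivity)
    rw [bW, ← hS₁] at h0
    rw [← hμ, hτ3] at h1 h2
    have h5 := mul_le_mul_of_nonneg_left hbias hT0.le
    rw [hq]
    have e1 : 112 * Λ ^ 2 * (B + K * (√E * √T / √B)) + 112 * Λ ^ 2 * K ^ 2 * (δ * τ) * √V =
      112 * Λ ^ 2 * (B + K * (√E * √T / √B) + K ^ 2 * √V * (δ * τ)) := by ring
    rw [e1]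
    refine h0.trans (le_trans ?_ h4)
    refine add_le_add (add_le_add le_rfl h1) ?_
    rw [mul_add]
    exact add_le_add h2 (h5.trans h3)
  have hfin := le_add_mul_sqrt_of_forall hE0 (by positivity) key
  refine hfin.trans (le_of_eq ?_)
  rw [hu]
  ring

end Main

theorem theorem8 :
    ∃ (C : ℝ) (p : ℕ), 0 < C ∧
      ∀ (X : Type*) [MeasurableSpace X] (K T : ℕ)
        (D : Measure (Outcome X K)) [IsProbabilityMeasure D]
        (policies : Finset (X → Fin K))
        (best : (Fin K → ℝ) → Fin K) (erm : List (X × (Fin K → ℝ)) → X → Fin K)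
        (E d : ℝ),
        1 ≤ T →
        (∀ᵐ z ∂D, ∀ a, z.2.1 a ∈ Set.Icc (0 : ℝ) 1 ∧ z.2.2 a ∈ Set.Icc (0 : ℝ) 1) →
        (∀ π ∈ policies, Measurable π) →
        2 ≤ policies.card →
        IsArgmin best →
        IsERMOracle policies erm →
        E = predictionError D T →
        d = K * Real.log policies.card →
        (∀ B : ℕ, 1 ≤ B → B ≤ T →
          regret D T policies (epsGreedyVAR T B d best erm) ≤
            C * (1 + Real.log T) ^ p *
              (B + K * √(E * T / B) + K ^ 2 * √E * (d * T) ^ (1 / 3 : ℝ))) ∧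
        (1 ≤ K ^ 2 * √E * d ^ (1 / 3 : ℝ) →
          regret D T policies (epsGreedyVAR T ⌈(T : ℝ) ^ (1 / 3 : ℝ)⌉₊ d best erm) ≤
            C * (1 + Real.log T) ^ p * (K ^ 2 * √E * (d * T) ^ (1 / 3 : ℝ))) := by
  -- 448 = 4 · 112: for B = ⌈T^(1/3)⌉ the three terms are at most 2R, R and R.
  refine ⟨448, 2, by norm_num, ?_⟩
  intro X _ K T D _ policies best erm E d hT hD hmeas hcard hb herm hE hd
  have main : ∀ B : ℕ, 1 ≤ B → B ≤ T → _ := fun B hB hBT =>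
    regret_epsGreedyVAR_le (B := B) hT hD hmeas hcard hb herm hE hd hB hBT
  have hE0 : 0 ≤ E := by
    rw [hE, predictionError]
    exact mul_nonneg (Nat.cast_nonneg _) (integral_nonneg fun _ => by positivity)
  have hT1 : (1 : ℝ) ≤ T := by exact_mod_cast hT
  have hT0 : (0 : ℝ) < T := by linarith
  have hlogT : 0 ≤ Real.log T := Real.log_natCast_nonneg T
  have hK2 : (2 : ℝ) ≤ K := by exact_mod_cast two_le_of_card hcard
  have hd1 : 1 ≤ d := by
    have hcard' : (2 : ℝ) ≤ policies.card := by exact_mod_cast hcard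
    have hlogN : Real.log 2 ≤ Real.log policies.card := Real.log_le_log (by norm_num) hcard'
    rw [hd]; nlinarith [Real.log_two_gt_d9]
  refine ⟨fun B hB hBT => (main B hB hBT).trans ?_, fun hlarge => ?_⟩
  · have h0 : 0 ≤ (1 + Real.log T) ^ 2 *
        (B + K * √(E * T / B) + K ^ 2 * √E * (d * T) ^ (1 / 3 : ℝ)) := by positivity
    linarith
  · set τ := (T : ℝ) ^ (1 / 3 : ℝ) with hτ
    have hτ1 : 1 ≤ τ := Real.one_le_rpow hT1 (by norm_num)
    have hτ3 : τ ^ 3 = T := by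
      rw [hτ, ← Real.rpow_natCast, ← Real.rpow_mul hT0.le]; norm_num
    have hδ1 : 1 ≤ d ^ (1 / 3 : ℝ) := Real.one_le_rpow hd1 (by norm_num)
    have hu : (d * T) ^ (1 / 3 : ℝ) = d ^ (1 / 3 : ℝ) * τ :=
      Real.mul_rpow (by linarith) hT0.le
    have hB1 : 1 ≤ ⌈τ⌉₊ := Nat.one_le_ceil_iff.2 (by linarith)
    have hBT : ⌈τ⌉₊ ≤ T := Nat.ceil_le.2 (by rw [← hτ3]; nlinarith [sq_nonneg (τ - 1)])
    refine (main _ hB1 hBT).trans ?_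
    have hBτ : (⌈τ⌉₊ : ℝ) ≤ 2 * τ := by
      have := Nat.ceil_lt_add_one (by linarith : 0 ≤ τ)
      linarith
    have hτB : τ ≤ ⌈τ⌉₊ := Nat.le_ceil τ
    set R := K ^ 2 * √E * (d * T) ^ (1 / 3 : ℝ) with hR
    have hR' : R = (K ^ 2 * √E * d ^ (1 / 3 : ℝ)) * τ := by rw [hR, hu]; ring
    -- The only use of the largeness assumption: it absorbs the cost B ≤ 2τ of exploration.
    have h1 : τ ≤ R := by rw [hR']; exact le_mul_of_one_le_left (by linarith) hlarge
    have h2 : K * √(E * T / ⌈τ⌉₊) ≤ R := by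
      have h3 : √(E * T / ⌈τ⌉₊) ≤ √E * τ := by
        refine Real.sqrt_le_iff.2 ⟨by positivity, ?_⟩
        rw [mul_pow, Real.sq_sqrt hE0, div_le_iff₀ (by linarith), ← hτ3]
        calc E * τ ^ 3 = E * τ ^ 2 * τ := by ring
          _ ≤ E * τ ^ 2 * ⌈τ⌉₊ := by gcongr
      calc K * √(E * T / ⌈τ⌉₊) ≤ K * (√E * τ) := by gcongr
        _ = K * √E * 1 * τ := by ring
        _ ≤ K ^ 2 * √E * d ^ (1 / 3 : ℝ) * τ := by gcongr; nlinarith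
        _ = R := hR'.symm
    have h4 : (⌈τ⌉₊ : ℝ) + K * √(E * T / ⌈τ⌉₊) + R ≤ 4 * R := by linarith
    calc 112 * (1 + Real.log T) ^ 2 * ((⌈τ⌉₊ : ℝ) + K * √(E * T / ⌈τ⌉₊) + R)
        ≤ 112 * (1 + Real.log T) ^ 2 * (4 * R) := by gcongr
      _ = _ := by ring
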